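/- Consider the Cauchy problem for the one-dimensional defocusing damped wave equation $$\partial_t^2u+\partial_tu-\partial_x^2u+u^p=0\quad (t>0,\ x\in\mathbb R),\qquad u(0)=u_0,\quad \partial_tu(0)=u_1,\qquad p>1.$$ Let $$S(t)f(x)=\frac{e^{-t/2}}2\int_{-t}^{t}I_0\Big(\frac{\sqrt{t^2-y^2}}2\Big)f(x-y)\,dy,$$ where $I_0$ is the modified Bessel function of the first kind of order $0$. A mild solution is a non-negative (measurable) function $u$ on $[0,\infty)\times\mathbb R$, with $u^p$ locally integrable, such that for every $t\ge0$ and almost every $x\in\mathbb R$ $$u(t,x)=S(t)(u_0+u_1)(x)+\partial_tS(t)u_0(x)-\int_0^tS(t-\tau)u^p(\tau)(x)\,d\tau .$$ **Theorem.** Let $p>1$ and let $\phi\in W^{1,1}\cap W^{1,\infty}(\mathbb R;(0,\infty))$. Assume that there is a constant $K$ such that, for almost every $x\in\mathbb R$, $$\phi(x)\le K\inf_{y\in(x-1,x+1)}\phi(y),\qquad \phi(x)\le K\inf_{|y|<2|x|}\phi(y),\qquad |\phi'(x)|\le K\phi(x),$$ and that for every $\delta>0$ there is $K_\delta>0$ such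 that $e^{-\delta|x|}\le K_\delta\,\phi(x)$ for almost every $x\in\mathbb R$ (the infima are taken up to null sets). Then there exist $C>0$ and $T_{\min}>0$ such that for every $T_0\ge T_{\min}$ there is $\varepsilon_{\max}>0$ such that for every $\varepsilon_0\in(0,\varepsilon_{\max}]$ the following holds. If $u_0\in W^{1,1}\cap W^{1,\infty}(\mathbb R)$ and $u_1\in L^1\cap L^\infty(\mathbb R)$ satisfy $$0\le u_0(x)\le C\,\frac{\varepsilon_0}{T_0^{\,p-1/2}}\,\phi(x),\qquad 0\le u_1(x)+\tfrac12u_0(x)\le C\,\frac{\varepsilon_0}{T_0^{\,p-1/2}}\,\phi(x)$$ for almost every $x\in\mathbb R$, then every mild solution $u$ satisfies $$0\le u(t,x)\le C\left(\frac{u_L(t+T_0,x)^{p-1}}{(t+T_0)\,u_L(t+T_0,x)^{p-1}+1}\right)^{\frac1{p-1}}$$ for every $t\ge0$ and almost every $x\in\mathbb R$, where $u_L(t,x)=\varepsilon_0S(t)\phi(x)+\varepsilon_0\,\partial_tS(t)\phi(x)$. -/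

import Mathlib

open MeasureTheory Set
open scoped ContDiff ENNReal

noncomputable section

namespace DampedWave

/-- The modified Bessel function of the first kind of order zero,
`I₀(z) = ∑ₖ (z / 2) ^ (2 k) / (k !) ^ 2` (the series converges for every real `z`). -/
def besselI0 (z : ℝ) : ℝ := ∑' k : ℕ, (z / 2) ^ (2 * k) / (k.factorial : ℝ) ^ 2

/-- The solution operator of the linear damped wave equation,
`S(t) f (x) = (e^{-t/2} / 2) ∫_{-t}^{t} I₀(√(t² - y²) / 2) f(x - y) dy`. -/
def S (t : ℝ) (f : ℝ → ℝ) (x : ℝ) : ℝ :=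
  Real.exp (-t / 2) / 2 *
    ∫ y in (-t)..t, besselI0 (Real.sqrt (t ^ 2 - y ^ 2) / 2) * f (x - y)

/-- The time derivative `∂ₜ S(t) f (x)`. If `f` has a (locally) Lipschitz representative then
`s ↦ S(s) f (x)` is differentiable at every time, including `s = 0`, where the oriented interval
integral extends the formula to negative times. -/
def dtS (t : ℝ) (f : ℝ → ℝ) (x : ℝ) : ℝ := deriv (fun s : ℝ => S s f x) t

/-- `f'` is a weak derivative of `f` on the real line. -/
def IsWeakDeriv (f f' : ℝ → ℝ) : Prop :=
  LocallyIntegrable f volume ∧ LocallyIntegrable f' volume ∧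
    ∀ η : ℝ → ℝ, ContDiff ℝ ∞ η → HasCompactSupport η →
      ∫ x, f x * deriv η x = - ∫ x, f' x * η x

/-- `f` belongs to `W^{1,1} ∩ W^{1,∞}(ℝ)`, and `f'` is its weak derivative. -/
def MemW1With (f f' : ℝ → ℝ) : Prop :=
  IsWeakDeriv f f' ∧ MemLp f 1 volume ∧ MemLp f ∞ volume ∧ MemLp f' 1 volume ∧ MemLp f' ∞ volume

/-- `f` belongs to `W^{1,1} ∩ W^{1,∞}(ℝ)`. -/
def MemW1 (f : ℝ → ℝ) : Prop := ∃ f' : ℝ → ℝ, MemW1With f f'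

/-- `u` is a (global) mild solution of `u_tt + u_t - u_xx + u ^ p = 0`, `u(0) = u₀`, `u_t(0) = u₁`:
it is nonnegative and satisfies
`u(t) = S(t)(u₀ + u₁) + ∂ₜS(t) u₀ - ∫₀ᵗ S(t - τ) u^p(τ) dτ`, for every `t ≥ 0`, as functions of
`x` up to null sets. Local integrability of `u ^ p` in space-time (which contains the
measurability of `u`) makes the last integral meaningful. -/
structure IsMildSolution (p : ℝ) (u₀ u₁ : ℝ → ℝ) (u : ℝ → ℝ → ℝ) : Prop where
  nonneg : ∀ t : ℝ, 0 ≤ t → ∀ᵐ x : ℝ, 0 ≤ u t x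
  locInt : LocallyIntegrableOn (fun z : ℝ × ℝ => u z.1 z.2 ^ p) (Ici (0 : ℝ) ×ˢ (univ : Set ℝ))
    (volume : Measure (ℝ × ℝ))
  eqn : ∀ t : ℝ, 0 ≤ t → ∀ᵐ x : ℝ,
    u t x = S t (fun y => u₀ y + u₁ y) x + dtS t u₀ x
      - ∫ τ in (0 : ℝ)..t, S (t - τ) (fun y => u τ y ^ p) x

/-- The linear solution `u_L(t) = ε S(t) φ + ε ∂ₜS(t) φ`. -/
def uL (ε : ℝ) (φ : ℝ → ℝ) (t x : ℝ) : ℝ := ε * S t φ x + ε * dtS t φ x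

end DampedWave

end

/-!
The function `v = exp (t / 2) u` solves `v_tt - v_xx = v / 4 - exp (t / 2) u ^ p`. With
`s = t + T₀`, `q = p - 1` and a positive solution `U` of the linear damped wave equation, the
bound of the theorem is `w = C * (U ^ (-q) + s) ^ (-1 / q)`, and it is a supersolution. For frozen
`U` it solves `w_s = -w ^ p / (q C ^ q)`, so that for large `C` most of `w ^ p` remains available.
As `U` solves the linear equation, what has to be absorbed consists of a multiple of
`U_t ^ 2 - U_x ^ 2`, where `-U_x ^ 2` has the favourable sign, and of terms containing the
logarithmic derivative `U_t / U = O(s ^ (-1 / 2))`; each of them is at most a constant times the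
remaining nonlinearity (`superV_ge`). A mild solution whose data lie below those of the
supersolution stays below it (`coneInt_source_le`), and for `T₀` large and `ε₀` small the data of
the theorem do (`data_le_superV`, `quarter_le_superVLogT`).

*Kernels.* Everything is written with the Bessel-Clifford functions
`besselC n w = ∑ wᵏ / (k! (n + k)!)`, which are entire in `w`, so that `S(t) f` and `∂ₜS(t) f` become
integrals over `[x - t, x + t]` of smooth kernels (`S_eq_kgSin`, `dtS_eq_kg`). The recurrence
`w besselC (n + 2) w + (n + 1) besselC (n + 1) w = besselC n w` exhibits the cancellation behind
`U_t = O(s ^ (-1 / 2) U)` (`SlowProfile.exists_abs_kgLinT_sub_le`), and the size of `besselC 0` gives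
`U ≥ c ε₀ s ^ (-1 / 2) φ`
(`SlowProfile.le_kgLin`).

*The profile.* A weakly differentiable function has a continuous representative
(`IsWeakDeriv.exists_continuous`), for which the comparison hypotheses hold at every point. A moving
average of it is a comparable `C¹` profile `ψ` with `|ψ'| ≤ K ψ`, and the hypothesis on
`|y| < 2 |x|` is a doubling property, which yields a polynomial lower bound and hence controls `φ`
at distance `t` by a power of `t` (`exists_slowProfile`). `U` is the linear solution issued from
`ε₀ ψ`; it lies below `u_L`, and the bound is increasing in `U`.

*Low regularity.* A mild solution is only measurable, so the comparison is made for an integral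
equation. The kernel of `S` satisfies a Volterra identity (`kgSin_volterra`, `kgCos_volterra`,
`kgDuhamel_volterra`), by which the mild equation for `u` becomes the d'Alembert formula for `v`
with source `v / 4 - exp (t / 2) u ^ p` (`IsMildSolution.exists_wave_form`); the supersolution
satisfies the same formula as an inequality (`dAlembert_le`). The source is increasing in `u` for
small `u`, so the positive part `r` of the difference satisfies `r ≤ coneInt r / 4`, and hence
vanishes.
-/

noncomputable section

namespace DampedWave

/-! ### Bessel–Clifford functions -/

/-- The Bessel–Clifford function `∑ₖ w ^ k / (k! (n + k)!)`. It is entire, and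
`I₀(z) = besselC 0 (z² / 4)`; using `w = z² / 4` as the variable removes the square root from the
kernel of `S`. -/
def besselC (n : ℕ) (w : ℝ) : ℝ :=
  ∑' k : ℕ, w ^ k / ((k.factorial : ℝ) * ((n + k).factorial : ℝ))

lemma summable_besselC (n : ℕ) (w : ℝ) :
    Summable fun k : ℕ => w ^ k / ((k.factorial : ℝ) * ((n + k).factorial : ℝ)) := by
  refine Summable.of_norm_bounded (Real.summable_pow_div_factorial |w|) fun k => ?_
  have h1 : (1 : ℝ) ≤ ((n + k).factorial : ℝ) := by
    exact_mod_cast Nat.one_le_iff_ne_zero.mpr (Nat.factorial_ne_zero _)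
  have h2 : (0 : ℝ) < (k.factorial : ℝ) := by positivity
  rw [Real.norm_eq_abs, abs_div, abs_pow, abs_of_pos (by positivity : (0 : ℝ) <
    (k.factorial : ℝ) * ((n + k).factorial : ℝ))]
  gcongr
  nlinarith

lemma hasDerivAt_besselC (n : ℕ) (w : ℝ) : HasDerivAt (besselC n) (besselC (n + 1) w) w := by
  set R : ℝ := |w| + 1
  have hR : 0 ≤ R := by positivity
  set g' : ℕ → ℝ → ℝ :=
    fun k y => ((k : ℝ) * y ^ (k - 1)) / ((k.factorial : ℝ) * ((n + k).factorial : ℝ))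
  have hu : Summable fun k : ℕ => (k : ℝ) * R ^ (k - 1) / (k.factorial : ℝ) := by
    refine (summable_nat_add_iff 1).1 ?_
    refine (Real.summable_pow_div_factorial R).congr fun k => ?_
    rw [Nat.factorial_succ]
    push_cast
    have : (k.factorial : ℝ) ≠ 0 := by positivity
    have : (k + 1 : ℝ) ≠ 0 := by positivity
    field_simp
  have key := hasDerivAt_tsum_of_isPreconnected (t := Metric.ball (0 : ℝ) R)
    (g := fun k y => y ^ k / ((k.factorial : ℝ) * ((n + k).factorial : ℝ))) (g' := g') hu
    Metric.isOpen_ball (convex_ball (0 : ℝ) R).isPreconnected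
    (fun k y _ => (hasDerivAt_pow k y).div_const _)
    (fun k y hy => ?_) (y₀ := w) (y := w) (by simp [R]) (summable_besselC n w) (by simp [R])
  · suffices h : besselC (n + 1) w = ∑' k, g' k w by rw [h]; exact key
    have hs : Summable fun k => g' k w := by
      refine (summable_nat_add_iff 1).1 ?_
      refine (summable_besselC (n + 1) w).congr fun k => ?_
      simp only [g', Nat.add_sub_cancel, Nat.factorial_succ k]
      have : (k.factorial : ℝ) ≠ 0 := by positivity
      have : ((n + (k + 1)).factorial : ℝ) ≠ 0 := by positivity
      rw [show n + 1 + k = n + (k + 1) by ring]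
      push_cast
      field_simp
    rw [hs.tsum_eq_zero_add]
    simp only [g', besselC]
    rw [show ((0 : ℕ) : ℝ) * w ^ (0 - 1) / (((0 : ℕ).factorial : ℝ) * ((n + 0).factorial : ℝ)) = 0
      by simp, zero_add]
    refine tsum_congr fun k => ?_
    simp only [Nat.add_sub_cancel, Nat.factorial_succ k]
    have : (k.factorial : ℝ) ≠ 0 := by positivity
    have : ((n + (k + 1)).factorial : ℝ) ≠ 0 := by positivity
    rw [show n + 1 + k = n + (k + 1) by ring]
    push_cast
    field_simp
  · have hy' : |y| ≤ R := by simpa using (mem_ball_zero_iff.1 hy).le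
    have h1 : (1 : ℝ) ≤ ((n + k).factorial : ℝ) := by
      exact_mod_cast Nat.one_le_iff_ne_zero.mpr (Nat.factorial_ne_zero _)
    have h2 : (0 : ℝ) < (k.factorial : ℝ) := by positivity
    simp only [g']
    rw [Real.norm_eq_abs, abs_div, abs_mul, abs_pow, Nat.abs_cast,
      abs_of_pos (by positivity : (0 : ℝ) < (k.factorial : ℝ) * ((n + k).factorial : ℝ))]
    gcongr
    nlinarith

@[fun_prop]
lemma continuous_besselC (n : ℕ) : Continuous (besselC n) :=
  continuous_iff_continuousAt.2 fun w => (hasDerivAt_besselC n w).continuousAt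

lemma besselC_zero_right (n : ℕ) : besselC n 0 = 1 / (n.factorial : ℝ) := by
  rw [besselC, tsum_eq_single 0]
  · simp
  · intro k hk
    simp [hk]

/-- The three-term recurrence, in the Bessel normalisation
`I_n(z) - I_{n+2}(z) = (2 (n + 1) / z) I_{n+1}(z)`. -/
lemma besselC_recurrence (n : ℕ) (w : ℝ) :
    besselC n w = w * besselC (n + 2) w + (n + 1) * besselC (n + 1) w := by
  have h1 := (summable_besselC n w).tsum_eq_zero_add
  have h2 := (summable_besselC (n + 1) w).tsum_eq_zero_add
  have s1 := (summable_nat_add_iff 1).2 (summable_besselC (n + 1) w)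
  have s2 := summable_besselC (n + 2) w
  simp only [besselC]
  rw [h1, h2, mul_add, ← tsum_mul_left, ← tsum_mul_left, ← add_assoc, add_comm (∑' _, _), add_assoc,
    ← (s2.mul_left w).tsum_add (s1.mul_left ((n : ℝ) + 1))]
  congr 1
  · simp [Nat.factorial_succ]
    have : (n.factorial : ℝ) ≠ 0 := by positivity
    field_simp
  · refine tsum_congr fun k => ?_
    rw [show n + 2 + k = n + k + 1 + 1 by ring, show n + 1 + (k + 1) = n + k + 1 + 1 by ring,
      show n + (k + 1) = n + k + 1 by ring, Nat.factorial_succ (n + k + 1), Nat.factorial_succ k]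
    have : (k.factorial : ℝ) ≠ 0 := by positivity
    have : ((n + k + 1).factorial : ℝ) ≠ 0 := by positivity
    push_cast
    field_simp
    ring

lemma besselC_nonneg (n : ℕ) {w : ℝ} (hw : 0 ≤ w) : 0 ≤ besselC n w :=
  tsum_nonneg fun _ => by positivity

lemma besselC_mono (n : ℕ) {w w' : ℝ} (hw : 0 ≤ w) (h : w ≤ w') : besselC n w ≤ besselC n w' :=
  (summable_besselC n w).tsum_le_tsum (fun k => by gcongr) (summable_besselC n w')

lemma besselC_succ_le (n : ℕ) {w : ℝ} (hw : 0 ≤ w) : besselC (n + 1) w ≤ besselC n w := by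
  refine (summable_besselC (n + 1) w).tsum_le_tsum (fun k => ?_) (summable_besselC n w)
  gcongr
  omega

lemma mul_besselC_two_le {w : ℝ} (hw : 0 ≤ w) : w * besselC 2 w ≤ besselC 0 w := by
  have h := besselC_recurrence 0 w
  have := besselC_nonneg 1 hw
  norm_num at h
  linarith

lemma sq_div_four_pow (z : ℝ) (k : ℕ) : (z ^ 2 / 4) ^ k = z ^ (2 * k) / 4 ^ k := by
  rw [div_pow, ← pow_mul]

lemma factorial_two_mul (k : ℕ) :
    ((2 * k).factorial : ℝ) = (k.centralBinom : ℝ) * ((k.factorial : ℝ) * (k.factorial : ℝ)) := by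
  have := Nat.choose_mul_factorial_mul_factorial (show k ≤ 2 * k by omega)
  rw [show 2 * k - k = k by omega] at this
  rw [Nat.centralBinom, ← this]
  push_cast
  ring

lemma besselC_zero_le_exp {z : ℝ} (hz : 0 ≤ z) : besselC 0 (z ^ 2 / 4) ≤ Real.exp z := by
  have hc := Real.hasSum_cosh z
  calc besselC 0 (z ^ 2 / 4) ≤ ∑' k : ℕ, z ^ (2 * k) / ((2 * k).factorial : ℝ) := by
        refine (summable_besselC 0 _).tsum_le_tsum (fun k => ?_) hc.summable
        have h4 : (k.centralBinom : ℝ) ≤ 4 ^ k := by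
          have := Nat.sum_range_choose (2 * k)
          have h' : (2 * k).choose k ≤ 2 ^ (2 * k) := Nat.choose_le_two_pow _ _
          rw [pow_mul] at h'
          rw [Nat.centralBinom]
          exact_mod_cast h'
        have : (0 : ℝ) < (k.factorial : ℝ) := by positivity
        have hb : (0 : ℝ) < (k.centralBinom : ℝ) := by exact_mod_cast k.centralBinom_pos
        rw [sq_div_four_pow, factorial_two_mul, zero_add, div_div]
        gcongr
    _ = Real.cosh z := hc.tsum_eq
    _ ≤ Real.exp z := by
        rw [Real.cosh_eq]
        have : Real.exp (-z) ≤ Real.exp z := Real.exp_le_exp.2 (by linarith)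
        linarith

lemma sixteen_pow_le_centralBinom_sq (k : ℕ) :
    16 ^ (k + 1) ≤ 4 * (k + 1) * (k + 1).centralBinom ^ 2 := by
  induction k with
  | zero => simp [Nat.centralBinom, Nat.choose]
  | succ k ih =>
    have h := Nat.succ_mul_centralBinom_succ (k + 1)
    set a := (k + 1).centralBinom
    set b := (k + 1 + 1).centralBinom
    have h2 : (k + 2) * (4 * (k + 2) * b ^ 2) = 4 * (2 * (2 * (k + 1) + 1) * a) ^ 2 := by
      rw [← h]; ring
    have h3 : (k + 2) * 16 ^ (k + 2) ≤ (k + 2) * (4 * (k + 2) * b ^ 2) := by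
      rw [h2]
      calc (k + 2) * 16 ^ (k + 2) = 16 * (k + 2) * 16 ^ (k + 1) := by ring
        _ ≤ 16 * (k + 2) * (4 * (k + 1) * a ^ 2) := by gcongr
        _ ≤ 4 * (2 * (2 * (k + 1) + 1) * a) ^ 2 := by nlinarith [Nat.zero_le (a ^ 2)]
    exact Nat.le_of_mul_le_mul_left h3 (by omega)

/-- The sharp order of growth of `I₀` from below. The coefficient ratio `binom(2k, k) / 4 ^ k` to
the series of `cosh` is at least `1 / (2 √k)`, which is bounded below by its tangent (in `k`) at
`k = z`; the resulting linear weight is summed with the series of `cosh` and `sinh`. -/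
lemma exp_div_sqrt_le_besselC_zero {z : ℝ} (hz : 1 ≤ z) :
    5 / 16 * (Real.exp z / Real.sqrt z) ≤ besselC 0 (z ^ 2 / 4) := by
  have hz0 : 0 < z := by linarith
  set r := Real.sqrt z
  have hr : 1 ≤ r := Real.one_le_sqrt.2 hz
  have hr2 : r ^ 2 = z := Real.sq_sqrt hz0.le
  have hr0 : 0 < r := by linarith
  have hc := Real.hasSum_cosh z
  -- the series of `z sinh z / 2`
  have hs : HasSum (fun k : ℕ => (k : ℝ) * (z ^ (2 * k) / ((2 * k).factorial : ℝ)))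
      (z / 2 * Real.sinh z) := by
    refine (hasSum_nat_add_iff' 1).1 ?_
    simp only [Finset.range_one, Finset.sum_singleton, Nat.cast_zero, zero_mul, sub_zero]
    refine ((Real.hasSum_sinh z).mul_left (z / 2)).congr_fun ?_
    intro k
    rw [show 2 * (k + 1) = (2 * k + 1) + 1 by ring, Nat.factorial_succ (2 * k + 1)]
    have : ((2 * k + 1).factorial : ℝ) ≠ 0 := by positivity
    push_cast
    field_simp
    ring
  have hlow : ∀ k : ℕ, (3 / (4 * r) - 1 / (4 * r ^ 3) * k) * (z ^ (2 * k) / ((2 * k).factorial : ℝ))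
      ≤ (z ^ 2 / 4) ^ k / ((k.factorial : ℝ) * ((0 + k).factorial : ℝ)) := by
    intro k
    have hb : (0 : ℝ) < (k.centralBinom : ℝ) := by exact_mod_cast k.centralBinom_pos
    have hf : (0 : ℝ) < (k.factorial : ℝ) := by positivity
    have hratio : 3 / (4 * r) - 1 / (4 * r ^ 3) * k ≤ (k.centralBinom : ℝ) / 4 ^ k := by
      rcases k with _ | k
      · simp only [Nat.cast_zero, mul_zero, sub_zero, Nat.centralBinom_zero, Nat.cast_one, pow_zero,
          div_one]
        rw [div_le_one (by positivity)]
        linarith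
      · set κ := Real.sqrt ((k + 1 : ℕ) : ℝ)
        have hκ2 : κ ^ 2 = ((k + 1 : ℕ) : ℝ) := Real.sq_sqrt (by positivity)
        have hκ : 0 < κ := Real.sqrt_pos.2 (by positivity)
        have h1 : 3 / (4 * r) - 1 / (4 * r ^ 3) * ((k + 1 : ℕ) : ℝ) ≤ 1 / (2 * κ) := by
          rw [← hκ2]
          have : 1 / (2 * κ) - (3 / (4 * r) - 1 / (4 * r ^ 3) * κ ^ 2) =
              (κ - r) ^ 2 * (κ + 2 * r) / (4 * κ * r ^ 3) := by
            field_simp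
            ring
          have h' : 0 ≤ (κ - r) ^ 2 * (κ + 2 * r) / (4 * κ * r ^ 3) := by positivity
          linarith
        refine h1.trans ?_
        have h16 : (16 : ℝ) ^ (k + 1) ≤ 4 * κ ^ 2 * ((k + 1).centralBinom : ℝ) ^ 2 := by
          rw [hκ2]
          exact_mod_cast sixteen_pow_le_centralBinom_sq k
        have h4 : (4 : ℝ) ^ (k + 1) ≤ 2 * κ * ((k + 1).centralBinom : ℝ) := by
          refine le_of_sq_le_sq ?_ (by positivity)
          calc ((4 : ℝ) ^ (k + 1)) ^ 2 = 16 ^ (k + 1) := by rw [← pow_mul, mul_comm, pow_mul]; norm_num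
            _ ≤ _ := h16
            _ = _ := by ring
        rw [div_le_div_iff₀ (by positivity) (by positivity)]
        linarith
    calc _ ≤ (k.centralBinom : ℝ) / 4 ^ k * (z ^ (2 * k) / ((2 * k).factorial : ℝ)) := by gcongr
      _ = _ := by
        rw [sq_div_four_pow, factorial_two_mul, zero_add]
        field_simp
  have hsum := hasSum_le hlow (f := fun k : ℕ => (3 / (4 * r) - 1 / (4 * r ^ 3) * k) *
      (z ^ (2 * k) / ((2 * k).factorial : ℝ)))
    (((hc.mul_left (3 / (4 * r))).sub (hs.mul_left (1 / (4 * r ^ 3)))).congr_fun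
      (fun k => by ring)) (summable_besselC 0 (z ^ 2 / 4)).hasSum
  refine le_trans ?_ hsum
  have e1 : 3 / (4 * r) * Real.cosh z - 1 / (4 * r ^ 3) * (z / 2 * Real.sinh z) =
      (6 * Real.cosh z - Real.sinh z) / (8 * r) := by
    rw [← hr2]; field_simp; ring
  rw [e1, Real.cosh_eq, Real.sinh_eq, mul_div_assoc', div_le_div_iff₀ hr0 (by positivity)]
  have := Real.exp_pos z
  have := Real.exp_pos (-z)
  nlinarith [mul_pos hr0 (Real.exp_pos (-z)), mul_pos hr0 (Real.exp_pos z)]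

/-! ### Parametric integrals -/

open Filter Topology in
lemma hasDerivAt_integral_fixed {h h' : ℝ → ℝ → ℝ} (hc : Continuous (Function.uncurry h))
    (hc' : Continuous (Function.uncurry h')) (hd : ∀ t z, HasDerivAt (fun s => h s z) (h' t z) t)
    (a b t : ℝ) : HasDerivAt (fun s => ∫ z in a..b, h s z) (∫ z in a..b, h' t z) t := by
  have hK : IsCompact (Metric.closedBall t 1 ×ˢ uIcc a b) :=
    (isCompact_closedBall t 1).prod isCompact_uIcc
  obtain ⟨M, hM⟩ := hK.exists_bound_of_continuousOn hc'.continuousOn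
  refine (intervalIntegral.hasDerivAt_integral_of_dominated_loc_of_deriv_le (bound := fun _ => M)
    (s := Metric.closedBall t 1) (Metric.closedBall_mem_nhds t one_pos) ?_ ?_ ?_ ?_ ?_ ?_).2
  · exact Eventually.of_forall fun s => (hc.uncurry_left s).aestronglyMeasurable
  · exact (hc.uncurry_left t).intervalIntegrable _ _
  · exact (hc'.uncurry_left t).aestronglyMeasurable
  · exact ae_of_all _ fun z hz s hs => hM (s, z) ⟨hs, uIoc_subset_uIcc hz⟩
  · exact intervalIntegrable_const
  · exact ae_of_all _ fun z _ s _ => hd s z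

open Filter Topology in
lemma hasDerivAt_integral_short {h : ℝ → ℝ → ℝ} (hc : Continuous (Function.uncurry h)) {b : ℝ → ℝ}
    (hb : Continuous b) {t b' : ℝ} (hbt : HasDerivAt b b' t) :
    HasDerivAt (fun s => ∫ z in b t..b s, h s z) (b' * h t (b t)) t := by
  have e : ∀ s, ∫ z in b t..b s, h s z = (b s - b t) * ∫ r in (0 : ℝ)..1, h s (b t + (b s - b t) * r) := by
    intro s
    have := intervalIntegral.smul_integral_comp_add_mul (fun z => h s z) (a := 0) (b := 1)
      (b s - b t) (b t)
    rw [smul_eq_mul] at this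
    rw [this]
    simp
  have hg : Continuous fun s => ∫ r in (0 : ℝ)..1, h s (b t + (b s - b t) * r) := by
    refine intervalIntegral.continuous_parametric_intervalIntegral_of_continuous' ?_ _ _
    exact hc.comp (f := fun q : ℝ × ℝ => (q.1, b t + (b q.1 - b t) * q.2)) (by fun_prop)
  have hlim := ((hasDerivAt_iff_tendsto_slope.1 hbt).mul
    (hg.continuousAt.mono_left nhdsWithin_le_nhds : Tendsto _ (𝓝[≠] t) _))
  refine hasDerivAt_iff_tendsto_slope.2 ?_
  have e0 : (∫ r in (0 : ℝ)..1, h t (b t + (b t - b t) * r)) = h t (b t) := by simp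
  beta_reduce at hlim
  rw [e0] at hlim
  refine hlim.congr fun s => ?_
  rw [slope_def_field, slope_def_field, e s, e t, sub_self (b t), zero_mul, sub_zero]
  ring

/-- The Leibniz rule for an integral whose integrand and end points all depend on the parameter. -/
lemma hasDerivAt_integral_leibniz {h h' : ℝ → ℝ → ℝ} (hc : Continuous (Function.uncurry h))
    (hc' : Continuous (Function.uncurry h')) (hd : ∀ t z, HasDerivAt (fun s => h s z) (h' t z) t)
    {a b : ℝ → ℝ} (ha : Continuous a) (hb : Continuous b) {t a' b' : ℝ} (hat : HasDerivAt a a' t)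
    (hbt : HasDerivAt b b' t) :
    HasDerivAt (fun s => ∫ z in a s..b s, h s z)
      (b' * h t (b t) - a' * h t (a t) + ∫ z in a t..b t, h' t z) t := by
  have hi : ∀ s u v, IntervalIntegrable (h s) volume u v := fun s u v =>
    (hc.uncurry_left s).intervalIntegrable _ _
  have e : (fun s => ∫ z in a s..b s, h s z) = fun s => (∫ z in b t..b s, h s z) -
      (∫ z in a t..a s, h s z) + ∫ z in a t..b t, h s z := by
    funext s
    rw [← intervalIntegral.integral_add_adjacent_intervals (hi s (a s) (a t)) (hi s (a t) (b s)),
      ← intervalIntegral.integral_add_adjacent_intervals (hi s (a t) (b t)) (hi s (b t) (b s)),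
      intervalIntegral.integral_symm (a t) (a s)]
    ring
  rw [e]
  exact ((hasDerivAt_integral_short hc hb hbt).sub (hasDerivAt_integral_short hc ha hat)).add
    (hasDerivAt_integral_fixed hc hc' hd _ _ _)

lemma continuous_integral_moving {X : Type*} [TopologicalSpace X] [FirstCountableTopology X]
    {f : X → ℝ → ℝ} (hf : Continuous (Function.uncurry f)) {a b : X → ℝ} (ha : Continuous a)
    (hb : Continuous b) : Continuous fun x => ∫ z in a x..b x, f x z := by
  have e : (fun x => ∫ z in a x..b x, f x z) =
      fun x => (∫ z in (0 : ℝ)..b x, f x z) - ∫ z in (0 : ℝ)..a x, f x z := by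
    funext x
    have hi : ∀ u v, IntervalIntegrable (f x) volume u v := fun u v =>
      (hf.uncurry_left x).intervalIntegrable _ _
    rw [intervalIntegral.integral_interval_sub_left (hi _ _) (hi _ _)]
  rw [e]
  exact (intervalIntegral.continuous_parametric_intervalIntegral_of_continuous hf hb).sub
    (intervalIntegral.continuous_parametric_intervalIntegral_of_continuous hf ha)

lemma intervalIntegrable_of_bounded {f : ℝ → ℝ} (hf : AEStronglyMeasurable f volume) {a b M : ℝ}
    (hM : ∀ x ∈ uIoc a b, |f x| ≤ M) : IntervalIntegrable f volume a b := by
  rw [intervalIntegrable_iff]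
  refine Measure.integrableOn_of_bounded (M := M) (by simp) hf ?_
  exact (ae_restrict_iff' measurableSet_uIoc).2 (ae_of_all _ fun x hx => hM x hx)

lemma intervalIntegral_swap_of_bounded {F : ℝ → ℝ → ℝ} (hF : Measurable (Function.uncurry F))
    {a b c d M : ℝ} (hM : ∀ x ∈ uIoc a b, ∀ y ∈ uIoc c d, |F x y| ≤ M) :
    ∫ x in a..b, ∫ y in c..d, F x y = ∫ y in c..d, ∫ x in a..b, F x y := by
  refine intervalIntegral_intervalIntegral_swap ?_
  refine Measure.integrableOn_of_bounded (M := M) ?_ hF.aestronglyMeasurable ?_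
  · exact ((Metric.isBounded_Ioc _ _).prod (Metric.isBounded_Ioc _ _)).measure_lt_top.ne
  · exact (ae_restrict_iff' (measurableSet_uIoc.prod measurableSet_uIoc)).2
      (ae_of_all _ fun z hz => hM z.1 hz.1 z.2 hz.2)

/-- Fubini on the triangle `β ≤ b ≤ a ≤ α`. -/
lemma intervalIntegral_swap_triangle {F : ℝ → ℝ → ℝ} (hF : Measurable (Function.uncurry F))
    {β α M : ℝ} (h : β ≤ α) (hM : ∀ a b, β ≤ b → b ≤ a → a ≤ α → |F a b| ≤ M) :
    ∫ a in β..α, ∫ b in β..a, F a b = ∫ b in β..α, ∫ a in b..α, F a b := by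
  set G : ℝ → ℝ → ℝ := fun a b => if b ≤ a then F a b else 0
  have hG : Measurable (Function.uncurry G) :=
    Measurable.ite (measurableSet_le measurable_snd measurable_fst) hF measurable_const
  have hGM : ∀ x ∈ uIoc β α, ∀ y ∈ uIoc β α, |G x y| ≤ |M| := by
    intro x hx y hy
    rw [uIoc_of_le h] at hx hy
    simp only [G]
    split_ifs with hxy
    · exact (hM x y hy.1.le hxy hx.2).trans (le_abs_self M)
    · simp
  have e1 : ∀ a ∈ uIcc β α, ∫ b in β..a, F a b = ∫ b in β..α, G a b := by
    intro a ha
    rw [uIcc_of_le h] at ha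
    rw [intervalIntegral.integral_of_le ha.1, intervalIntegral.integral_of_le h]
    have e : ∀ b, b ∈ Ioc β α → G a b = (Ioc β a).indicator (F a) b := by
      intro b hb
      simp only [G, indicator, mem_Ioc, hb.1, true_and]
    rw [setIntegral_congr_fun measurableSet_Ioc e, setIntegral_indicator measurableSet_Ioc,
      Ioc_inter_Ioc, sup_idem, inf_eq_right.2 ha.2]
  have e2 : ∀ b ∈ uIcc β α, ∫ a in b..α, F a b = ∫ a in β..α, G a b := by
    intro b hb
    rw [uIcc_of_le h] at hb
    rw [intervalIntegral.integral_of_le hb.2, intervalIntegral.integral_of_le h,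
      integral_Ioc_eq_integral_Ioo, ← integral_Ico_eq_integral_Ioo,
      integral_Ioc_eq_integral_Ioo (f := fun a => G a b), ← integral_Ico_eq_integral_Ioo]
    have e : ∀ a, a ∈ Ico β α → G a b = (Ico b α).indicator (fun a => F a b) a := by
      intro a ha
      simp only [G, indicator, mem_Ico, ha.2, and_true]
    rw [setIntegral_congr_fun measurableSet_Ico e, setIntegral_indicator measurableSet_Ico,
      Ico_inter_Ico, sup_eq_right.2 hb.1, inf_idem]
  rw [intervalIntegral.integral_congr e1, intervalIntegral.integral_congr e2,
    intervalIntegral_swap_of_bounded hG hGM]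

/-! ### Propagators of `v_tt - v_xx = v / 4` -/

/-- The solution at time `t` of `v_tt - v_xx = v / 4` with `v(0) = 0`, `v_t(0) = f`.
This is the equation satisfied by `exp (t / 2) u` when `u` solves the damped wave equation. -/
def kgSin (f : ℝ → ℝ) (t x : ℝ) : ℝ :=
  1 / 2 * ∫ z in (x - t)..(x + t), besselC 0 ((t ^ 2 - (x - z) ^ 2) / 16) * f z

/-- The solution at time `t` of `v_tt - v_xx = v / 4` with `v(0) = f`, `v_t(0) = 0`. -/
def kgCos (f : ℝ → ℝ) (t x : ℝ) : ℝ :=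
  1 / 2 * (f (x + t) + f (x - t)) +
    1 / 2 * ∫ z in (x - t)..(x + t), t / 8 * besselC 1 ((t ^ 2 - (x - z) ^ 2) / 16) * f z

lemma besselI0_sqrt {w : ℝ} (hw : 0 ≤ w) : besselI0 (Real.sqrt w / 2) = besselC 0 (w / 16) := by
  rw [besselI0, besselC]
  refine tsum_congr fun k => ?_
  rw [zero_add, ← sq, pow_mul, show (Real.sqrt w / 2 / 2) ^ 2 = w / 16 by
    rw [div_pow, div_pow, Real.sq_sqrt hw]; ring]

lemma S_eq_kgSin (t : ℝ) (f : ℝ → ℝ) (x : ℝ) : S t f x = Real.exp (-t / 2) * kgSin f t x := by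
  have h := intervalIntegral.integral_comp_sub_left
    (fun z => besselI0 (Real.sqrt (t ^ 2 - (x - z) ^ 2) / 2) * f z) (a := -t) (b := t) x
  simp only [sub_sub_cancel, sub_neg_eq_add] at h
  rw [S, h, kgSin, intervalIntegral.integral_congr
    (g := fun z => besselC 0 ((t ^ 2 - (x - z) ^ 2) / 16) * f z)]
  · ring
  · intro z hz
    have : |x - z| ≤ |t| := by
      rcases le_total 0 t with ht | ht
      · rw [uIcc_of_le (by linarith)] at hz
        rw [abs_of_nonneg ht, abs_le]
        constructor <;> linarith [hz.1, hz.2]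
      · rw [uIcc_of_ge (by linarith)] at hz
        rw [abs_of_nonpos ht, abs_le]
        constructor <;> linarith [hz.1, hz.2]
    beta_reduce
    rw [besselI0_sqrt (sub_nonneg.2 (sq_le_sq.2 this))]

lemma kgSin_congr_ae {f g : ℝ → ℝ} (h : f =ᵐ[volume] g) (t x : ℝ) : kgSin f t x = kgSin g t x := by
  rw [kgSin, kgSin, intervalIntegral.integral_congr_ae]
  filter_upwards [h] with z hz _
  rw [hz]

lemma S_congr_ae {f g : ℝ → ℝ} (h : f =ᵐ[volume] g) (t x : ℝ) : S t f x = S t g x := by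
  rw [S_eq_kgSin, S_eq_kgSin, kgSin_congr_ae h]

lemma hasDerivAt_kgSin {f : ℝ → ℝ} (hf : Continuous f) (t x : ℝ) :
    HasDerivAt (fun s => kgSin f s x) (kgCos f t x) t := by
  have hd : ∀ t z, HasDerivAt (fun s => besselC 0 ((s ^ 2 - (x - z) ^ 2) / 16) * f z)
      (t / 8 * besselC 1 ((t ^ 2 - (x - z) ^ 2) / 16) * f z) t := by
    intro t z
    have h1 : HasDerivAt (fun s : ℝ => (s ^ 2 - (x - z) ^ 2) / 16) (t / 8) t := by
      refine (((hasDerivAt_pow 2 t).sub_const _).div_const 16).congr_deriv ?_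
      norm_num
      ring
    refine (((hasDerivAt_besselC 0 _).comp t h1).mul_const (f z)).congr_deriv ?_
    ring
  have := hasDerivAt_integral_leibniz (by fun_prop) (by fun_prop) hd (a := fun s => x - s)
    (b := fun s => x + s) (by fun_prop) (by fun_prop) ((hasDerivAt_id t).const_sub x)
    ((hasDerivAt_id t).const_add x)
  refine (this.const_mul (1 / 2)).congr_deriv ?_
  simp only [kgCos, sub_sub_cancel, sub_add_cancel_left, neg_sq, sub_self,
    zero_div, besselC_zero_right]
  norm_num
  ring

lemma dtS_eq_kg {f : ℝ → ℝ} (hf : Continuous f) (t x : ℝ) :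
    dtS t f x = Real.exp (-t / 2) * (kgCos f t x - 1 / 2 * kgSin f t x) := by
  have h1 : HasDerivAt (fun s : ℝ => Real.exp (-s / 2)) (Real.exp (-t / 2) * (-1 / 2)) t :=
    ((hasDerivAt_id t).neg.div_const 2).exp
  have h2 := h1.mul (hasDerivAt_kgSin hf t x)
  rw [dtS]
  have e : (fun s => S s f x) = fun s => Real.exp (-s / 2) * kgSin f s x :=
    funext fun s => S_eq_kgSin s f x
  rw [e]
  refine h2.deriv.trans ?_
  ring

lemma dtS_congr_ae {f g : ℝ → ℝ} (h : f =ᵐ[volume] g) (t x : ℝ) : dtS t f x = dtS t g x := by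
  rw [dtS, dtS]
  congr 1
  funext s
  exact S_congr_ae h s x

lemma continuous_kgSin {f : ℝ → ℝ} (hf : Continuous f) :
    Continuous fun q : ℝ × ℝ => kgSin f q.1 q.2 := by
  unfold kgSin
  exact continuous_const.mul (continuous_integral_moving (by fun_prop) (by fun_prop) (by fun_prop))

lemma continuous_kgCos {f : ℝ → ℝ} (hf : Continuous f) :
    Continuous fun q : ℝ × ℝ => kgCos f q.1 q.2 := by
  unfold kgCos
  exact Continuous.add (by fun_prop) (continuous_const.mul
    (continuous_integral_moving (by fun_prop) (by fun_prop) (by fun_prop)))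

lemma mul_sub_nonneg_of_mem {t x z : ℝ} (hz : z ∈ Icc (x - t) (x + t)) :
    0 ≤ (t ^ 2 - (x - z) ^ 2) / 16 := by
  have : 0 ≤ (t - (x - z)) * (t + (x - z)) :=
    mul_nonneg (by linarith [hz.1]) (by linarith [hz.2])
  nlinarith

lemma besselC_zero_le_exp_half {t y : ℝ} (ht : 0 ≤ t) (hy : 0 ≤ (t ^ 2 - y ^ 2) / 16) :
    besselC 0 ((t ^ 2 - y ^ 2) / 16) ≤ Real.exp (t / 2) := by
  refine (besselC_mono 0 hy ?_).trans (besselC_zero_le_exp (z := t / 2) (by positivity))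
  nlinarith [sq_nonneg y]

lemma kgSin_nonneg {f : ℝ → ℝ} {t x : ℝ} (ht : 0 ≤ t) (hf : ∀ᵐ z, 0 ≤ f z) : 0 ≤ kgSin f t x := by
  refine mul_nonneg (by norm_num) (intervalIntegral.integral_nonneg_of_ae_restrict (by linarith) ?_)
  filter_upwards [ae_restrict_of_ae hf, ae_restrict_mem measurableSet_Icc] with z hz hz'
  exact mul_nonneg (besselC_nonneg _ (mul_sub_nonneg_of_mem hz')) hz

lemma abs_kgSin_le {f : ℝ → ℝ} {t x M : ℝ} (ht : 0 ≤ t)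
    (hM : ∀ z ∈ Icc (x - t) (x + t), |f z| ≤ M) : |kgSin f t x| ≤ M * t * Real.exp (t / 2) := by
  have h := intervalIntegral.norm_integral_le_of_norm_le_const (a := x - t) (b := x + t)
    (f := fun z => besselC 0 ((t ^ 2 - (x - z) ^ 2) / 16) * f z) (C := Real.exp (t / 2) * M) ?_
  · rw [Real.norm_eq_abs, show x + t - (x - t) = 2 * t by ring,
      abs_of_nonneg (by linarith : 0 ≤ 2 * t)] at h
    rw [kgSin, abs_mul, abs_of_pos (by norm_num : (0 : ℝ) < 1 / 2)]
    linarith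
  · intro z hz
    rw [uIoc_of_le (by linarith)] at hz
    have hz' := Ioc_subset_Icc_self hz
    have hw := mul_sub_nonneg_of_mem hz'
    rw [Real.norm_eq_abs, abs_mul, abs_of_nonneg (besselC_nonneg _ hw)]
    exact mul_le_mul (besselC_zero_le_exp_half ht hw) (hM z hz') (abs_nonneg _) (Real.exp_pos _).le

/-! ### The cone operator of the wave equation -/

/-- The Duhamel operator of the wave equation: the solution of `v_tt - v_xx = g` with vanishing
data, as half the integral of `g` over the backward cone. -/
def coneInt (g : ℝ → ℝ → ℝ) (t x : ℝ) : ℝ :=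
  1 / 2 * ∫ σ in (0 : ℝ)..t, ∫ z in (x - (t - σ))..(x + (t - σ)), g σ z

/-- The cone integral, along characteristics. -/
lemma coneInt_eq_triangle {g : ℝ → ℝ → ℝ} (hg : Measurable (Function.uncurry g)) {t x M : ℝ}
    (ht : 0 ≤ t) (hM : ∀ σ z, 0 ≤ σ → σ ≤ t → z ∈ Icc (x - (t - σ)) (x + (t - σ)) → |g σ z| ≤ M) :
    ∫ s in (0 : ℝ)..t, ∫ σ in (0 : ℝ)..s, g σ (x - t + 2 * s - σ) = coneInt g t x := by
  rw [intervalIntegral_swap_triangle (F := fun s σ => g σ (x - t + 2 * s - σ)) (M := M) ?_ ht ?_,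
    coneInt, ← intervalIntegral.integral_const_mul]
  · refine intervalIntegral.integral_congr fun σ _ => ?_
    have h := intervalIntegral.smul_integral_comp_add_mul (fun z => g σ z) (a := σ) (b := t)
      (2 : ℝ) (x - t - σ)
    rw [smul_eq_mul] at h
    rw [show x - (t - σ) = x - t - σ + 2 * σ by ring, show x + (t - σ) = x - t - σ + 2 * t by ring,
      ← h, ← mul_assoc, show (1 / 2 : ℝ) * 2 = 1 by norm_num, one_mul]
    refine intervalIntegral.integral_congr fun s _ => ?_
    congr 1
    ring
  · exact hg.comp (f := fun q : ℝ × ℝ => (q.2, x - t + 2 * q.1 - q.2)) (by fun_prop)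
  · intro s σ h0 h1 h2
    exact hM _ _ h0 (h1.trans h2) ⟨by linarith, by linarith⟩

/-- The cone integral, in null coordinates `a = x + t`, `b = x - t`. -/
lemma integral_null_eq_coneInt {g : ℝ → ℝ → ℝ} (hg : Measurable (Function.uncurry g)) {t x M : ℝ}
    (ht : 0 ≤ t) (hM : ∀ σ z, 0 ≤ σ → σ ≤ t → z ∈ Icc (x - (t - σ)) (x + (t - σ)) → |g σ z| ≤ M) :
    ∫ a in (x - t)..(x + t), ∫ b in (x - t)..a, g ((a - b) / 2) ((a + b) / 2)
      = 4 * coneInt g t x := by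
  rw [← coneInt_eq_triangle hg ht hM]
  have h := intervalIntegral.smul_integral_comp_add_mul
    (fun a => ∫ b in (x - t)..a, g ((a - b) / 2) ((a + b) / 2)) (a := 0) (b := t) 2 (x - t)
  rw [show x - t + 2 * 0 = x - t by ring, show x - t + 2 * t = x + t by ring, smul_eq_mul] at h
  rw [← h, ← intervalIntegral.integral_const_mul, ← intervalIntegral.integral_const_mul]
  refine intervalIntegral.integral_congr fun s _ => ?_
  have h' := intervalIntegral.smul_integral_comp_sub_mul
    (fun b => g ((x - t + 2 * s - b) / 2) ((x - t + 2 * s + b) / 2)) (a := 0) (b := s) 2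
    (x - t + 2 * s)
  rw [show x - t + 2 * s - 2 * 0 = x - t + 2 * s by ring,
    show x - t + 2 * s - 2 * s = x - t by ring, smul_eq_mul] at h'
  rw [← h', ← mul_assoc]
  norm_num
  refine intervalIntegral.integral_congr fun σ _ => ?_
  congr 1
  ring

/-! ### The propagators as solutions of the Volterra equation of the wave operator -/

lemma kgSin_null (f : ℝ → ℝ) (a b : ℝ) : kgSin f ((a - b) / 2) ((a + b) / 2) =
    1 / 2 * ∫ z in b..a, besselC 0 ((a - z) * (z - b) / 16) * f z := by
  rw [kgSin, show (a + b) / 2 - (a - b) / 2 = b by ring,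
    show (a + b) / 2 + (a - b) / 2 = a by ring]
  congr 1
  refine intervalIntegral.integral_congr fun z _ => ?_
  congr 2
  ring

lemma integral_besselC_zero_lower (a z β : ℝ) :
    ∫ b in β..z, besselC 0 ((a - z) * (z - b) / 16) =
      (z - β) * besselC 1 ((a - z) * (z - β) / 16) := by
  have hd : ∀ b ∈ uIcc β z, HasDerivAt (fun b => -((z - b) * besselC 1 ((a - z) * (z - b) / 16)))
      (besselC 0 ((a - z) * (z - b) / 16)) b := by
    intro b _
    have h1 : HasDerivAt (fun b : ℝ => z - b) (-1) b := (hasDerivAt_id b).const_sub z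
    have h2 : HasDerivAt (fun b : ℝ => (a - z) * (z - b) / 16) ((a - z) * (-1) / 16) b :=
      (h1.const_mul _).div_const _
    have h3 := (h1.mul ((hasDerivAt_besselC 1 _).comp b h2)).neg
    refine h3.congr_deriv ?_
    have := besselC_recurrence 0 ((a - z) * (z - b) / 16)
    norm_num at this
    simp only [Function.comp]
    rw [this]
    ring
  rw [intervalIntegral.integral_eq_sub_of_hasDerivAt hd
    ((by fun_prop : Continuous _).intervalIntegrable _ _)]
  ring

lemma integral_besselC_one_upper (α z β : ℝ) :
    ∫ a in z..α, (z - β) * besselC 1 ((a - z) * (z - β) / 16) =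
      16 * (besselC 0 ((α - z) * (z - β) / 16) - 1) := by
  have hd : ∀ a ∈ uIcc z α, HasDerivAt (fun a => 16 * besselC 0 ((a - z) * (z - β) / 16))
      ((z - β) * besselC 1 ((a - z) * (z - β) / 16)) a := by
    intro a _
    have h2 : HasDerivAt (fun a : ℝ => (a - z) * (z - β) / 16) (1 * (z - β) / 16) a :=
      (((hasDerivAt_id a).sub_const z).mul_const _).div_const _
    refine (((hasDerivAt_besselC 0 _).comp a h2).const_mul 16).congr_deriv ?_
    ring
  rw [intervalIntegral.integral_eq_sub_of_hasDerivAt hd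
    ((by fun_prop : Continuous _).intervalIntegrable _ _)]
  simp [besselC_zero_right]
  ring

lemma measurable_integral_moving {X : Type*} [MeasurableSpace X] {F : X → ℝ → ℝ}
    (hF : Measurable (Function.uncurry F)) {a b : X → ℝ} (ha : Measurable a) (hb : Measurable b) :
    Measurable fun x => ∫ z in a x..b x, F x z := by
  have e : (fun x => ∫ z in a x..b x, F x z) = fun x => (b x - a x) *
      ∫ r in Ioc (0 : ℝ) 1, F x (a x + (b x - a x) * r) := by
    funext x
    have h := intervalIntegral.smul_integral_comp_add_mul (fun z => F x z) (a := 0) (b := 1)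
      (b x - a x) (a x)
    rw [smul_eq_mul, intervalIntegral.integral_of_le zero_le_one] at h
    rw [h]
    simp
  rw [e]
  refine (hb.sub ha).mul (StronglyMeasurable.integral_prod_right
    (f := fun x r => F x (a x + (b x - a x) * r)) ?_).measurable
  exact (hF.comp (f := fun q : X × ℝ => (q.1, a q.1 + (b q.1 - a q.1) * q.2))
    (by fun_prop)).stronglyMeasurable

lemma measurable_kgSin_param {F : ℝ → ℝ → ℝ} (hF : Measurable (Function.uncurry F)) :
    Measurable fun q : ℝ × ℝ × ℝ => kgSin (F q.1) q.2.1 q.2.2 := by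
  unfold kgSin
  refine measurable_const.mul (measurable_integral_moving
    (F := fun (q : ℝ × ℝ × ℝ) z => besselC 0 ((q.2.1 ^ 2 - (q.2.2 - z) ^ 2) / 16) * F q.1 z)
    ?_ (by fun_prop) (by fun_prop))
  refine Measurable.mul ?_ (hF.comp (f := fun q : (ℝ × ℝ × ℝ) × ℝ => (q.1.1, q.2)) (by fun_prop))
  exact (by fun_prop : Continuous fun q : (ℝ × ℝ × ℝ) × ℝ =>
    besselC 0 ((q.1.2.1 ^ 2 - (q.1.2.2 - q.2) ^ 2) / 16)).measurable

lemma measurable_kgSin {f : ℝ → ℝ} (hf : Measurable f) :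
    Measurable (Function.uncurry (kgSin f)) := by
  have := (measurable_kgSin_param (F := fun _ => f) (hf.comp measurable_snd)).comp
    (f := fun q : ℝ × ℝ => ((0 : ℝ), q.1, q.2)) (by fun_prop)
  exact this

/-- The Volterra equation `K = W + W * (K / 4)` relating the Riemann function `K` of
`v_tt - v_xx = v / 4` to that of the wave equation, tested against the initial velocity `f`. In null
coordinates it amounts to two exchanges of integrals and two antiderivatives. -/
lemma kgSin_volterra {f : ℝ → ℝ} (hf : Measurable f) {t x M : ℝ} (ht : 0 ≤ t)
    (hM : ∀ z ∈ Icc (x - t) (x + t), |f z| ≤ M) :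
    kgSin f t x = 1 / 2 * (∫ z in (x - t)..(x + t), f z) + 1 / 4 * coneInt (kgSin f) t x := by
  set α := x + t with hα
  set β := x - t with hβ
  have hβα : β ≤ α := by linarith
  have hM0 : 0 ≤ M := (abs_nonneg _).trans (hM α ⟨hβα, le_rfl⟩)
  have hfi : ∀ u ∈ Icc β α, ∀ v ∈ Icc β α, IntervalIntegrable f volume u v := fun u hu v hv =>
    intervalIntegrable_of_bounded hf.aestronglyMeasurable fun z hz =>
      hM z (uIcc_subset_Icc hu hv (uIoc_subset_uIcc hz))
  -- bounds for continuous factors on compact sets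
  have hcb : ∀ g : ℝ × ℝ × ℝ → ℝ, Continuous g → ∃ L, 0 ≤ L ∧
      ∀ a ∈ Icc β α, ∀ b ∈ Icc β α, ∀ z ∈ Icc β α, |g (a, b, z)| ≤ L := by
    intro g hg
    obtain ⟨L, hL⟩ := ((isCompact_Icc (a := β) (b := α)).prod ((isCompact_Icc (a := β) (b := α)).prod
      (isCompact_Icc (a := β) (b := α)))).exists_bound_of_continuousOn hg.continuousOn
    refine ⟨|L|, abs_nonneg _, fun a ha b hb z hz => (hL (a, b, z) ⟨ha, hb, hz⟩).trans (le_abs_self L)⟩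
  have key : ∫ a in β..α, ∫ b in β..a, kgSin f ((a - b) / 2) ((a + b) / 2) =
      16 * (kgSin f t x - 1 / 2 * ∫ z in β..α, f z) := by
    have inner : ∀ a ∈ uIcc β α, ∫ b in β..a, kgSin f ((a - b) / 2) ((a + b) / 2) =
        ∫ z in β..a, 1 / 2 * ((z - β) * besselC 1 ((a - z) * (z - β) / 16) * f z) := by
      intro a ha
      rw [uIcc_of_le hβα] at ha
      simp_rw [kgSin_null]
      rw [intervalIntegral.integral_const_mul]
      obtain ⟨L, hL0, hL⟩ := hcb (fun q => besselC 0 ((q.1 - q.2.2) * (q.2.2 - q.2.1) / 16))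
        (by fun_prop)
      rw [← intervalIntegral_swap_triangle
        (F := fun z b => besselC 0 ((a - z) * (z - b) / 16) * f z) (M := L * M) ?_ ha.1 ?_,
        ← intervalIntegral.integral_const_mul]
      · refine intervalIntegral.integral_congr fun z _ => ?_
        rw [intervalIntegral.integral_mul_const, integral_besselC_zero_lower]
      · refine Measurable.mul ?_ (hf.comp measurable_fst)
        exact (by fun_prop : Continuous fun q : ℝ × ℝ =>
          besselC 0 ((a - q.1) * (q.1 - q.2) / 16)).measurable
      · intro z b h1 h2 h3
        rw [abs_mul]
        have hz : z ∈ Icc β α := ⟨h1.trans h2, h3.trans ha.2⟩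
        exact mul_le_mul (hL a ha b ⟨h1, h2.trans hz.2⟩ z hz) (hM z hz) (abs_nonneg _) hL0
    rw [intervalIntegral.integral_congr inner]
    obtain ⟨L, hL0, hL⟩ := hcb (fun q => 1 / 2 * ((q.2.2 - β) *
      besselC 1 ((q.1 - q.2.2) * (q.2.2 - β) / 16))) (by fun_prop)
    rw [intervalIntegral_swap_triangle
        (F := fun a z => 1 / 2 * ((z - β) * besselC 1 ((a - z) * (z - β) / 16) * f z))
        (M := L * M) ?_ hβα ?_]
    · have e : ∀ z ∈ uIcc β α,
          ∫ a in z..α, 1 / 2 * ((z - β) * besselC 1 ((a - z) * (z - β) / 16) * f z) =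
          8 * (besselC 0 ((α - z) * (z - β) / 16) * f z) - 8 * f z := by
        intro z _
        rw [intervalIntegral.integral_const_mul, intervalIntegral.integral_mul_const,
          integral_besselC_one_upper]
        ring
      rw [intervalIntegral.integral_congr e, intervalIntegral.integral_sub,
        intervalIntegral.integral_const_mul, intervalIntegral.integral_const_mul]
      · have := kgSin_null f α β
        rw [show (α - β) / 2 = t by rw [hα, hβ]; ring, show (α + β) / 2 = x by rw [hα, hβ]; ring]
          at this
        rw [this]
        ring
      · refine IntervalIntegrable.const_mul ?_ 8
        exact (hfi β ⟨le_rfl, hβα⟩ α ⟨hβα, le_rfl⟩).continuousOn_mul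
          (by fun_prop : Continuous fun z => besselC 0 ((α - z) * (z - β) / 16)).continuousOn
      · exact (hfi β ⟨le_rfl, hβα⟩ α ⟨hβα, le_rfl⟩).const_mul 8
    · refine Measurable.const_mul (Measurable.mul ?_ (hf.comp measurable_snd)) _
      exact (by fun_prop : Continuous fun q : ℝ × ℝ =>
        (q.2 - β) * besselC 1 ((q.1 - q.2) * (q.2 - β) / 16)).measurable
    · intro a z h1 h2 h3
      have hz : z ∈ Icc β α := ⟨h1, h2.trans h3⟩
      rw [← mul_assoc, abs_mul]
      exact mul_le_mul (hL a ⟨h1.trans h2, h3⟩ β ⟨le_rfl, hβα⟩ z hz) (hM z hz) (abs_nonneg _) hL0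
  rw [integral_null_eq_coneInt (measurable_kgSin hf) (M := M * t * Real.exp (t / 2)) ht ?_] at key
  · linarith
  · intro σ z h0 h1 hz
    refine (abs_kgSin_le h0 (M := M) fun y hy => hM y ⟨?_, ?_⟩).trans ?_
    · rw [hβ]; linarith [hy.1, hz.1]
    · rw [hα]; linarith [hy.2, hz.2]
    · gcongr

lemma abs_integral_le_of_abs_le {f : ℝ → ℝ} {a b C : ℝ} (hab : a ≤ b)
    (hC : ∀ z ∈ Icc a b, |f z| ≤ C) : |∫ z in a..b, f z| ≤ C * (b - a) := by
  have h := intervalIntegral.norm_integral_le_of_norm_le_const (a := a) (b := b) (f := f) (C := C)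
    fun z hz => by
      rw [uIoc_of_le hab] at hz
      exact hC z (Ioc_subset_Icc_self hz)
  rwa [Real.norm_eq_abs, abs_of_nonneg (sub_nonneg.2 hab)] at h

/-- The cone integral with the time variable measured from the vertex of the cone. -/
lemma coneInt_eq_vertex (g : ℝ → ℝ → ℝ) (t x : ℝ) :
    coneInt g t x = 1 / 2 * ∫ σ in (0 : ℝ)..t, ∫ z in (x - σ)..(x + σ), g (t - σ) z := by
  have h := intervalIntegral.integral_comp_sub_left
    (fun σ => ∫ z in (x - (t - σ))..(x + (t - σ)), g σ z) (a := 0) (b := t) t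
  simp only [sub_sub_cancel, sub_zero, sub_self] at h
  rw [coneInt, h]

/-- The Volterra equation for `kgCos` is the time derivative of the one for `kgSin`. -/
lemma kgCos_volterra {f : ℝ → ℝ} (hf : Continuous f) {t : ℝ} (ht : 0 ≤ t) (x : ℝ) :
    kgCos f t x = 1 / 2 * (f (x + t) + f (x - t)) + 1 / 4 * coneInt (kgCos f) t x := by
  rcases ht.eq_or_lt with rfl | ht
  · simp [kgCos, coneInt]
  have h1 := hasDerivAt_kgSin hf t x
  have h2 : HasDerivAt (fun s => 1 / 2 * (∫ z in (x - s)..(x + s), f z) + 1 / 4 *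
      coneInt (kgSin f) s x)
      (1 / 2 * (f (x + t) + f (x - t)) + 1 / 4 * coneInt (kgCos f) t x) t := by
    refine HasDerivAt.add ?_ (HasDerivAt.const_mul _ ?_)
    · have := hasDerivAt_integral_leibniz (h := fun _ z => f z) (h' := fun _ _ => 0) (t := t)
        (by fun_prop) (by fun_prop) (fun _ z => hasDerivAt_const _ _) (a := fun s => x - s)
        (b := fun s => x + s) (by fun_prop) (by fun_prop) ((hasDerivAt_id t).const_sub x)
        ((hasDerivAt_id t).const_add x)
      refine (this.const_mul (1 / 2)).congr_deriv ?_
      simp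
    · simp_rw [coneInt_eq_vertex]
      have hS : Continuous fun q : ℝ × ℝ => kgSin f q.1 q.2 := continuous_kgSin hf
      have hC : Continuous fun q : ℝ × ℝ => kgCos f q.1 q.2 := continuous_kgCos hf
      have hd : ∀ t σ, HasDerivAt (fun s => ∫ z in (x - σ)..(x + σ), kgSin f (s - σ) z)
          (∫ z in (x - σ)..(x + σ), kgCos f (t - σ) z) t := by
        intro t σ
        refine hasDerivAt_integral_fixed (h := fun s z => kgSin f (s - σ) z)
          (h' := fun s z => kgCos f (s - σ) z) ?_ ?_ (fun s z => ?_) _ _ _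
        · exact hS.comp (f := fun q : ℝ × ℝ => (q.1 - σ, q.2)) (by fun_prop)
        · exact hC.comp (f := fun q : ℝ × ℝ => (q.1 - σ, q.2)) (by fun_prop)
        · exact (hasDerivAt_kgSin hf (s - σ) z).comp_sub_const s σ
      have := hasDerivAt_integral_leibniz (t := t)
        (h := fun s σ => ∫ z in (x - σ)..(x + σ), kgSin f (s - σ) z)
        (h' := fun s σ => ∫ z in (x - σ)..(x + σ), kgCos f (s - σ) z)
        (continuous_integral_moving
          (f := fun (q : ℝ × ℝ) z => kgSin f (q.1 - q.2) z) (a := fun q : ℝ × ℝ => x - q.2)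
          (b := fun q : ℝ × ℝ => x + q.2)
          (hS.comp (f := fun q : (ℝ × ℝ) × ℝ => (q.1.1 - q.1.2, q.2)) (by fun_prop))
          (by fun_prop) (by fun_prop))
        (continuous_integral_moving
          (f := fun (q : ℝ × ℝ) z => kgCos f (q.1 - q.2) z) (a := fun q : ℝ × ℝ => x - q.2)
          (b := fun q : ℝ × ℝ => x + q.2)
          (hC.comp (f := fun q : (ℝ × ℝ) × ℝ => (q.1.1 - q.1.2, q.2)) (by fun_prop))
          (by fun_prop) (by fun_prop)) hd (a := fun _ => 0)
        (b := fun s => s) (by fun_prop) (by fun_prop) (hasDerivAt_const _ _) (hasDerivAt_id t)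
      refine (this.const_mul (1 / 2)).congr_deriv ?_
      simp [kgSin]
  have e : (fun s => kgSin f s x) =ᶠ[nhds t] fun s =>
      1 / 2 * (∫ z in (x - s)..(x + s), f z) + 1 / 4 * coneInt (kgSin f) s x := by
    filter_upwards [lt_mem_nhds ht] with s hs
    obtain ⟨M, hM⟩ := (isCompact_Icc (a := x - s) (b := x + s)).exists_bound_of_continuousOn
      hf.continuousOn
    exact kgSin_volterra hf.measurable hs.le hM
  exact h1.unique (h2.congr_of_eventuallyEq e)

/-- The Duhamel term of `v_tt - v_xx = v / 4 + F`. -/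
def kgDuhamel (F : ℝ → ℝ → ℝ) (t x : ℝ) : ℝ := ∫ τ in (0 : ℝ)..t, kgSin (F τ) (t - τ) x

lemma measurable_kgDuhamel {F : ℝ → ℝ → ℝ} (hF : Measurable (Function.uncurry F)) :
    Measurable (Function.uncurry (kgDuhamel F)) := by
  refine measurable_integral_moving (F := fun (q : ℝ × ℝ) τ => kgSin (F τ) (q.1 - τ) q.2)
    ?_ measurable_const measurable_fst
  exact (measurable_kgSin_param hF).comp
    (f := fun q : (ℝ × ℝ) × ℝ => (q.2, q.1.1 - q.2, q.1.2)) (by fun_prop)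

lemma abs_kgDuhamel_le {F : ℝ → ℝ → ℝ} {t x M : ℝ} (ht : 0 ≤ t)
    (hM : ∀ τ z, 0 ≤ τ → τ ≤ t → |F τ z| ≤ M) :
    |kgDuhamel F t x| ≤ M * t * Real.exp (t / 2) * t := by
  have hM0 : 0 ≤ M := (abs_nonneg _).trans (hM 0 0 le_rfl ht)
  have h := abs_integral_le_of_abs_le ht (f := fun τ => kgSin (F τ) (t - τ) x)
    (C := M * t * Real.exp (t / 2)) fun τ hτ => by
      refine (abs_kgSin_le (by linarith [hτ.2]) fun z _ => hM τ z hτ.1 hτ.2).trans ?_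
      have h1 : t - τ ≤ t := by linarith [hτ.1]
      have h2 : 0 ≤ t - τ := by linarith [hτ.2]
      gcongr
  rwa [sub_zero] at h

/-- The Volterra equation of the Duhamel term, obtained from that of `kgSin` on each time slice. -/
lemma kgDuhamel_volterra {F : ℝ → ℝ → ℝ} (hF : Measurable (Function.uncurry F)) {t M : ℝ}
    (ht : 0 ≤ t) (hM : ∀ τ z, 0 ≤ τ → τ ≤ t → |F τ z| ≤ M) (x : ℝ) :
    kgDuhamel F t x = coneInt F t x + 1 / 4 * coneInt (kgDuhamel F) t x := by
  have hM0 : 0 ≤ M := (abs_nonneg _).trans (hM 0 0 le_rfl ht)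
  have hFm : ∀ τ, Measurable (F τ) := fun τ => hF.comp (f := fun z => (τ, z)) (by fun_prop)
  have hK := measurable_kgSin_param hF
  set B := M * t * Real.exp (t / 2)
  have hB : ∀ τ σ z, 0 ≤ τ → τ ≤ t → 0 ≤ σ → σ ≤ t → |kgSin (F τ) σ z| ≤ B := by
    intro τ σ z h1 h2 h3 h4
    refine (abs_kgSin_le h3 fun z _ => hM τ z h1 h2).trans ?_
    change _ ≤ M * t * Real.exp (t / 2)
    gcongr
  -- the integrals over the cone below `(t - τ, x)` as an integral over later times
  have e1 : ∀ τ, coneInt (kgSin (F τ)) (t - τ) x =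
      1 / 2 * ∫ σ in τ..t, ∫ z in (x - (t - σ))..(x + (t - σ)), kgSin (F τ) (σ - τ) z := by
    intro τ
    have h := intervalIntegral.integral_comp_sub_right
      (fun σ => ∫ z in (x - (t - τ - σ))..(x + (t - τ - σ)), kgSin (F τ) σ z) (a := τ) (b := t) τ
    rw [sub_self] at h
    rw [coneInt, ← h]
    congr 1
    refine intervalIntegral.integral_congr fun σ _ => ?_
    rw [show t - τ - (σ - τ) = t - σ by ring]
  have hin : Measurable (Function.uncurry fun σ τ =>
      ∫ z in (x - (t - σ))..(x + (t - σ)), kgSin (F τ) (σ - τ) z) :=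
    measurable_integral_moving (F := fun (q : ℝ × ℝ) z => kgSin (F q.2) (q.1 - q.2) z)
      (hK.comp (f := fun q : (ℝ × ℝ) × ℝ => (q.1.2, q.1.1 - q.1.2, q.2)) (by fun_prop))
      (by fun_prop) (by fun_prop)
  have hinB : ∀ σ τ, 0 ≤ τ → τ ≤ σ → σ ≤ t →
      |∫ z in (x - (t - σ))..(x + (t - σ)), kgSin (F τ) (σ - τ) z| ≤ B * (2 * t) := by
    intro σ τ h1 h2 h3
    refine (abs_integral_le_of_abs_le (by linarith)
      fun z _ => hB τ (σ - τ) z h1 (h2.trans h3) (by linarith) (by linarith)).trans ?_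
    rw [show x + (t - σ) - (x - (t - σ)) = 2 * (t - σ) by ring]
    have : 0 ≤ B := by positivity
    gcongr
    linarith
  have e2 : ∫ τ in (0 : ℝ)..t, coneInt (kgSin (F τ)) (t - τ) x = coneInt (kgDuhamel F) t x := by
    simp_rw [e1]
    rw [intervalIntegral.integral_const_mul, coneInt,
      ← intervalIntegral_swap_triangle hin ht hinB]
    congr 1
    refine intervalIntegral.integral_congr fun σ hσ => ?_
    rw [uIcc_of_le ht] at hσ
    refine intervalIntegral_swap_of_bounded (F := fun τ z => kgSin (F τ) (σ - τ) z) (M := B)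
      (hK.comp (f := fun q : ℝ × ℝ => (q.1, σ - q.1, q.2)) (by fun_prop)) fun τ hτ z _ => ?_
    rw [uIoc_of_le hσ.1] at hτ
    exact hB τ (σ - τ) z hτ.1.le (hτ.2.trans hσ.2) (by linarith [hτ.2]) (by linarith [hτ.1, hσ.2])
  have e3 : ∀ τ ∈ uIcc 0 t, kgSin (F τ) (t - τ) x =
      1 / 2 * (∫ z in (x - (t - τ))..(x + (t - τ)), F τ z) +
        1 / 4 * coneInt (kgSin (F τ)) (t - τ) x := by
    intro τ hτ
    rw [uIcc_of_le ht] at hτ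
    exact kgSin_volterra (hFm τ) (by linarith [hτ.2]) fun z _ => hM τ z hτ.1 hτ.2
  have hcone : ∀ τ ∈ uIoc 0 t, |coneInt (kgSin (F τ)) (t - τ) x| ≤ B * t * t := by
    intro τ hτ
    rw [uIoc_of_le ht] at hτ
    rw [e1, abs_mul, abs_of_pos (by norm_num : (0 : ℝ) < 1 / 2)]
    have := abs_integral_le_of_abs_le hτ.2 fun σ hσ => hinB σ τ hτ.1.le hσ.1 hσ.2
    have hB0 : 0 ≤ B := by positivity
    have : B * (2 * t) * (t - τ) ≤ B * (2 * t) * t := by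
      have := hτ.1
      gcongr
      linarith
    linarith
  rw [kgDuhamel, intervalIntegral.integral_congr e3, intervalIntegral.integral_add,
    intervalIntegral.integral_const_mul, intervalIntegral.integral_const_mul, e2, ← coneInt]
  · refine IntervalIntegrable.const_mul (intervalIntegrable_of_bounded (M := M * (2 * t)) ?_ ?_) _
    · exact (measurable_integral_moving (F := fun τ z => F τ z) hF (by fun_prop)
        (by fun_prop)).aestronglyMeasurable
    · intro τ hτ
      rw [uIoc_of_le ht] at hτ
      refine (abs_integral_le_of_abs_le (by linarith [hτ.2])
        fun z _ => hM τ z hτ.1.le hτ.2).trans ?_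
      rw [show x + (t - τ) - (x - (t - τ)) = 2 * (t - τ) by ring]
      gcongr
      linarith [hτ.1]
  · refine IntervalIntegrable.const_mul (intervalIntegrable_of_bounded (M := B * t * t) ?_ hcone) _
    have hin' : Measurable (Function.uncurry fun τ σ =>
        ∫ z in (x - (t - σ))..(x + (t - σ)), kgSin (F τ) (σ - τ) z) :=
      measurable_integral_moving (F := fun (q : ℝ × ℝ) z => kgSin (F q.1) (q.2 - q.1) z)
        (hK.comp (f := fun q : (ℝ × ℝ) × ℝ => (q.1.1, q.1.2 - q.1.1, q.2)) (by fun_prop))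
        (by fun_prop) (by fun_prop)
    have hm : Measurable fun τ => ∫ σ in τ..t, ∫ z in (x - (t - σ))..(x + (t - σ)),
        kgSin (F τ) (σ - τ) z :=
      measurable_integral_moving
        (F := fun τ σ => ∫ z in (x - (t - σ))..(x + (t - σ)), kgSin (F τ) (σ - τ) z)
        hin' measurable_id measurable_const
    simp_rw [e1]
    exact (hm.const_mul (1 / 2)).aestronglyMeasurable

/-! ### The linear solution and its derivatives -/

/-- `exp (t / 2) (S(t) ψ + ∂ₜS(t) ψ)`: the solution of `v_tt - v_xx = v / 4` with `v(0) = ψ` and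
`v_t(0) = ψ / 2`. -/
def kgLin (ψ : ℝ → ℝ) (t x : ℝ) : ℝ :=
  1 / 2 * (ψ (x + t) + ψ (x - t)) + 1 / 2 * ∫ z in (x - t)..(x + t),
    (1 / 2 * besselC 0 ((t ^ 2 - (x - z) ^ 2) / 16) +
      t / 8 * besselC 1 ((t ^ 2 - (x - z) ^ 2) / 16)) * ψ z

/-- The time derivative of `kgLin`, in terms of `ψ` and its derivative `ψ'`. -/
def kgLinT (ψ ψ' : ℝ → ℝ) (t x : ℝ) : ℝ :=
  1 / 2 * (ψ' (x + t) - ψ' (x - t)) + 1 / 2 * (1 / 2 + t / 8) * (ψ (x + t) + ψ (x - t)) +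
    1 / 2 * ∫ z in (x - t)..(x + t),
      ((t / 16 + 1 / 8) * besselC 1 ((t ^ 2 - (x - z) ^ 2) / 16) +
        t ^ 2 / 64 * besselC 2 ((t ^ 2 - (x - z) ^ 2) / 16)) * ψ z

/-- The space derivative of `kgLin`, in terms of `ψ` and its derivative `ψ'`. -/
def kgLinX (ψ ψ' : ℝ → ℝ) (t x : ℝ) : ℝ :=
  1 / 2 * (ψ' (x + t) + ψ' (x - t)) + 1 / 2 * (1 / 2 + t / 8) * (ψ (x + t) - ψ (x - t)) +
    1 / 2 * ∫ z in (x - t)..(x + t),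
      (-((x - z) / 16) * besselC 1 ((t ^ 2 - (x - z) ^ 2) / 16) -
        t * (x - z) / 64 * besselC 2 ((t ^ 2 - (x - z) ^ 2) / 16)) * ψ z

lemma kgLin_eq {ψ : ℝ → ℝ} (hψ : Continuous ψ) (t x : ℝ) :
    kgLin ψ t x = kgCos ψ t x + 1 / 2 * kgSin ψ t x := by
  rw [kgLin, kgCos, kgSin]
  have : ∀ z, (1 / 2 * besselC 0 ((t ^ 2 - (x - z) ^ 2) / 16) +
      t / 8 * besselC 1 ((t ^ 2 - (x - z) ^ 2) / 16)) * ψ z =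
      1 / 2 * (besselC 0 ((t ^ 2 - (x - z) ^ 2) / 16) * ψ z) +
      t / 8 * besselC 1 ((t ^ 2 - (x - z) ^ 2) / 16) * ψ z := fun z => by ring
  simp_rw [this]
  rw [intervalIntegral.integral_add ((by fun_prop : Continuous _).intervalIntegrable _ _)
    ((by fun_prop : Continuous _).intervalIntegrable _ _), intervalIntegral.integral_const_mul]
  ring

lemma uL_eq_kgLin {φ : ℝ → ℝ} (hφ : Continuous φ) (ε t x : ℝ) :
    uL ε φ t x = ε * (Real.exp (-t / 2) * kgLin φ t x) := by
  rw [uL, S_eq_kgSin, dtS_eq_kg hφ, kgLin_eq hφ]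
  ring

lemma continuous_kgLin {ψ : ℝ → ℝ} (hψ : Continuous ψ) :
    Continuous fun q : ℝ × ℝ => kgLin ψ q.1 q.2 := by
  unfold kgLin
  exact Continuous.add (by fun_prop) (continuous_const.mul
    (continuous_integral_moving (by fun_prop) (by fun_prop) (by fun_prop)))

lemma continuous_kgLinT {ψ ψ' : ℝ → ℝ} (hψ : Continuous ψ) (hψ' : Continuous ψ') :
    Continuous fun q : ℝ × ℝ => kgLinT ψ ψ' q.1 q.2 := by
  unfold kgLinT
  exact Continuous.add (by fun_prop) (continuous_const.mul
    (continuous_integral_moving (by fun_prop) (by fun_prop) (by fun_prop)))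

lemma continuous_kgLinX {ψ ψ' : ℝ → ℝ} (hψ : Continuous ψ) (hψ' : Continuous ψ') :
    Continuous fun q : ℝ × ℝ => kgLinX ψ ψ' q.1 q.2 := by
  unfold kgLinX
  exact Continuous.add (by fun_prop) (continuous_const.mul
    (continuous_integral_moving (by fun_prop) (by fun_prop) (by fun_prop)))

lemma hasDerivAt_affine (t₀ c s : ℝ) : HasDerivAt (fun s => t₀ + c * s) c s := by
  simpa using ((hasDerivAt_id s).const_mul c).const_add t₀

/-- The argument of the Bessel–Clifford functions in the kernels, along a line. -/
lemma hasDerivAt_besselC_line (n : ℕ) (t₀ c x₀ d z s : ℝ) :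
    HasDerivAt (fun s => besselC n (((t₀ + c * s) ^ 2 - (x₀ + d * s - z) ^ 2) / 16))
      (besselC (n + 1) (((t₀ + c * s) ^ 2 - (x₀ + d * s - z) ^ 2) / 16) *
        ((c * (t₀ + c * s) - d * (x₀ + d * s - z)) / 8)) s := by
  have h1 : HasDerivAt (fun s => ((t₀ + c * s) ^ 2 - (x₀ + d * s - z) ^ 2) / 16)
      ((c * (t₀ + c * s) - d * (x₀ + d * s - z)) / 8) s := by
    refine ((((hasDerivAt_affine t₀ c s).pow 2).sub
      (((hasDerivAt_affine x₀ d s).sub_const z).pow 2)).div_const 16).congr_deriv ?_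
    norm_num
    ring
  exact (hasDerivAt_besselC n _).comp s h1

lemma hasDerivAt_kgLin_line {ψ ψ' : ℝ → ℝ} (hd : ∀ x, HasDerivAt ψ (ψ' x) x)
    (t₀ c x₀ d s : ℝ) :
    HasDerivAt (fun s => kgLin ψ (t₀ + c * s) (x₀ + d * s))
      (c * kgLinT ψ ψ' (t₀ + c * s) (x₀ + d * s) +
        d * kgLinX ψ ψ' (t₀ + c * s) (x₀ + d * s)) s := by
  have hψ : Continuous ψ := continuous_iff_continuousAt.2 fun x => (hd x).continuousAt
  have hk : ∀ s z, HasDerivAt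
      (fun s => (1 / 2 * besselC 0 (((t₀ + c * s) ^ 2 - (x₀ + d * s - z) ^ 2) / 16) +
        (t₀ + c * s) / 8 * besselC 1 (((t₀ + c * s) ^ 2 - (x₀ + d * s - z) ^ 2) / 16)) * ψ z)
      ((c * (((t₀ + c * s) / 16 + 1 / 8) *
            besselC 1 (((t₀ + c * s) ^ 2 - (x₀ + d * s - z) ^ 2) / 16) +
          (t₀ + c * s) ^ 2 / 64 * besselC 2 (((t₀ + c * s) ^ 2 - (x₀ + d * s - z) ^ 2) / 16)) +
        d * (-((x₀ + d * s - z) / 16) *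
            besselC 1 (((t₀ + c * s) ^ 2 - (x₀ + d * s - z) ^ 2) / 16) -
          (t₀ + c * s) * (x₀ + d * s - z) / 64 *
            besselC 2 (((t₀ + c * s) ^ 2 - (x₀ + d * s - z) ^ 2) / 16))) * ψ z) s := by
    intro s z
    refine ((((hasDerivAt_besselC_line 0 t₀ c x₀ d z s).const_mul (1 / 2)).add
      (((hasDerivAt_affine t₀ c s).div_const 8).mul
        (hasDerivAt_besselC_line 1 t₀ c x₀ d z s))).mul_const (ψ z)).congr_deriv ?_
    simp only [zero_add, Nat.reduceAdd]
    ring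
  have hα : HasDerivAt (fun s => x₀ + d * s + (t₀ + c * s)) (d + c) s :=
    (hasDerivAt_affine x₀ d s).add (hasDerivAt_affine t₀ c s)
  have hβ : HasDerivAt (fun s => x₀ + d * s - (t₀ + c * s)) (d - c) s :=
    (hasDerivAt_affine x₀ d s).sub (hasDerivAt_affine t₀ c s)
  have hI := hasDerivAt_integral_leibniz (by fun_prop) (by fun_prop) hk
    (a := fun s => x₀ + d * s - (t₀ + c * s)) (b := fun s => x₀ + d * s + (t₀ + c * s))
    (by fun_prop) (by fun_prop) hβ hα
  have h1 := ((hd _).comp s hα).add ((hd _).comp s hβ)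
  refine ((h1.const_mul (1 / 2)).add (hI.const_mul (1 / 2))).congr_deriv ?_
  set T := t₀ + c * s
  set X := x₀ + d * s
  rw [kgLinT, kgLinX]
  simp only [add_mul, mul_assoc c, mul_assoc d]
  rw [intervalIntegral.integral_add ((by fun_prop : Continuous _).intervalIntegrable _ _)
    ((by fun_prop : Continuous _).intervalIntegrable _ _), intervalIntegral.integral_const_mul,
    intervalIntegral.integral_const_mul]
  simp only [sub_add_cancel_left, neg_sq, sub_self, sub_sub_cancel, zero_div, besselC_zero_right]
  norm_num
  ring

lemma kgLinT_add_kgLinX {ψ ψ' : ℝ → ℝ} (hψ : Continuous ψ) (t x : ℝ) :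
    kgLinT ψ ψ' t x + kgLinX ψ ψ' t x = ψ' (x + t) + (1 / 2 + t / 8) * ψ (x + t) +
      1 / 2 * ∫ z in (x - t)..(x + t),
        (((t - (x - z)) / 16 + 1 / 8) * besselC 1 ((t ^ 2 - (x - z) ^ 2) / 16) +
          t * (t - (x - z)) / 64 * besselC 2 ((t ^ 2 - (x - z) ^ 2) / 16)) * ψ z := by
  have e : ∀ z, (((t - (x - z)) / 16 + 1 / 8) * besselC 1 ((t ^ 2 - (x - z) ^ 2) / 16) +
          t * (t - (x - z)) / 64 * besselC 2 ((t ^ 2 - (x - z) ^ 2) / 16)) * ψ z =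
      ((t / 16 + 1 / 8) * besselC 1 ((t ^ 2 - (x - z) ^ 2) / 16) +
        t ^ 2 / 64 * besselC 2 ((t ^ 2 - (x - z) ^ 2) / 16)) * ψ z +
      (-((x - z) / 16) * besselC 1 ((t ^ 2 - (x - z) ^ 2) / 16) -
        t * (x - z) / 64 * besselC 2 ((t ^ 2 - (x - z) ^ 2) / 16)) * ψ z := fun z => by ring
  simp_rw [e]
  rw [intervalIntegral.integral_add ((by fun_prop : Continuous _).intervalIntegrable _ _)
    ((by fun_prop : Continuous _).intervalIntegrable _ _), kgLinT, kgLinX]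
  ring

/-- The equation `v_tt - v_xx = v / 4` in characteristic form: `(∂ₜ - ∂ₓ)(v_t + v_x) = v / 4`.
This mixed derivative exists although `ψ` is only of class `C¹`. -/
lemma hasDerivAt_kgLin_mixed {ψ ψ' : ℝ → ℝ} (hψ : Continuous ψ) (t₀ x₀ s : ℝ) :
    HasDerivAt (fun s => kgLinT ψ ψ' (t₀ + 1 * s) (x₀ + -1 * s) +
        kgLinX ψ ψ' (t₀ + 1 * s) (x₀ + -1 * s))
      (1 / 4 * kgLin ψ (t₀ + 1 * s) (x₀ + -1 * s)) s := by
  have hk : ∀ s z, HasDerivAt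
      (fun s => (((t₀ + 1 * s - (x₀ + -1 * s - z)) / 16 + 1 / 8) *
          besselC 1 (((t₀ + 1 * s) ^ 2 - (x₀ + -1 * s - z) ^ 2) / 16) +
        (t₀ + 1 * s) * (t₀ + 1 * s - (x₀ + -1 * s - z)) / 64 *
          besselC 2 (((t₀ + 1 * s) ^ 2 - (x₀ + -1 * s - z) ^ 2) / 16)) * ψ z)
      (1 / 4 * ((1 / 2 * besselC 0 (((t₀ + 1 * s) ^ 2 - (x₀ + -1 * s - z) ^ 2) / 16) +
        (t₀ + 1 * s) / 8 *
          besselC 1 (((t₀ + 1 * s) ^ 2 - (x₀ + -1 * s - z) ^ 2) / 16)) * ψ z)) s := by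
    intro s z
    have h1 := hasDerivAt_besselC_line 1 t₀ 1 x₀ (-1) z s
    have h2 := hasDerivAt_besselC_line 2 t₀ 1 x₀ (-1) z s
    have h3 := hasDerivAt_affine t₀ 1 s
    have h4 := h3.sub ((hasDerivAt_affine x₀ (-1) s).sub_const z)
    refine (((((h4.div_const 16).add_const (1 / 8)).mul h1).add
      (((h3.mul h4).div_const 64).mul h2)).mul_const (ψ z)).congr_deriv ?_
    simp only [Pi.mul_apply, Pi.sub_apply]
    set T := t₀ + 1 * s
    set Y := x₀ + -1 * s - z
    have r0 := besselC_recurrence 0 ((T ^ 2 - Y ^ 2) / 16)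
    have r1 := besselC_recurrence 1 ((T ^ 2 - Y ^ 2) / 16)
    norm_num at r0 r1 ⊢
    rw [r0, r1]
    ring
  have hα : ∀ s, x₀ + -1 * s + (t₀ + 1 * s) = x₀ + t₀ := fun s => by ring
  have hβ : HasDerivAt (fun s => x₀ + -1 * s - (t₀ + 1 * s)) (-1 - 1) s :=
    (hasDerivAt_affine x₀ (-1) s).sub (hasDerivAt_affine t₀ 1 s)
  have hI := hasDerivAt_integral_leibniz (by fun_prop) (by fun_prop) hk
    (a := fun s => x₀ + -1 * s - (t₀ + 1 * s)) (b := fun _ => x₀ + t₀)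
    (by fun_prop) (by fun_prop) hβ (hasDerivAt_const s _)
  simp_rw [kgLinT_add_kgLinX hψ, hα]
  refine (((((hasDerivAt_affine t₀ 1 s).div_const 8).const_add (1 / 2)).mul_const
    (ψ (x₀ + t₀))).const_add (ψ' (x₀ + t₀)) |>.add (hI.const_mul (1 / 2))).congr_deriv ?_
  rw [kgLin, hα, intervalIntegral.integral_const_mul]
  simp only [sub_sub_cancel, sub_self, zero_div, besselC_zero_right]
  norm_num
  ring

/-- The exact formula behind the decay of the logarithmic time derivative: after subtracting half
of `v`, the kernel `∂ₜ k - k / 2` is `-H₁ / 8 + (y² / 64) H₂`, whose counterpart for the heat kernel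
is `-1 / (2 t) + y² / (4 t²)`. -/
lemma kgLinT_sub_half {ψ ψ' : ℝ → ℝ} (hψ : Continuous ψ) (t x : ℝ) :
    kgLinT ψ ψ' t x - 1 / 2 * kgLin ψ t x =
      1 / 2 * (ψ' (x + t) - ψ' (x - t)) + t / 16 * (ψ (x + t) + ψ (x - t)) +
      1 / 2 * ∫ z in (x - t)..(x + t),
        (-(1 / 8) * besselC 1 ((t ^ 2 - (x - z) ^ 2) / 16) +
          (x - z) ^ 2 / 64 * besselC 2 ((t ^ 2 - (x - z) ^ 2) / 16)) * ψ z := by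
  have e : ∀ z, (-(1 / 8) * besselC 1 ((t ^ 2 - (x - z) ^ 2) / 16) +
          (x - z) ^ 2 / 64 * besselC 2 ((t ^ 2 - (x - z) ^ 2) / 16)) * ψ z =
      ((t / 16 + 1 / 8) * besselC 1 ((t ^ 2 - (x - z) ^ 2) / 16) +
        t ^ 2 / 64 * besselC 2 ((t ^ 2 - (x - z) ^ 2) / 16)) * ψ z -
      1 / 2 * ((1 / 2 * besselC 0 ((t ^ 2 - (x - z) ^ 2) / 16) +
      t / 8 * besselC 1 ((t ^ 2 - (x - z) ^ 2) / 16)) * ψ z) := fun z => by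
    have r0 := besselC_recurrence 0 ((t ^ 2 - (x - z) ^ 2) / 16)
    norm_num at r0
    rw [r0]
    ring
  simp_rw [e]
  rw [intervalIntegral.integral_sub ((by fun_prop : Continuous _).intervalIntegrable _ _)
    ((by fun_prop : Continuous _).intervalIntegrable _ _), intervalIntegral.integral_const_mul,
    kgLinT, kgLin]
  ring

section

/-! ### Slowly varying profiles and the linear estimates -/

/-- A positive `C¹` profile whose logarithm is Lipschitz, which is comparable to itself at unit
distance, and whose values at distance at most `t` are comparable up to a power of `t`. -/
structure SlowProfile (ψ ψ' : ℝ → ℝ) (K : ℝ) (N : ℕ) : Prop where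
  hasDerivAt : ∀ x, HasDerivAt ψ (ψ' x) x
  continuous_deriv : Continuous ψ'
  pos : ∀ x, 0 < ψ x
  abs_deriv_le : ∀ x, |ψ' x| ≤ K * ψ x
  near : ∀ x z, |x - z| ≤ 1 → ψ x ≤ K * ψ z
  far : ∀ t x z, 1 ≤ t → |x - z| ≤ t → ψ z ≤ K * t ^ N * ψ x

namespace SlowProfile

variable {ψ ψ' : ℝ → ℝ} {K : ℝ} {N : ℕ}

lemma continuous (h : SlowProfile ψ ψ' K N) : Continuous ψ :=
  continuous_iff_continuousAt.2 fun x => (h.hasDerivAt x).continuousAt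

lemma one_le (h : SlowProfile ψ ψ' K N) : 1 ≤ K := by
  have h1 := h.near 0 0 (by simp)
  have h2 := h.pos 0
  by_contra hK
  nlinarith

end SlowProfile

variable {ψ ψ' : ℝ → ℝ} {K : ℝ} {N : ℕ}

lemma kgLin_kernel_nonneg {t y : ℝ} (ht : 0 ≤ t) (hy : 0 ≤ (t ^ 2 - y ^ 2) / 16) :
    0 ≤ 1 / 2 * besselC 0 ((t ^ 2 - y ^ 2) / 16) + t / 8 * besselC 1 ((t ^ 2 - y ^ 2) / 16) := by
  have := besselC_nonneg 0 hy
  have := besselC_nonneg 1 hy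
  positivity

lemma integral_le_kgLin (hψ : ∀ x, 0 < ψ x) (t x : ℝ) :
    1 / 2 * (∫ z in (x - t)..(x + t), (1 / 2 * besselC 0 ((t ^ 2 - (x - z) ^ 2) / 16) +
      t / 8 * besselC 1 ((t ^ 2 - (x - z) ^ 2) / 16)) * ψ z) ≤ kgLin ψ t x := by
  have := hψ (x + t)
  have := hψ (x - t)
  rw [kgLin]
  linarith

lemma kgLin_pos (hψ : ∀ x, 0 < ψ x) {t : ℝ} (ht : 0 ≤ t) (x : ℝ) : 0 < kgLin ψ t x := by
  have h1 := hψ (x + t)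
  have h2 := hψ (x - t)
  have h3 : 0 ≤ ∫ z in (x - t)..(x + t), (1 / 2 * besselC 0 ((t ^ 2 - (x - z) ^ 2) / 16) +
      t / 8 * besselC 1 ((t ^ 2 - (x - z) ^ 2) / 16)) * ψ z :=
    intervalIntegral.integral_nonneg (by linarith) fun z hz =>
      mul_nonneg (kgLin_kernel_nonneg ht (mul_sub_nonneg_of_mem hz)) (hψ z).le
  rw [kgLin]
  linarith

lemma kgLin_mono {φ : ℝ → ℝ} (hψ : Continuous ψ) (hφ : Continuous φ) (h : ∀ x, ψ x ≤ φ x) {t : ℝ}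
    (ht : 0 ≤ t) (x : ℝ) : kgLin ψ t x ≤ kgLin φ t x := by
  have h1 := h (x + t)
  have h2 := h (x - t)
  have h3 : ∫ z in (x - t)..(x + t), (1 / 2 * besselC 0 ((t ^ 2 - (x - z) ^ 2) / 16) +
      t / 8 * besselC 1 ((t ^ 2 - (x - z) ^ 2) / 16)) * ψ z ≤
      ∫ z in (x - t)..(x + t), (1 / 2 * besselC 0 ((t ^ 2 - (x - z) ^ 2) / 16) +
      t / 8 * besselC 1 ((t ^ 2 - (x - z) ^ 2) / 16)) * φ z :=
    intervalIntegral.integral_mono_on (by linarith) ((by fun_prop : Continuous _).intervalIntegrable _ _)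
      ((by fun_prop : Continuous _).intervalIntegrable _ _) fun z hz =>
      mul_le_mul_of_nonneg_left (h z) (kgLin_kernel_nonneg ht (mul_sub_nonneg_of_mem hz))
  rw [kgLin, kgLin]
  linarith

lemma kgLin_le_of_le {M : ℝ} (h0 : ∀ x, 0 ≤ ψ x) (h : ∀ x, ψ x ≤ M) {t : ℝ}
    (ht : 0 ≤ t) (x : ℝ) : kgLin ψ t x ≤ M * (1 + t + t ^ 2) * Real.exp (t / 2) := by
  have h1 := h (x + t)
  have h2 := h (x - t)
  have hM : 0 ≤ M := (h0 x).trans (h x)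
  have h3 : |∫ z in (x - t)..(x + t), (1 / 2 * besselC 0 ((t ^ 2 - (x - z) ^ 2) / 16) +
      t / 8 * besselC 1 ((t ^ 2 - (x - z) ^ 2) / 16)) * ψ z| ≤
      ((1 / 2 + t / 8) * Real.exp (t / 2) * M) * (x + t - (x - t)) := by
    refine abs_integral_le_of_abs_le (by linarith) fun z hz => ?_
    have hw := mul_sub_nonneg_of_mem hz
    rw [abs_of_nonneg (mul_nonneg (kgLin_kernel_nonneg ht hw) (h0 z))]
    have e0 := besselC_zero_le_exp_half ht hw
    have e1 := (besselC_succ_le 0 hw).trans e0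
    rw [zero_add] at e1
    rw [add_mul (1 / 2) (t / 8)]
    have := h z
    have := h0 z
    gcongr
  have h4 := (le_abs_self _).trans h3
  have h5 : 1 ≤ Real.exp (t / 2) := Real.one_le_exp (by positivity)
  rw [kgLin]
  have h6 : M ≤ M * Real.exp (t / 2) := by nlinarith
  have h7 : 0 ≤ t ^ 2 * (M * Real.exp (t / 2)) := by positivity
  have h8 : 0 ≤ t * (M * Real.exp (t / 2)) := by positivity
  nlinarith

/-- The linear solution decays no faster than `t ^ (-1 / 2) ψ`. -/
lemma SlowProfile.le_kgLin (h : SlowProfile ψ ψ' K N) {t : ℝ} (ht : 3 ≤ t) (x : ℝ) :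
    5 / 32 * Real.exp (-1 / 2) / K * ψ x * Real.exp (t / 2) ≤ Real.sqrt t * kgLin ψ t x := by
  have hK := h.one_le
  have hK0 : 0 < K := by linarith
  have ht0 : 0 < Real.sqrt t := Real.sqrt_pos.2 (by linarith)
  set z₀ := (t - 1) / 2
  have hz₀ : 1 ≤ z₀ := by simp only [z₀]; linarith
  have hB : ∀ z ∈ Icc (x - 1) (x + 1), 5 / 16 * (Real.exp z₀ / Real.sqrt t) * (1 / 2) * (ψ x / K) ≤
      (1 / 2 * besselC 0 ((t ^ 2 - (x - z) ^ 2) / 16) +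
        t / 8 * besselC 1 ((t ^ 2 - (x - z) ^ 2) / 16)) * ψ z := by
    intro z hz
    have hxz : |x - z| ≤ 1 := abs_le.2 ⟨by linarith [hz.2], by linarith [hz.1]⟩
    have hxz2 : (x - z) ^ 2 ≤ 1 := by
      rw [← sq_abs]; nlinarith [abs_nonneg (x - z)]
    have hw : 0 ≤ (t ^ 2 - (x - z) ^ 2) / 16 := by nlinarith
    have h1 : 5 / 16 * (Real.exp z₀ / Real.sqrt t) ≤ besselC 0 ((t ^ 2 - (x - z) ^ 2) / 16) := by
      calc 5 / 16 * (Real.exp z₀ / Real.sqrt t) ≤ 5 / 16 * (Real.exp z₀ / Real.sqrt z₀) := by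
            have : 0 < Real.sqrt z₀ := Real.sqrt_pos.2 (by linarith)
            gcongr
            simp only [z₀]; linarith
        _ ≤ besselC 0 (z₀ ^ 2 / 4) := exp_div_sqrt_le_besselC_zero hz₀
        _ ≤ _ := besselC_mono 0 (by positivity) (by simp only [z₀]; nlinarith)
    have h2 := besselC_nonneg 1 hw
    have h3 : ψ x / K ≤ ψ z := by
      rw [div_le_iff₀ hK0, mul_comm]
      exact h.near x z hxz
    have h4 : 0 ≤ ψ x / K := div_nonneg (h.pos x).le hK0.le
    have h5 : 0 ≤ t / 8 * besselC 1 ((t ^ 2 - (x - z) ^ 2) / 16) := by positivity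
    refine mul_le_mul ?_ h3 h4 (kgLin_kernel_nonneg (by linarith) hw)
    linarith
  have hψ := h.continuous
  have hc : Continuous fun z => (1 / 2 * besselC 0 ((t ^ 2 - (x - z) ^ 2) / 16) +
        t / 8 * besselC 1 ((t ^ 2 - (x - z) ^ 2) / 16)) * ψ z := by fun_prop
  have h1 : 5 / 16 * (Real.exp z₀ / Real.sqrt t) * (1 / 2) * (ψ x / K) * 2 ≤
      ∫ z in (x - 1)..(x + 1), (1 / 2 * besselC 0 ((t ^ 2 - (x - z) ^ 2) / 16) +
        t / 8 * besselC 1 ((t ^ 2 - (x - z) ^ 2) / 16)) * ψ z := by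
    have := intervalIntegral.integral_mono_on (by linarith)
      (intervalIntegrable_const (μ := volume))
      (hc.intervalIntegrable (x - 1) (x + 1)) hB
    rw [intervalIntegral.integral_const, smul_eq_mul] at this
    linarith
  have h2 : ∫ z in (x - 1)..(x + 1), (1 / 2 * besselC 0 ((t ^ 2 - (x - z) ^ 2) / 16) +
        t / 8 * besselC 1 ((t ^ 2 - (x - z) ^ 2) / 16)) * ψ z ≤
      ∫ z in (x - t)..(x + t), (1 / 2 * besselC 0 ((t ^ 2 - (x - z) ^ 2) / 16) +
        t / 8 * besselC 1 ((t ^ 2 - (x - z) ^ 2) / 16)) * ψ z := by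
    refine intervalIntegral.integral_mono_interval (by linarith) (by linarith) (by linarith) ?_
      (hc.intervalIntegrable _ _)
    filter_upwards [ae_restrict_mem measurableSet_Ioc] with z hz
    exact mul_nonneg (kgLin_kernel_nonneg (by linarith)
      (mul_sub_nonneg_of_mem (Ioc_subset_Icc_self hz))) (h.pos z).le
  have h3 := integral_le_kgLin h.pos t x
  have h4 : 5 / 16 * (Real.exp z₀ / Real.sqrt t) * (1 / 2) * (ψ x / K) ≤ kgLin ψ t x := by
    linarith
  have e : Real.exp z₀ = Real.exp (-1 / 2) * Real.exp (t / 2) := by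
    rw [← Real.exp_add]; congr 1; simp only [z₀]; ring
  calc 5 / 32 * Real.exp (-1 / 2) / K * ψ x * Real.exp (t / 2) =
      Real.sqrt t * (5 / 16 * (Real.exp z₀ / Real.sqrt t) * (1 / 2) * (ψ x / K)) := by
        rw [e]; field_simp; ring
    _ ≤ _ := by gcongr

/-- The kernel `(y² / 64) H₂` is `O(t ^ (-1 / 2))` relative to `H₀` where `y² ≤ t ^ (3 / 2)`, and
beyond it is smaller than `exp (t / 2)` by a stretched exponential. -/
lemma sq_mul_besselC_two_le {t y : ℝ} (ht : 4 ≤ t) (hy : |y| ≤ t) :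
    y ^ 2 / 64 * besselC 2 ((t ^ 2 - y ^ 2) / 16) ≤
      1 / Real.sqrt t * (1 / 2 * besselC 0 ((t ^ 2 - y ^ 2) / 16)) +
        t ^ 2 / 64 * Real.exp (t / 2 - Real.sqrt t / 4) := by
  set r := Real.sqrt t
  have hr : 2 ≤ r := by
    rw [show (2 : ℝ) = Real.sqrt 4 by rw [show (4 : ℝ) = 2 ^ 2 by norm_num]; simp]
    exact Real.sqrt_le_sqrt ht
  have hr2 : r ^ 2 = t := Real.sq_sqrt (by linarith)
  have hyt : y ^ 2 ≤ t ^ 2 := sq_le_sq' (by linarith [(abs_le.1 hy).1]) (abs_le.1 hy).2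
  have hw : 0 ≤ (t ^ 2 - y ^ 2) / 16 := by linarith
  set w := (t ^ 2 - y ^ 2) / 16
  have h0 := besselC_nonneg 0 hw
  have h2 := besselC_nonneg 2 hw
  rcases le_or_gt (y ^ 2) (t * r) with hc | hc
  · have h3 : r ^ 4 / 32 ≤ w := by
      have e : w = (r ^ 4 - y ^ 2) / 16 := by simp only [w]; rw [← hr2]; ring
      rw [← hr2] at hc
      rw [e]
      nlinarith [pow_pos (show 0 < r by linarith) 3]
    have h4 := mul_besselC_two_le hw
    have h5 : r ^ 4 / 32 * besselC 2 w ≤ besselC 0 w :=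
      (mul_le_mul_of_nonneg_right h3 h2).trans h4
    have h6 : y ^ 2 / 64 * besselC 2 w ≤ r ^ 3 / 64 * besselC 2 w := by
      rw [← hr2] at hc
      gcongr
      linarith
    have h7 : r ^ 3 / 64 * besselC 2 w ≤ 1 / r * (1 / 2 * besselC 0 w) := by
      have e : r ^ 3 / 64 * besselC 2 w = 1 / r * (1 / 2 * (r ^ 4 / 32 * besselC 2 w)) := by
        field_simp; ring
      rw [e]
      gcongr
    have : 0 ≤ t ^ 2 / 64 * Real.exp (t / 2 - r / 4) := by positivity
    linarith
  · have h3 : besselC 2 w ≤ Real.exp (t / 2 - r / 4) := by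
      have hz : 0 ≤ t / 2 - r / 4 := by nlinarith
      refine (besselC_succ_le 1 hw).trans ((besselC_succ_le 0 hw).trans ?_)
      refine (besselC_mono 0 hw ?_).trans (besselC_zero_le_exp hz)
      simp only [w]
      nlinarith
    have h4 : y ^ 2 / 64 * besselC 2 w ≤ t ^ 2 / 64 * Real.exp (t / 2 - r / 4) := by gcongr
    have : 0 ≤ 1 / r * (1 / 2 * besselC 0 w) := by positivity
    linarith

lemma pow_le_exp_sqrt (m : ℕ) {t : ℝ} (ht : 0 ≤ t) :
    t ^ m ≤ 16 ^ m * ((2 * m).factorial : ℝ) * Real.exp (Real.sqrt t / 4) := by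
  have h := Real.pow_div_factorial_le_exp (Real.sqrt t / 4) (by positivity) (2 * m)
  have e : (Real.sqrt t / 4) ^ (2 * m) = t ^ m / 16 ^ m := by
    rw [pow_mul, div_pow, Real.sq_sqrt ht, div_pow]
    norm_num
  rw [e, div_div, div_le_iff₀ (by positivity)] at h
  linarith

/-- The logarithmic time derivative of the linear solution is `O(t ^ (-1 / 2))`. -/
lemma SlowProfile.exists_abs_kgLinT_sub_le (h : SlowProfile ψ ψ' K N) :
    ∃ L : ℝ, 0 < L ∧ ∀ t x, 4 ≤ t →
      |kgLinT ψ ψ' t x - 1 / 2 * kgLin ψ t x| ≤ L / Real.sqrt t * kgLin ψ t x := by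
  have hK := h.one_le
  have hψ := h.continuous
  set m := N + 4
  set L₁ : ℝ := 16 ^ m * ((2 * m).factorial : ℝ)
  have hL₁ : 0 < L₁ := by positivity
  set c : ℝ := 5 / 32 * Real.exp (-1 / 2) / K
  have hc : 0 < c := by positivity
  refine ⟨1 + K * (K + 1) * L₁ / c, by positivity, fun t x ht => ?_⟩
  set r := Real.sqrt t
  have hr : 1 ≤ r := Real.one_le_sqrt.2 (by linarith)
  have hr2 : r ^ 2 = t := Real.sq_sqrt (by linarith)
  have hrt : r ≤ t := by nlinarith
  have ht0 : 0 < t := by linarith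
  set V := kgLin ψ t x
  have hV : 0 < V := kgLin_pos h.pos ht0.le x
  set E := Real.exp (t / 2 - r / 4)
  have hE : 1 ≤ E := Real.one_le_exp (by linarith)
  set P := K * t ^ N * ψ x
  have hP : 0 < P := by have := h.pos x; positivity
  have hfar : ∀ z ∈ Icc (x - t) (x + t), ψ z ≤ P := fun z hz =>
    h.far t x z (by linarith) (abs_le.2 ⟨by linarith [hz.2], by linarith [hz.1]⟩)
  have hα := hfar (x + t) ⟨by linarith, le_rfl⟩
  have hβ := hfar (x - t) ⟨le_rfl, by linarith⟩
  -- the kernel part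
  have hI : |∫ z in (x - t)..(x + t),
        (-(1 / 8) * besselC 1 ((t ^ 2 - (x - z) ^ 2) / 16) +
          (x - z) ^ 2 / 64 * besselC 2 ((t ^ 2 - (x - z) ^ 2) / 16)) * ψ z| ≤
      1 / r * (2 * V) + t ^ 2 / 64 * E * P * (2 * t) := by
    have hpt : ∀ z ∈ Icc (x - t) (x + t),
        |(-(1 / 8) * besselC 1 ((t ^ 2 - (x - z) ^ 2) / 16) +
          (x - z) ^ 2 / 64 * besselC 2 ((t ^ 2 - (x - z) ^ 2) / 16)) * ψ z| ≤
        1 / r * ((1 / 2 * besselC 0 ((t ^ 2 - (x - z) ^ 2) / 16) +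
          t / 8 * besselC 1 ((t ^ 2 - (x - z) ^ 2) / 16)) * ψ z) + t ^ 2 / 64 * E * P := by
      intro z hz
      have hw := mul_sub_nonneg_of_mem hz
      have h1 := besselC_nonneg 1 hw
      have h2 := besselC_nonneg 2 hw
      have h3 := sq_mul_besselC_two_le ht
        (abs_le.2 ⟨by linarith [hz.2], by linarith [hz.1]⟩ : |x - z| ≤ t)
      have hz0 := h.pos z
      rw [abs_mul, abs_of_pos hz0]
      have h4 : |-(1 / 8) * besselC 1 ((t ^ 2 - (x - z) ^ 2) / 16) +
          (x - z) ^ 2 / 64 * besselC 2 ((t ^ 2 - (x - z) ^ 2) / 16)| ≤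
          1 / r * (1 / 2 * besselC 0 ((t ^ 2 - (x - z) ^ 2) / 16) +
          t / 8 * besselC 1 ((t ^ 2 - (x - z) ^ 2) / 16)) + t ^ 2 / 64 * E := by
        have h5 : 1 / 8 * besselC 1 ((t ^ 2 - (x - z) ^ 2) / 16) ≤
            1 / r * (t / 8 * besselC 1 ((t ^ 2 - (x - z) ^ 2) / 16)) := by
          have : 1 ≤ 1 / r * t := by rw [one_div, inv_mul_eq_div, le_div_iff₀ (by linarith)]; linarith
          nlinarith
        have h6 : 0 ≤ (x - z) ^ 2 / 64 * besselC 2 ((t ^ 2 - (x - z) ^ 2) / 16) := by positivity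
        have h7 : 0 ≤ 1 / 8 * besselC 1 ((t ^ 2 - (x - z) ^ 2) / 16) := by positivity
        have h8 : 0 ≤ 1 / r * (1 / 2 * besselC 0 ((t ^ 2 - (x - z) ^ 2) / 16)) := by
          have := besselC_nonneg 0 hw
          positivity
        have h9 : 0 ≤ t ^ 2 / 64 * E := by positivity
        rw [abs_le]
        constructor
        · linarith
        · linarith
      calc _ ≤ (1 / r * (1 / 2 * besselC 0 ((t ^ 2 - (x - z) ^ 2) / 16) +
          t / 8 * besselC 1 ((t ^ 2 - (x - z) ^ 2) / 16)) + t ^ 2 / 64 * E) * ψ z := by gcongr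
        _ ≤ _ := by
          rw [add_mul, mul_assoc (1 / r)]
          have := hfar z hz
          gcongr
    have hc1 : Continuous fun z => (-(1 / 8) * besselC 1 ((t ^ 2 - (x - z) ^ 2) / 16) +
          (x - z) ^ 2 / 64 * besselC 2 ((t ^ 2 - (x - z) ^ 2) / 16)) * ψ z := by fun_prop
    have hc2 : Continuous fun z => 1 / r * ((1 / 2 * besselC 0 ((t ^ 2 - (x - z) ^ 2) / 16) +
          t / 8 * besselC 1 ((t ^ 2 - (x - z) ^ 2) / 16)) * ψ z) := by fun_prop
    have hxt : x - t ≤ x + t := by linarith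
    refine (intervalIntegral.abs_integral_le_integral_abs hxt).trans ?_
    refine (intervalIntegral.integral_mono_on hxt (hc1.abs.intervalIntegrable _ _)
      ((hc2.add continuous_const).intervalIntegrable _ _) hpt).trans ?_
    simp only [Pi.add_apply]
    rw [intervalIntegral.integral_add (hc2.intervalIntegrable _ _) intervalIntegrable_const,
      intervalIntegral.integral_const_mul, intervalIntegral.integral_const, smul_eq_mul]
    have h5 := integral_le_kgLin h.pos t x
    have h6 : 1 / r * (∫ z in (x - t)..(x + t), (1 / 2 * besselC 0 ((t ^ 2 - (x - z) ^ 2) / 16) +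
      t / 8 * besselC 1 ((t ^ 2 - (x - z) ^ 2) / 16)) * ψ z) ≤ 1 / r * (2 * V) := by
      gcongr
      linarith
    linarith
  -- the boundary part and the total
  have hd1 := (h.abs_deriv_le (x + t)).trans (mul_le_mul_of_nonneg_left hα (by linarith))
  have hd2 := (h.abs_deriv_le (x - t)).trans (mul_le_mul_of_nonneg_left hβ (by linarith))
  have hα0 := h.pos (x + t)
  have hβ0 := h.pos (x - t)
  have htot : |kgLinT ψ ψ' t x - 1 / 2 * V| ≤ 1 / r * V + (K + 1) * t ^ 3 * E * P := by
    rw [kgLinT_sub_half hψ]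
    have hb : |1 / 2 * (ψ' (x + t) - ψ' (x - t))| ≤ K * P := by
      rw [abs_le] at hd1 hd2 ⊢
      constructor <;> linarith [hd1.1, hd1.2, hd2.1, hd2.2]
    have hb2 : |t / 16 * (ψ (x + t) + ψ (x - t))| ≤ t / 8 * P := by
      rw [abs_of_nonneg (by positivity)]
      nlinarith
    have h1 := abs_add_three (1 / 2 * (ψ' (x + t) - ψ' (x - t)))
      (t / 16 * (ψ (x + t) + ψ (x - t))) (1 / 2 * ∫ z in (x - t)..(x + t),
        (-(1 / 8) * besselC 1 ((t ^ 2 - (x - z) ^ 2) / 16) +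
          (x - z) ^ 2 / 64 * besselC 2 ((t ^ 2 - (x - z) ^ 2) / 16)) * ψ z)
    rw [abs_mul (1 / 2) (∫ z in (x - t)..(x + t), _), abs_of_pos (by norm_num : (0 : ℝ) < 1 / 2)]
      at h1
    have ht3 : t ≤ t ^ 3 := by nlinarith [mul_pos ht0 ht0]
    have h2 : K * P ≤ K * t ^ 3 * E * P := by
      have : 1 ≤ t ^ 3 * E := by nlinarith
      have : K * 1 ≤ K * (t ^ 3 * E) := by gcongr
      nlinarith
    have h3 : t / 8 * P ≤ t ^ 3 / 8 * E * P := by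
      have : t / 8 * 1 ≤ t ^ 3 / 8 * E := by gcongr
      nlinarith
    have h4 : 0 ≤ t ^ 3 * E * P := by positivity
    nlinarith
  refine htot.trans ?_
  -- absorb the last term by the lower bound of `V`
  have hlow : c * ψ x * Real.exp (t / 2) ≤ r * V := h.le_kgLin (by linarith) x
  have hexp : t ^ m * E ≤ L₁ * Real.exp (t / 2) := by
    have h1 := pow_le_exp_sqrt m ht0.le
    have e : Real.exp (t / 2) = Real.exp (r / 4) * E := by
      rw [← Real.exp_add]; congr 1; ring
    rw [e, ← mul_assoc]
    gcongr
  have h3 : t ^ 3 * E * P ≤ K * L₁ / c * (V / r) := by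
    have e1 : t ^ 3 * E * P = K / t * (t ^ m * E) * ψ x := by
      simp only [P, m]
      field_simp
      ring
    rw [e1]
    calc K / t * (t ^ m * E) * ψ x ≤ K / t * (L₁ * Real.exp (t / 2)) * ψ x := by
          have := (h.pos x).le
          gcongr
      _ = K * L₁ / c / t * (c * ψ x * Real.exp (t / 2)) := by field_simp
      _ ≤ K * L₁ / c / t * (r * V) := by gcongr
      _ = _ := by rw [← hr2]; field_simp
  calc 1 / r * V + (K + 1) * t ^ 3 * E * P = 1 / r * V + (K + 1) * (t ^ 3 * E * P) := by ring
    _ ≤ 1 / r * V + (K + 1) * (K * L₁ / c * (V / r)) := by gcongr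
    _ = _ := by field_simp

end

/-! ### The d'Alembert inequality for supersolutions -/

lemma continuous_path_of_continuousOn {g : ℝ → ℝ → ℝ}
    (hg : ContinuousOn (Function.uncurry g) (Ici 0 ×ˢ univ)) {X : Type*} [TopologicalSpace X]
    {a b : X → ℝ} (ha : Continuous a) (hb : Continuous b) :
    Continuous fun s => g |a s| (b s) :=
  hg.comp_continuous (f := fun s => (|a s|, b s)) (by fun_prop)
    fun s => ⟨mem_Ici.2 (abs_nonneg (a s)), mem_univ _⟩

lemma continuousOn_path_of_continuousOn {g : ℝ → ℝ → ℝ}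
    (hg : ContinuousOn (Function.uncurry g) (Ici 0 ×ˢ univ)) {b : ℝ → ℝ} (hb : Continuous b)
    (t : ℝ) : ContinuousOn (fun s => g s (b s)) (Icc 0 t) :=
  (continuous_path_of_continuousOn hg continuous_id hb).continuousOn.congr fun s hs => by
    simp [abs_of_nonneg hs.1]

/-- D'Alembert's formula as an inequality: if `(∂ₜ - ∂ₓ)(w_t + w_x) ≥ g`, then `w` dominates the
solution of the wave equation with source `g` and the same data. Only derivatives along
characteristics are used. -/
lemma dAlembert_le {w wt wx g m : ℝ → ℝ → ℝ}
    (hw : ∀ x s, 0 ≤ s → HasDerivAt (fun s => w s (x + s)) (wt s (x + s) + wx s (x + s)) s)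
    (hm : ∀ x s, 0 ≤ s → HasDerivAt (fun s => wt s (x - s) + wx s (x - s)) (m s (x - s)) s)
    (h0 : ∀ x, HasDerivAt (w 0) (wx 0 x) x)
    (hgm : ∀ s x, 0 ≤ s → g s x ≤ m s x)
    (hwt : ContinuousOn (Function.uncurry wt) (Ici 0 ×ˢ univ))
    (hwx : ContinuousOn (Function.uncurry wx) (Ici 0 ×ˢ univ))
    (hg : ContinuousOn (Function.uncurry g) (Ici 0 ×ˢ univ)) {t : ℝ} (ht : 0 ≤ t) (x : ℝ) :
    1 / 2 * (w 0 (x + t) + w 0 (x - t)) + 1 / 2 * (∫ z in (x - t)..(x + t), wt 0 z) +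
      coneInt g t x ≤ w t x := by
  have hP : ContinuousOn (Function.uncurry fun s y => wt s y + wx s y) (Ici 0 ×ˢ univ) :=
    hwt.add hwx
  -- along the characteristics of speed `-1`
  have h1 : ∀ s y, 0 ≤ s → (wt 0 y + wx 0 y) + (∫ σ in (0 : ℝ)..s, g |σ| (y - σ)) ≤
      wt s (y - s) + wx s (y - s) := by
    intro s y hs
    have h := intervalIntegral.integral_le_sub_of_hasDeriv_right_of_le (a := 0) (b := s)
      (g := fun σ => wt σ (y - σ) + wx σ (y - σ)) (g' := fun σ => m σ (y - σ))
      (φ := fun σ => g |σ| (y - σ)) hs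
      (continuousOn_path_of_continuousOn hP (by fun_prop) s)
      (fun σ hσ => (hm y σ hσ.1.le).hasDerivWithinAt)
      ((continuous_path_of_continuousOn hg continuous_id (by fun_prop)).integrableOn_Icc)
      (fun σ hσ => by
        rw [abs_of_pos hσ.1]
        exact hgm σ _ hσ.1.le)
    simp only [sub_zero] at h
    linarith
  -- along the characteristics of speed `1`
  have hPc : ContinuousOn (fun s => wt s (x - t + s) + wx s (x - t + s)) (Icc 0 t) :=
    continuousOn_path_of_continuousOn hP (by fun_prop) t
  have h2 : ∫ s in (0 : ℝ)..t, (wt s (x - t + s) + wx s (x - t + s)) = w t x - w 0 (x - t) := by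
    rw [intervalIntegral.integral_eq_sub_of_hasDerivAt (f := fun s => w s (x - t + s))
      (fun s hs => hw _ s (by rw [uIcc_of_le ht] at hs; exact hs.1))
      (hPc.intervalIntegrable_of_Icc ht)]
    simp
  have hwt0 : Continuous (wt 0) := by
    have := continuous_path_of_continuousOn hwt (continuous_const (y := (0 : ℝ))) continuous_id
    simpa using this
  have hwx0 : Continuous (wx 0) := by
    have := continuous_path_of_continuousOn hwx (continuous_const (y := (0 : ℝ))) continuous_id
    simpa using this
  have hgc : Continuous fun s => ∫ σ in (0 : ℝ)..s, g |σ| (x - t + 2 * s - σ) :=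
    continuous_integral_moving (f := fun s σ => g |σ| (x - t + 2 * s - σ))
      (continuous_path_of_continuousOn hg (a := fun q : ℝ × ℝ => q.2)
        (b := fun q : ℝ × ℝ => x - t + 2 * q.1 - q.2) (by fun_prop) (by fun_prop))
      continuous_const continuous_id
  have hd0 : Continuous fun s => wt 0 (x - t + 2 * s) + wx 0 (x - t + 2 * s) := by fun_prop
  have h3 : ∫ s in (0 : ℝ)..t, ((wt 0 (x - t + 2 * s) + wx 0 (x - t + 2 * s)) +
      ∫ σ in (0 : ℝ)..s, g |σ| (x - t + 2 * s - σ)) ≤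
      ∫ s in (0 : ℝ)..t, (wt s (x - t + s) + wx s (x - t + s)) := by
    refine intervalIntegral.integral_mono_on ht ((hd0.add hgc).intervalIntegrable _ _)
      (hPc.intervalIntegrable_of_Icc ht) fun s hs => ?_
    have := h1 s (x - t + 2 * s) hs.1
    rwa [show x - t + 2 * s - s = x - t + s by ring] at this
  have h4 : ∫ s in (0 : ℝ)..t, (wt 0 (x - t + 2 * s) + wx 0 (x - t + 2 * s)) =
      1 / 2 * (∫ z in (x - t)..(x + t), wt 0 z) + 1 / 2 * (w 0 (x + t) - w 0 (x - t)) := by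
    have h := intervalIntegral.smul_integral_comp_add_mul (fun z => wt 0 z + wx 0 z) (a := 0)
      (b := t) 2 (x - t)
    rw [show x - t + 2 * 0 = x - t by ring, show x - t + 2 * t = x + t by ring, smul_eq_mul,
      intervalIntegral.integral_add (hwt0.intervalIntegrable _ _) (hwx0.intervalIntegrable _ _),
      intervalIntegral.integral_eq_sub_of_hasDerivAt (fun z _ => h0 z)
        (hwx0.intervalIntegrable _ _)] at h
    linarith
  -- the double integral is the cone integral
  have h5 : ∫ s in (0 : ℝ)..t, ∫ σ in (0 : ℝ)..s, g |σ| (x - t + 2 * s - σ) = coneInt g t x := by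
    have hgt : Continuous (Function.uncurry fun σ z => g |σ| z) :=
      continuous_path_of_continuousOn hg (a := fun q : ℝ × ℝ => q.1) (b := fun q : ℝ × ℝ => q.2)
        (by fun_prop) (by fun_prop)
    obtain ⟨M, hM⟩ := ((isCompact_Icc (a := (0 : ℝ)) (b := t)).prod
      (isCompact_Icc (a := x - t) (b := x + t))).exists_bound_of_continuousOn hgt.continuousOn
    rw [coneInt_eq_triangle (g := fun σ z => g |σ| z) hgt.measurable (M := M) ht
      fun σ z hσ0 hσt hz => hM (σ, z) ⟨⟨hσ0, hσt⟩, ⟨by linarith [hz.1], by linarith [hz.2]⟩⟩]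
    rw [coneInt, coneInt]
    congr 1
    refine intervalIntegral.integral_congr fun σ hσ => ?_
    rw [uIcc_of_le ht] at hσ
    simp only [abs_of_nonneg hσ.1]
  rw [intervalIntegral.integral_add (hd0.intervalIntegrable _ _) (hgc.intervalIntegrable _ _), h4,
    h5, h2] at h3
  linarith

/-! ### The nonlinear profile -/

/-- The solution at time `s` of `y' = -y ^ (q + 1) / q` with value `U` at `s = 0`; it interpolates
between `U` and the self-similar decay `s ^ (-1 / q)`. -/
def envelope (q s U : ℝ) : ℝ := (U ^ (-q) + s) ^ (-(1 / q))

/-- The ratio `(envelope q s U / U) ^ q`. -/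
def envelopeRatio (q s U : ℝ) : ℝ := U ^ (-q) * (U ^ (-q) + s)⁻¹

lemma envelope_base_pos (q : ℝ) {s U : ℝ} (hs : 0 ≤ s) (hU : 0 < U) : 0 < U ^ (-q) + s := by
  have := Real.rpow_pos_of_pos hU (-q)
  linarith

lemma envelope_pos (q : ℝ) {s U : ℝ} (hs : 0 ≤ s) (hU : 0 < U) : 0 < envelope q s U :=
  Real.rpow_pos_of_pos (envelope_base_pos q hs hU) _

lemma envelope_rpow {q : ℝ} (hq : 0 < q) {s U : ℝ} (hs : 0 ≤ s) (hU : 0 < U) :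
    envelope q s U ^ q = (U ^ (-q) + s)⁻¹ := by
  rw [envelope, ← Real.rpow_mul (envelope_base_pos q hs hU).le,
    show -(1 / q) * q = -1 by field_simp, Real.rpow_neg_one]

lemma envelope_eq (q : ℝ) {s U : ℝ} (hs : 0 ≤ s) (hU : 0 < U) :
    envelope q s U = (U ^ q / (s * U ^ q + 1)) ^ (1 / q) := by
  have hUq := Real.rpow_pos_of_pos hU q
  have hd : 0 < s * U ^ q + 1 := by positivity
  rw [envelope, Real.rpow_neg hU.le, Real.rpow_neg (by positivity), ← Real.inv_rpow (by positivity)]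
  congr 1
  field_simp
  ring

lemma envelope_mono {q : ℝ} (hq : 0 < q) {s U U' : ℝ} (hs : 0 ≤ s) (hU : 0 < U) (h : U ≤ U') :
    envelope q s U ≤ envelope q s U' := by
  refine Real.rpow_le_rpow_of_nonpos (envelope_base_pos q hs (hU.trans_le h)) ?_ ?_
  · have := Real.rpow_le_rpow_of_nonpos hU h (by linarith : -q ≤ 0)
    linarith
  · have : 0 < 1 / q := by positivity
    linarith

lemma envelopeRatio_pos (q : ℝ) {s U : ℝ} (hs : 0 ≤ s) (hU : 0 < U) : 0 < envelopeRatio q s U :=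
  mul_pos (Real.rpow_pos_of_pos hU _) (inv_pos.2 (envelope_base_pos q hs hU))

lemma one_sub_envelopeRatio (q : ℝ) {s U : ℝ} (hs : 0 ≤ s) (hU : 0 < U) :
    1 - envelopeRatio q s U = s * (U ^ (-q) + s)⁻¹ := by
  have := (envelope_base_pos q hs hU).ne'
  rw [envelopeRatio]
  field_simp
  ring

lemma hasDerivAt_envelope_base {q : ℝ} {T U : ℝ → ℝ} {s c U' : ℝ} (hT : HasDerivAt T c s)
    (hU : HasDerivAt U U' s) (hU0 : 0 < U s) :
    HasDerivAt (fun s => U s ^ (-q) + T s) (-q * U s ^ (-q) * (U' / U s) + c) s := by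
  refine ((hU.rpow_const (p := -q) (Or.inl hU0.ne')).add hT).congr_deriv ?_
  rw [Real.rpow_sub_one hU0.ne']
  field_simp

lemma hasDerivAt_envelope {q : ℝ} (hq : 0 < q) {T U : ℝ → ℝ} {s c U' : ℝ} (hT : HasDerivAt T c s)
    (hU : HasDerivAt U U' s) (hU0 : 0 < U s) (hT0 : 0 ≤ T s) :
    HasDerivAt (fun s => envelope q (T s) (U s)) (envelope q (T s) (U s) *
      (envelopeRatio q (T s) (U s) * (U' / U s) - c / q * (U s ^ (-q) + T s)⁻¹)) s := by
  have hZ := envelope_base_pos q hT0 hU0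
  refine ((hasDerivAt_envelope_base hT hU hU0).rpow_const (p := -(1 / q))
    (Or.inl hZ.ne')).congr_deriv ?_
  rw [Real.rpow_sub_one hZ.ne', envelope, envelopeRatio]
  field_simp
  ring

lemma hasDerivAt_envelope_inv {q : ℝ} {T U : ℝ → ℝ} {s c U' : ℝ} (hT : HasDerivAt T c s)
    (hU : HasDerivAt U U' s) (hU0 : 0 < U s) (hT0 : 0 ≤ T s) :
    HasDerivAt (fun s => (U s ^ (-q) + T s)⁻¹) ((U s ^ (-q) + T s)⁻¹ *
      (q * envelopeRatio q (T s) (U s) * (U' / U s) - c * (U s ^ (-q) + T s)⁻¹)) s := by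
  have hZ := envelope_base_pos q hT0 hU0
  refine ((hasDerivAt_envelope_base hT hU hU0).inv hZ.ne').congr_deriv ?_
  rw [envelopeRatio]
  field_simp
  ring

lemma hasDerivAt_envelopeRatio {q : ℝ} {T U : ℝ → ℝ} {s c U' : ℝ} (hT : HasDerivAt T c s)
    (hU : HasDerivAt U U' s) (hU0 : 0 < U s) (hT0 : 0 ≤ T s) :
    HasDerivAt (fun s => envelopeRatio q (T s) (U s)) (envelopeRatio q (T s) (U s) *
      (-q * (1 - envelopeRatio q (T s) (U s)) * (U' / U s) - c * (U s ^ (-q) + T s)⁻¹)) s := by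
  have h1 := hU.rpow_const (p := -q) (Or.inl hU0.ne')
  refine (h1.mul (hasDerivAt_envelope_inv hT hU hU0 hT0)).congr_deriv ?_
  rw [Real.rpow_sub_one hU0.ne']
  simp only [envelopeRatio]
  field_simp
  ring

section

/-! ### The supersolution -/

/-- The linear solution `ε (S(t) ψ + ∂ₜS(t) ψ)` of the damped wave equation. -/
def linU (ε : ℝ) (ψ : ℝ → ℝ) (t x : ℝ) : ℝ := ε * (Real.exp (-t / 2) * kgLin ψ t x)

/-- The time derivative of `linU`. -/
def linUT (ε : ℝ) (ψ ψ' : ℝ → ℝ) (t x : ℝ) : ℝ :=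
  ε * (Real.exp (-t / 2) * (kgLinT ψ ψ' t x - 1 / 2 * kgLin ψ t x))

/-- The space derivative of `linU`. -/
def linUX (ε : ℝ) (ψ ψ' : ℝ → ℝ) (t x : ℝ) : ℝ := ε * (Real.exp (-t / 2) * kgLinX ψ ψ' t x)

variable {ψ ψ' : ℝ → ℝ} {K : ℝ} {N : ℕ}

lemma hasDerivAt_exp_neg_half_line (t₀ c s : ℝ) :
    HasDerivAt (fun s => Real.exp (-(t₀ + c * s) / 2))
      (Real.exp (-(t₀ + c * s) / 2) * (-c / 2)) s :=
  ((hasDerivAt_affine t₀ c s).neg.div_const 2).exp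

lemma hasDerivAt_linU_line (hd : ∀ x, HasDerivAt ψ (ψ' x) x) (ε t₀ c x₀ d s : ℝ) :
    HasDerivAt (fun s => linU ε ψ (t₀ + c * s) (x₀ + d * s))
      (c * linUT ε ψ ψ' (t₀ + c * s) (x₀ + d * s) +
        d * linUX ε ψ ψ' (t₀ + c * s) (x₀ + d * s)) s := by
  refine (((hasDerivAt_exp_neg_half_line t₀ c s).mul
    (hasDerivAt_kgLin_line hd t₀ c x₀ d s)).const_mul ε).congr_deriv ?_
  simp only [linUT, linUX]
  ring

/-- The damped wave equation in characteristic form: `(∂ₜ - ∂ₓ)(U_t + U_x) = -U_t`. -/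
lemma hasDerivAt_linU_mixed (hd : ∀ x, HasDerivAt ψ (ψ' x) x) (ε t₀ x₀ s : ℝ) :
    HasDerivAt (fun s => linUT ε ψ ψ' (t₀ + 1 * s) (x₀ + -1 * s) +
        linUX ε ψ ψ' (t₀ + 1 * s) (x₀ + -1 * s))
      (-linUT ε ψ ψ' (t₀ + 1 * s) (x₀ + -1 * s)) s := by
  have hψ : Continuous ψ := continuous_iff_continuousAt.2 fun x => (hd x).continuousAt
  have h1 := (hasDerivAt_kgLin_mixed (ψ' := ψ') hψ t₀ x₀ s).sub
    ((hasDerivAt_kgLin_line hd t₀ 1 x₀ (-1) s).const_mul (1 / 2))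
  have h2 := ((hasDerivAt_exp_neg_half_line t₀ 1 s).mul h1).const_mul ε
  have e : (fun s => linUT ε ψ ψ' (t₀ + 1 * s) (x₀ + -1 * s) +
        linUX ε ψ ψ' (t₀ + 1 * s) (x₀ + -1 * s)) = fun s => ε *
      (Real.exp (-(t₀ + 1 * s) / 2) * (kgLinT ψ ψ' (t₀ + 1 * s) (x₀ + -1 * s) +
        kgLinX ψ ψ' (t₀ + 1 * s) (x₀ + -1 * s) -
          1 / 2 * kgLin ψ (t₀ + 1 * s) (x₀ + -1 * s))) := by
    funext s
    simp only [linUT, linUX]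
    ring
  rw [e]
  refine h2.congr_deriv ?_
  simp only [linUT, Pi.sub_apply]
  ring

lemma linU_pos {ε : ℝ} (hε : 0 < ε) (hψ : ∀ x, 0 < ψ x) {t : ℝ} (ht : 0 ≤ t) (x : ℝ) :
    0 < linU ε ψ t x :=
  mul_pos hε (mul_pos (Real.exp_pos _) (kgLin_pos hψ ht x))

lemma continuous_linU (hψ : Continuous ψ) (ε : ℝ) :
    Continuous fun z : ℝ × ℝ => linU ε ψ z.1 z.2 := by
  have := continuous_kgLin hψ
  unfold linU
  fun_prop

lemma continuous_linUT (hψ : Continuous ψ) (hψ' : Continuous ψ') (ε : ℝ) :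
    Continuous fun z : ℝ × ℝ => linUT ε ψ ψ' z.1 z.2 := by
  have := continuous_kgLin hψ
  have := continuous_kgLinT hψ hψ'
  unfold linUT
  fun_prop

lemma continuous_linUX (hψ : Continuous ψ) (hψ' : Continuous ψ') (ε : ℝ) :
    Continuous fun z : ℝ × ℝ => linUX ε ψ ψ' z.1 z.2 := by
  have := continuous_kgLinX hψ hψ'
  unfold linUX
  fun_prop

/-- `exp (t / 2)` times the supersolution `C envelope(t + T₀, U(t + T₀, x))`. -/
def superV (C q T₀ ε : ℝ) (ψ : ℝ → ℝ) (t x : ℝ) : ℝ :=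
  Real.exp (t / 2) * (C * envelope q (t + T₀) (linU ε ψ (t + T₀) x))

/-- The logarithmic time derivative of `superV`. -/
def superVLogT (q T₀ ε : ℝ) (ψ ψ' : ℝ → ℝ) (t x : ℝ) : ℝ :=
  1 / 2 + envelopeRatio q (t + T₀) (linU ε ψ (t + T₀) x) *
      (linUT ε ψ ψ' (t + T₀) x / linU ε ψ (t + T₀) x) -
    1 / q * (linU ε ψ (t + T₀) x ^ (-q) + (t + T₀))⁻¹

/-- The logarithmic space derivative of `superV`. -/
def superVLogX (q T₀ ε : ℝ) (ψ ψ' : ℝ → ℝ) (t x : ℝ) : ℝ :=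
  envelopeRatio q (t + T₀) (linU ε ψ (t + T₀) x) *
      (linUX ε ψ ψ' (t + T₀) x / linU ε ψ (t + T₀) x)

lemma hasDerivAt_superV_line {q ε T₀ : ℝ} (hq : 0 < q) (hε : 0 < ε) (h : SlowProfile ψ ψ' K N)
    (C t₀ c x₀ d s : ℝ) (hs : 0 ≤ t₀ + c * s + T₀) :
    HasDerivAt (fun s => superV C q T₀ ε ψ (t₀ + c * s) (x₀ + d * s))
      (superV C q T₀ ε ψ (t₀ + c * s) (x₀ + d * s) *
        (c * superVLogT q T₀ ε ψ ψ' (t₀ + c * s) (x₀ + d * s) +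
          d * superVLogX q T₀ ε ψ ψ' (t₀ + c * s) (x₀ + d * s))) s := by
  have e : ∀ s, t₀ + T₀ + c * s = t₀ + c * s + T₀ := fun s => by ring
  have hU := hasDerivAt_linU_line h.hasDerivAt ε (t₀ + T₀) c x₀ d s
  simp only [e] at hU
  have hT : HasDerivAt (fun s => t₀ + c * s + T₀) c s := (hasDerivAt_affine t₀ c s).add_const T₀
  have hE := hasDerivAt_envelope hq hT hU (linU_pos hε h.pos hs _) hs
  have h2 : HasDerivAt (fun s => Real.exp ((t₀ + c * s) / 2))
      (Real.exp ((t₀ + c * s) / 2) * (c / 2)) s := ((hasDerivAt_affine t₀ c s).div_const 2).exp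
  refine (h2.mul (hE.const_mul C)).congr_deriv ?_
  simp only [superV, superVLogT, superVLogX]
  ring

/-- `(∂ₜ - ∂ₓ)(w_t + w_x)` for the supersolution `w = superV`, where `ρ` is the envelope ratio,
`n = 1 / (U ^ (-q) + s)` and `ℓ`, `χ` are the logarithmic derivatives of the linear solution. -/
lemma hasDerivAt_superV_mixed {q ε T₀ : ℝ} (hq : 0 < q) (hε : 0 < ε) (h : SlowProfile ψ ψ' K N)
    (C x₀ s : ℝ) (hs : 0 ≤ s + T₀) :
    HasDerivAt (fun s => superV C q T₀ ε ψ s (x₀ - s) * superVLogT q T₀ ε ψ ψ' s (x₀ - s) +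
        superV C q T₀ ε ψ s (x₀ - s) * superVLogX q T₀ ε ψ ψ' s (x₀ - s))
      (let U := linU ε ψ (s + T₀) (x₀ - s)
       let n := (U ^ (-q) + (s + T₀))⁻¹
       let ρ := envelopeRatio q (s + T₀) U
       let ℓ := linUT ε ψ ψ' (s + T₀) (x₀ - s) / U
       let χ := linUX ε ψ ψ' (s + T₀) (x₀ - s) / U
       superV C q T₀ ε ψ s (x₀ - s) * (1 / 4 - n / q - (q + 1) * ρ * (1 - ρ) * (ℓ ^ 2 - χ ^ 2) -
        2 * ρ * n * (1 + 1 / q) * ℓ + n ^ 2 * (1 / q ^ 2 + 1 / q))) s := by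
  have hW := hasDerivAt_superV_line (q := q) hq hε h C 0 1 x₀ (-1) s (by simpa using hs)
  have hU := hasDerivAt_linU_line h.hasDerivAt ε T₀ 1 x₀ (-1) s
  have hP := hasDerivAt_linU_mixed h.hasDerivAt ε T₀ x₀ s
  have hT : HasDerivAt (fun s => s + T₀) 1 s := (hasDerivAt_id s).add_const T₀
  simp only [one_mul, zero_add, neg_mul, ← sub_eq_add_neg, add_comm T₀] at hW hU hP
  have hU0 := linU_pos hε h.pos hs (x₀ - s)
  have hR := hasDerivAt_envelopeRatio (q := q) hT hU hU0 hs
  have hN := hasDerivAt_envelope_inv (q := q) hT hU hU0 hs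
  have hL := hP.div hU hU0.ne'
  have hG := hW.mul (((hR.mul hL).const_add (1 / 2)).sub (hN.const_mul (1 / q)))
  have e : (fun s => superV C q T₀ ε ψ s (x₀ - s) * superVLogT q T₀ ε ψ ψ' s (x₀ - s) +
        superV C q T₀ ε ψ s (x₀ - s) * superVLogX q T₀ ε ψ ψ' s (x₀ - s)) =
      fun s => superV C q T₀ ε ψ s (x₀ - s) *
        (1 / 2 + envelopeRatio q (s + T₀) (linU ε ψ (s + T₀) (x₀ - s)) *
          ((linUT ε ψ ψ' (s + T₀) (x₀ - s) + linUX ε ψ ψ' (s + T₀) (x₀ - s)) /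
            linU ε ψ (s + T₀) (x₀ - s)) -
          1 / q * (linU ε ψ (s + T₀) (x₀ - s) ^ (-q) + (s + T₀))⁻¹) := by
    funext s
    simp only [superVLogT, superVLogX]
    ring
  rw [e]
  refine hG.congr_deriv ?_
  simp only [superVLogT, superVLogX, Pi.mul_apply, Pi.div_apply, Pi.sub_apply]
  set U := linU ε ψ (s + T₀) (x₀ - s)
  set n := (U ^ (-q) + (s + T₀))⁻¹
  set ρ := envelopeRatio q (s + T₀) U
  set Ut := linUT ε ψ ψ' (s + T₀) (x₀ - s)
  set Ux := linUX ε ψ ψ' (s + T₀) (x₀ - s)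
  set W := superV C q T₀ ε ψ s (x₀ - s)
  field_simp
  ring

/-- The supersolution inequality `(∂ₜ - ∂ₓ)(w_t + w_x) ≥ w / 4 - exp (t / 2) (exp (-t / 2) w) ^ p`,
with `w = superV` and `p = q + 1`: the good term `C ^ q n` dominates because the logarithmic time
derivative `ℓ` of the linear solution satisfies `ℓ² ≤ L² / s`; the space derivative `χ` enters with
a favourable sign. -/
lemma superV_source_le {C q n s L ρ ℓ χ w : ℝ} (hq : 0 < q) (hs : 1 ≤ s) (hn : 0 ≤ n)
    (hρ : 0 ≤ ρ) (hρn : 1 - ρ = s * n) (hL : 0 ≤ L) (hℓ : |ℓ| ≤ L / Real.sqrt s) (hw : 0 ≤ w)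
    (hC : 1 / q + (q + 1) * L ^ 2 + 2 * (1 + 1 / q) * L ≤ C ^ q) :
    w * (1 / 4 - C ^ q * n) ≤ w * (1 / 4 - n / q - (q + 1) * ρ * (1 - ρ) * (ℓ ^ 2 - χ ^ 2) -
        2 * ρ * n * (1 + 1 / q) * ℓ + n ^ 2 * (1 / q ^ 2 + 1 / q)) := by
  have hs0 : 0 < s := by linarith
  have hr : 1 ≤ Real.sqrt s := Real.one_le_sqrt.2 hs
  have hr2 : Real.sqrt s ^ 2 = s := Real.sq_sqrt hs0.le
  have hρ1 : ρ ≤ 1 := by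
    have : 0 ≤ s * n := by positivity
    linarith
  have hℓ2 : s * ℓ ^ 2 ≤ L ^ 2 := by
    rw [le_div_iff₀ (by linarith)] at hℓ
    calc s * ℓ ^ 2 = (|ℓ| * Real.sqrt s) ^ 2 := by rw [mul_pow, sq_abs, hr2]; ring
      _ ≤ L ^ 2 := by gcongr
  have hℓ1 : ℓ ≤ L := (le_abs_self ℓ).trans (hℓ.trans (div_le_self hL hr))
  refine mul_le_mul_of_nonneg_left ?_ hw
  have h1 : (q + 1) * ρ * (1 - ρ) * (ℓ ^ 2 - χ ^ 2) ≤ n * ((q + 1) * L ^ 2) := by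
    rw [hρn]
    have h2 : ρ * (s * ℓ ^ 2) ≤ 1 * L ^ 2 := by gcongr
    have h3 : 0 ≤ (q + 1) * ρ * (s * n) * χ ^ 2 := by positivity
    have h4 : n * (q + 1) * (ρ * (s * ℓ ^ 2)) ≤ n * (q + 1) * (1 * L ^ 2) := by gcongr
    nlinarith
  have h2 : 2 * ρ * n * (1 + 1 / q) * ℓ ≤ n * (2 * (1 + 1 / q) * L) := by
    have h3 : ρ * ℓ ≤ 1 * L := by
      calc ρ * ℓ ≤ ρ * L := by gcongr
        _ ≤ 1 * L := by gcongr
    have h4 : n * (2 * (1 + 1 / q)) * (ρ * ℓ) ≤ n * (2 * (1 + 1 / q)) * (1 * L) := by gcongr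
    linarith
  have h3 : 0 ≤ n ^ 2 * (1 / q ^ 2 + 1 / q) := by positivity
  have h4 := mul_le_mul_of_nonneg_left hC hn
  rw [mul_add, mul_add] at h4
  have h5 : n / q = n * (1 / q) := by ring
  linarith

lemma continuousOn_superV {q ε T₀ : ℝ} (hε : 0 < ε) (hT₀ : 0 < T₀)
    (h : SlowProfile ψ ψ' K N) (C : ℝ) :
    ContinuousOn (Function.uncurry (superV C q T₀ ε ψ)) (Ici 0 ×ˢ univ) ∧
    ContinuousOn (Function.uncurry (superVLogT q T₀ ε ψ ψ')) (Ici 0 ×ˢ univ) ∧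
    ContinuousOn (Function.uncurry (superVLogX q T₀ ε ψ ψ')) (Ici 0 ×ˢ univ) ∧
    ContinuousOn (fun z : ℝ × ℝ => (linU ε ψ (z.1 + T₀) z.2 ^ (-q) + (z.1 + T₀))⁻¹)
      (Ici 0 ×ˢ univ) := by
  have hshift : Continuous fun z : ℝ × ℝ => (z.1 + T₀, z.2) := by fun_prop
  have cU : ContinuousOn (fun z : ℝ × ℝ => linU ε ψ (z.1 + T₀) z.2) (Ici 0 ×ˢ univ) :=
    ((continuous_linU h.continuous ε).comp hshift).continuousOn
  have cT : ContinuousOn (fun z : ℝ × ℝ => linUT ε ψ ψ' (z.1 + T₀) z.2) (Ici 0 ×ˢ univ) :=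
    ((continuous_linUT h.continuous h.continuous_deriv ε).comp hshift).continuousOn
  have cX : ContinuousOn (fun z : ℝ × ℝ => linUX ε ψ ψ' (z.1 + T₀) z.2) (Ici 0 ×ˢ univ) :=
    ((continuous_linUX h.continuous h.continuous_deriv ε).comp hshift).continuousOn
  have c1 : ContinuousOn (fun z : ℝ × ℝ => z.1 + T₀) (Ici 0 ×ˢ univ) := by fun_prop
  have ht : ∀ z ∈ (Ici (0 : ℝ) ×ˢ (univ : Set ℝ)), 0 ≤ z.1 + T₀ := fun z hz => by
    have : 0 ≤ z.1 := hz.1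
    linarith
  have hU0 : ∀ z ∈ (Ici (0 : ℝ) ×ˢ (univ : Set ℝ)), 0 < linU ε ψ (z.1 + T₀) z.2 := fun z hz =>
    linU_pos hε h.pos (ht z hz) _
  have cUq : ContinuousOn (fun z : ℝ × ℝ => linU ε ψ (z.1 + T₀) z.2 ^ (-q)) (Ici 0 ×ˢ univ) :=
    cU.rpow_const fun z hz => Or.inl (hU0 z hz).ne'
  have hZ : ∀ z ∈ (Ici (0 : ℝ) ×ˢ (univ : Set ℝ)),
      linU ε ψ (z.1 + T₀) z.2 ^ (-q) + (z.1 + T₀) ≠ 0 := fun z hz =>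
    (envelope_base_pos q (ht z hz) (hU0 z hz)).ne'
  have cN : ContinuousOn (fun z : ℝ × ℝ => (linU ε ψ (z.1 + T₀) z.2 ^ (-q) + (z.1 + T₀))⁻¹)
      (Ici 0 ×ˢ univ) := (cUq.add c1).inv₀ hZ
  have cR : ContinuousOn (fun z : ℝ × ℝ => envelopeRatio q (z.1 + T₀) (linU ε ψ (z.1 + T₀) z.2))
      (Ici 0 ×ˢ univ) := cUq.mul cN
  have cE : ContinuousOn (fun z : ℝ × ℝ => envelope q (z.1 + T₀) (linU ε ψ (z.1 + T₀) z.2))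
      (Ici 0 ×ˢ univ) := (cUq.add c1).rpow_const fun z hz => Or.inl (hZ z hz)
  refine ⟨?_, ?_, ?_, cN⟩
  · exact ContinuousOn.mul (by fun_prop) (cE.const_mul C)
  · exact (continuousOn_const.add (cR.mul (cT.div cU fun z hz => (hU0 z hz).ne'))).sub
      (cN.const_mul (1 / q))
  · exact cR.mul (cX.div cU fun z hz => (hU0 z hz).ne')

/-- The source term `v / 4 - exp (t / 2) (exp (-t / 2) v) ^ p` of the equation for
`v = exp (t / 2) u`, when `u` solves the nonlinear damped wave equation. -/
def source (p : ℝ) (v : ℝ → ℝ → ℝ) (t x : ℝ) : ℝ :=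
  1 / 4 * v t x - Real.exp (t / 2) * (Real.exp (-t / 2) * v t x) ^ p

/-- The integral form of the supersolution property. -/
lemma superV_ge {C q ε T₀ L : ℝ} (hq : 0 < q) (hε : 0 < ε) (hT₀ : 4 ≤ T₀) (hC0 : 0 < C)
    (h : SlowProfile ψ ψ' K N) (hL0 : 0 ≤ L)
    (hL : ∀ t x, 4 ≤ t → |kgLinT ψ ψ' t x - 1 / 2 * kgLin ψ t x| ≤ L / Real.sqrt t * kgLin ψ t x)
    (hC : 1 / q + (q + 1) * L ^ 2 + 2 * (1 + 1 / q) * L ≤ C ^ q) {t : ℝ} (ht : 0 ≤ t) (x : ℝ) :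
    1 / 2 * (superV C q T₀ ε ψ 0 (x + t) + superV C q T₀ ε ψ 0 (x - t)) +
      1 / 2 * (∫ z in (x - t)..(x + t), superV C q T₀ ε ψ 0 z * superVLogT q T₀ ε ψ ψ' 0 z) +
      coneInt (source (q + 1) (superV C q T₀ ε ψ)) t x ≤ superV C q T₀ ε ψ t x := by
  obtain ⟨cV, cT, cX, cN⟩ := continuousOn_superV (q := q) hε (by linarith : 0 < T₀) h C
  refine dAlembert_le (wt := fun t x => superV C q T₀ ε ψ t x * superVLogT q T₀ ε ψ ψ' t x)
    (wx := fun t x => superV C q T₀ ε ψ t x * superVLogX q T₀ ε ψ ψ' t x)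
    (m := fun s x => superV C q T₀ ε ψ s x * (1 / 4 -
      (linU ε ψ (s + T₀) x ^ (-q) + (s + T₀))⁻¹ / q -
      (q + 1) * envelopeRatio q (s + T₀) (linU ε ψ (s + T₀) x) *
        (1 - envelopeRatio q (s + T₀) (linU ε ψ (s + T₀) x)) *
        ((linUT ε ψ ψ' (s + T₀) x / linU ε ψ (s + T₀) x) ^ 2 -
          (linUX ε ψ ψ' (s + T₀) x / linU ε ψ (s + T₀) x) ^ 2) -
      2 * envelopeRatio q (s + T₀) (linU ε ψ (s + T₀) x) *
        (linU ε ψ (s + T₀) x ^ (-q) + (s + T₀))⁻¹ * (1 + 1 / q) *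
          (linUT ε ψ ψ' (s + T₀) x / linU ε ψ (s + T₀) x) +
      ((linU ε ψ (s + T₀) x ^ (-q) + (s + T₀))⁻¹) ^ 2 * (1 / q ^ 2 + 1 / q)))
    ?_ ?_ ?_ ?_ (cV.mul cT) (cV.mul cX) ?_ ht x
  · intro x s hs
    have := hasDerivAt_superV_line hq hε h C 0 1 x 1 s (T₀ := T₀) (by linarith)
    simp only [one_mul, zero_add] at this
    exact this.congr_deriv (by ring)
  · intro x s hs
    exact hasDerivAt_superV_mixed hq hε h C x s (by linarith)
  · intro x
    have := hasDerivAt_superV_line hq hε h C 0 0 0 1 x (T₀ := T₀) (by linarith)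
    simp only [one_mul, zero_add, zero_mul] at this
    exact this
  · intro s x hs
    have hs' : 0 ≤ s + T₀ := by linarith
    have hU := linU_pos hε h.pos hs' x
    have hE := envelope_pos q hs' hU
    have hsrc : source (q + 1) (superV C q T₀ ε ψ) s x = superV C q T₀ ε ψ s x *
        (1 / 4 - C ^ q * (linU ε ψ (s + T₀) x ^ (-q) + (s + T₀))⁻¹) := by
      rw [source, superV, ← mul_assoc (Real.exp (-s / 2)), ← Real.exp_add,
        show -s / 2 + s / 2 = 0 by ring, Real.exp_zero, one_mul, Real.rpow_add_one (by positivity),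
        Real.mul_rpow hC0.le hE.le, envelope_rpow hq hs' hU]
      ring
    rw [hsrc]
    refine superV_source_le (s := s + T₀) hq (by linarith)
      (inv_pos.2 (envelope_base_pos q hs' hU)).le (envelopeRatio_pos q hs' hU).le
      (one_sub_envelopeRatio q hs' hU) hL0 ?_ ?_ hC
    · have hV := kgLin_pos h.pos hs' x
      rw [linUT, linU, mul_div_mul_left _ _ hε.ne', mul_div_mul_left _ _ (Real.exp_pos _).ne',
        abs_div, abs_of_pos hV, div_le_iff₀ hV]
      exact hL _ _ (by linarith)
    · rw [superV]
      positivity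
  · have h1 : ContinuousOn (fun z : ℝ × ℝ => Real.exp (z.1 / 2) *
        (Real.exp (-z.1 / 2) * superV C q T₀ ε ψ z.1 z.2) ^ (q + 1)) (Ici 0 ×ˢ univ) := by
      refine ContinuousOn.mul (by fun_prop) (ContinuousOn.rpow_const
        (ContinuousOn.mul (by fun_prop) cV) fun z _ => Or.inr (by linarith))
    exact (cV.const_mul (1 / 4)).sub h1

end

section

/-! ### Cone integrals of measurable functions bounded on strips -/

/-- Joint measurability together with boundedness on every strip `[0, T] × ℝ`. -/
structure StripBounded (g : ℝ → ℝ → ℝ) : Prop where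
  measurable : Measurable (Function.uncurry g)
  bounded : ∀ T, ∃ M, ∀ τ z, 0 ≤ τ → τ ≤ T → |g τ z| ≤ M

namespace StripBounded

variable {g h : ℝ → ℝ → ℝ}

lemma linear_comb (hg : StripBounded g) (hh : StripBounded h) (a b : ℝ) :
    StripBounded fun τ z => a * g τ z + b * h τ z := by
  refine ⟨(hg.measurable.const_mul a).add (hh.measurable.const_mul b), fun T => ?_⟩
  obtain ⟨M, hM⟩ := hg.bounded T
  obtain ⟨M', hM'⟩ := hh.bounded T
  refine ⟨|a| * M + |b| * M', fun τ z h0 hT => ?_⟩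
  refine (abs_add_le _ _).trans ?_
  rw [abs_mul, abs_mul]
  have := hM τ z h0 hT
  have := hM' τ z h0 hT
  gcongr

lemma measurable_right (hg : StripBounded g) (τ : ℝ) : Measurable (g τ) :=
  hg.measurable.comp (f := fun z => (τ, z)) (by fun_prop)

lemma intervalIntegrable_inner (hg : StripBounded g) {τ : ℝ} (hτ : 0 ≤ τ) (a b : ℝ) :
    IntervalIntegrable (g τ) volume a b := by
  obtain ⟨M, hM⟩ := hg.bounded τ
  exact intervalIntegrable_of_bounded (hg.measurable_right τ).aestronglyMeasurable
    fun z _ => hM τ z hτ le_rfl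

lemma intervalIntegrable_outer (hg : StripBounded g) {t : ℝ} (ht : 0 ≤ t) (x : ℝ) :
    IntervalIntegrable (fun σ => ∫ z in (x - (t - σ))..(x + (t - σ)), g σ z) volume 0 t := by
  obtain ⟨M, hM⟩ := hg.bounded t
  have hM0 : 0 ≤ M := (abs_nonneg _).trans (hM 0 0 le_rfl ht)
  refine intervalIntegrable_of_bounded (M := M * (2 * t))
    (measurable_integral_moving hg.measurable (by fun_prop) (by fun_prop)).aestronglyMeasurable
    fun σ hσ => ?_
  rw [uIoc_of_le ht] at hσ
  refine (abs_integral_le_of_abs_le (by linarith [hσ.2]) fun z _ => hM σ z hσ.1.le hσ.2).trans ?_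
  gcongr
  linarith [hσ.1]

lemma coneInt_linear_comb (hg : StripBounded g) (hh : StripBounded h) (a b : ℝ) {t : ℝ}
    (ht : 0 ≤ t) (x : ℝ) : coneInt (fun τ z => a * g τ z + b * h τ z) t x =
      a * coneInt g t x + b * coneInt h t x := by
  have e : ∀ σ ∈ uIcc 0 t, ∫ z in (x - (t - σ))..(x + (t - σ)), (a * g σ z + b * h σ z) =
      a * (∫ z in (x - (t - σ))..(x + (t - σ)), g σ z) +
        b * ∫ z in (x - (t - σ))..(x + (t - σ)), h σ z := by
    intro σ hσ
    rw [uIcc_of_le ht] at hσ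
    rw [intervalIntegral.integral_add ((hg.intervalIntegrable_inner hσ.1 _ _).const_mul a)
      ((hh.intervalIntegrable_inner hσ.1 _ _).const_mul b), intervalIntegral.integral_const_mul,
      intervalIntegral.integral_const_mul]
  rw [coneInt, intervalIntegral.integral_congr e,
    intervalIntegral.integral_add ((hg.intervalIntegrable_outer ht x).const_mul a)
      ((hh.intervalIntegrable_outer ht x).const_mul b), intervalIntegral.integral_const_mul,
      intervalIntegral.integral_const_mul, coneInt, coneInt]
  ring

lemma coneInt_mono (hg : StripBounded g) (hh : StripBounded h)
    (hgh : ∀ᵐ τ : ℝ, 0 ≤ τ → ∀ᵐ z : ℝ, g τ z ≤ h τ z) {t : ℝ} (ht : 0 ≤ t) (x : ℝ) :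
    coneInt g t x ≤ coneInt h t x := by
  refine mul_le_mul_of_nonneg_left ?_ (by norm_num)
  refine intervalIntegral.integral_mono_ae_restrict ht (hg.intervalIntegrable_outer ht x)
    (hh.intervalIntegrable_outer ht x) ?_
  filter_upwards [ae_restrict_of_ae hgh, ae_restrict_mem measurableSet_Icc] with τ hτ hτ'
  exact intervalIntegral.integral_mono_ae (by linarith [hτ'.2])
    (hg.intervalIntegrable_inner hτ'.1 _ _) (hh.intervalIntegrable_inner hτ'.1 _ _) (hτ hτ'.1)

lemma coneInt_congr (hg : StripBounded g) (hh : StripBounded h)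
    (hgh : ∀ᵐ τ : ℝ, 0 ≤ τ → ∀ᵐ z : ℝ, g τ z = h τ z) {t : ℝ} (ht : 0 ≤ t) (x : ℝ) :
    coneInt g t x = coneInt h t x := by
  refine le_antisymm (hg.coneInt_mono hh ?_ ht x) (hh.coneInt_mono hg ?_ ht x)
  · filter_upwards [hgh] with τ hτ h0
    filter_upwards [hτ h0] with z hz using hz.le
  · filter_upwards [hgh] with τ hτ h0
    filter_upwards [hτ h0] with z hz using hz.ge

end StripBounded

/-! ### Comparison -/

lemma coneInt_exp_le {M t : ℝ} (hM : 0 ≤ M) (ht : 0 ≤ t) (x : ℝ) :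
    coneInt (fun τ _ => M * Real.exp (3 * τ)) t x ≤ M / 2 * Real.exp (3 * t) := by
  have h1 : ∀ σ ∈ Icc 0 t, ∫ _z in (x - (t - σ))..(x + (t - σ)), M * Real.exp (3 * σ) ≤
      2 * M * Real.exp t * Real.exp (2 * σ) := by
    intro σ hσ
    rw [intervalIntegral.integral_const, smul_eq_mul]
    have h2 : t - σ ≤ Real.exp (t - σ) := by linarith [Real.add_one_le_exp (t - σ)]
    have e : Real.exp t * Real.exp (2 * σ) = Real.exp (t - σ) * Real.exp (3 * σ) := by
      rw [← Real.exp_add, ← Real.exp_add]; congr 1; ring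
    calc (x + (t - σ) - (x - (t - σ))) * (M * Real.exp (3 * σ)) =
        2 * M * ((t - σ) * Real.exp (3 * σ)) := by ring
      _ ≤ 2 * M * (Real.exp (t - σ) * Real.exp (3 * σ)) := by gcongr
      _ = _ := by rw [← e]; ring
  have h2 : ∫ σ in (0 : ℝ)..t, 2 * M * Real.exp t * Real.exp (2 * σ) ≤ M * Real.exp (3 * t) := by
    rw [intervalIntegral.integral_const_mul,
      intervalIntegral.integral_comp_mul_left (fun σ => Real.exp σ) two_ne_zero, integral_exp,
      smul_eq_mul]
    have e : Real.exp (3 * t) = Real.exp t * Real.exp (2 * t) := by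
      rw [← Real.exp_add]; congr 1; ring
    rw [e, mul_zero, Real.exp_zero]
    have := mul_nonneg hM (Real.exp_pos t).le
    nlinarith
  have h3 : ∫ σ in (0 : ℝ)..t, ∫ _z in (x - (t - σ))..(x + (t - σ)), M * Real.exp (3 * σ) ≤
      ∫ σ in (0 : ℝ)..t, 2 * M * Real.exp t * Real.exp (2 * σ) := by
    refine intervalIntegral.integral_mono_on ht ?_
      ((by fun_prop : Continuous _).intervalIntegrable _ _) h1
    exact (continuous_integral_moving (f := fun σ _ => M * Real.exp (3 * σ)) (by fun_prop)
      (by fun_prop) (by fun_prop)).intervalIntegrable _ _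
  rw [coneInt]
  linarith

/-- The tangent line inequality for `x ^ p`. -/
lemma rpow_sub_rpow_le {p a b : ℝ} (hp : 1 < p) (ha : 0 ≤ a) (hab : a ≤ b) :
    b ^ p - a ^ p ≤ p * b ^ (p - 1) * (b - a) := by
  rcases (ha.trans hab).eq_or_lt with rfl | hb
  · have : a = 0 := le_antisymm hab ha
    simp [this]
  have h1 := one_add_mul_self_le_rpow_one_add (s := a / b - 1) (p := p)
    (by have := div_nonneg ha hb.le; linarith) hp.le
  rw [add_sub_cancel, Real.div_rpow ha hb.le, le_div_iff₀ (Real.rpow_pos_of_pos hb p)] at h1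
  have e : b ^ p = b ^ (p - 1) * b := by
    rw [← Real.rpow_add_one hb.ne']; congr 1; ring
  have e2 : (1 + p * (a / b - 1)) * b ^ p = b ^ p - p * b ^ (p - 1) * (b - a) := by
    rw [e]; field_simp; ring
  linarith

/-- The source term `v / 4 - exp (t / 2) u ^ p`, `u = exp (-t / 2) v`, is increasing in `u` as long
as `p u ^ (p - 1) ≤ 1 / 4`, and its slope is at most `1 / 4`. Smallness is needed for the larger
of the two functions only where this is `w`. -/
lemma source_sub_le {p : ℝ} (hp : 1 < p) {v w : ℝ → ℝ → ℝ} {t x : ℝ} (hv : 0 ≤ v t x)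
    (hw : 0 ≤ w t x) (hsmall : p * (Real.exp (-t / 2) * w t x) ^ (p - 1) ≤ 1 / 4) :
    source p v t x ≤ source p w t x + 1 / 4 * max (v t x - w t x) 0 := by
  have hE := Real.exp_pos (-t / 2)
  have hE' := Real.exp_pos (t / 2)
  rw [source, source]
  rcases le_total (w t x) (v t x) with h | h
  · rw [max_eq_left (by linarith)]
    have : Real.exp (t / 2) * (Real.exp (-t / 2) * w t x) ^ p ≤
        Real.exp (t / 2) * (Real.exp (-t / 2) * v t x) ^ p := by
      refine mul_le_mul_of_nonneg_left (Real.rpow_le_rpow (by positivity) ?_ (by linarith)) hE'.le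
      gcongr
    linarith
  · rw [max_eq_right (by linarith)]
    have h1 := rpow_sub_rpow_le hp (mul_nonneg hE.le hv) (mul_le_mul_of_nonneg_left h hE.le)
    have h2 : p * (Real.exp (-t / 2) * w t x) ^ (p - 1) *
        (Real.exp (-t / 2) * w t x - Real.exp (-t / 2) * v t x) ≤
        1 / 4 * (Real.exp (-t / 2) * w t x - Real.exp (-t / 2) * v t x) := by
      refine mul_le_mul_of_nonneg_right hsmall ?_
      have := mul_le_mul_of_nonneg_left h hE.le
      linarith
    have h3 := mul_le_mul_of_nonneg_left (h1.trans h2) hE'.le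
    have e : Real.exp (t / 2) * Real.exp (-t / 2) = 1 := by
      rw [← Real.exp_add, show t / 2 + -t / 2 = 0 by ring, Real.exp_zero]
    have e2 : Real.exp (t / 2) * (1 / 4 * (Real.exp (-t / 2) * w t x - Real.exp (-t / 2) * v t x)) =
        Real.exp (t / 2) * Real.exp (-t / 2) * (1 / 4 * (w t x - v t x)) := by ring
    rw [e2, e, one_mul, mul_sub] at h3
    linarith

lemma StripBounded.source {p : ℝ} (hp : 1 < p) {v : ℝ → ℝ → ℝ} (hv : StripBounded v)
    (h0 : ∀ t x, 0 ≤ t → 0 ≤ v t x) : StripBounded (source p v) := by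
  refine ⟨?_, fun T => ?_⟩
  · have := hv.measurable
    refine (hv.measurable.const_mul (1 / 4)).sub (Measurable.mul (by fun_prop) ?_)
    exact (Measurable.mul (by fun_prop) hv.measurable).pow_const p
  · obtain ⟨M, hM⟩ := hv.bounded T
    refine ⟨1 / 4 * M + Real.exp (T / 2) * M ^ p, fun τ z h1 h2 => ?_⟩
    have h3 := h0 τ z h1
    have h4 := hM τ z h1 h2
    rw [abs_of_nonneg h3] at h4
    have h5 : Real.exp (-τ / 2) ≤ 1 := Real.exp_le_one_iff.2 (by linarith)
    have h6 : Real.exp (-τ / 2) * v τ z ≤ M := by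
      have := Real.exp_pos (-τ / 2)
      nlinarith
    have h7 : Real.exp (τ / 2) * (Real.exp (-τ / 2) * v τ z) ^ p ≤ Real.exp (T / 2) * M ^ p := by
      have := Real.exp_pos (-τ / 2)
      gcongr
    have h8 : 0 ≤ Real.exp (τ / 2) * (Real.exp (-τ / 2) * v τ z) ^ p := by positivity
    rw [DampedWave.source, abs_le]
    constructor <;> linarith

/-- Comparison for the integral equation of the wave operator: the positive part `r` of `v - w`
satisfies `r ≤ coneInt r / 4`, which contracts the weighted norm with weight `exp (3 t)`. -/
lemma coneInt_source_le {p M : ℝ} (hp : 1 < p) {v w hv hw : ℝ → ℝ → ℝ} (sv : StripBounded v)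
    (sw : StripBounded w) (hv0 : ∀ t x, 0 ≤ t → 0 ≤ v t x) (hw0 : ∀ t x, 0 ≤ t → 0 ≤ w t x)
    (hM : 0 ≤ M) (hvM : ∀ t x, 0 ≤ t → v t x ≤ M * Real.exp (3 * t))
    (hsmall : ∀ t x, 0 ≤ t → p * (Real.exp (-t / 2) * w t x) ^ (p - 1) ≤ 1 / 4)
    (hveq : ∀ᵐ t : ℝ, 0 ≤ t → ∀ᵐ x : ℝ, v t x ≤ hv t x + coneInt (source p v) t x)
    (hwle : ∀ t x, 0 ≤ t → hw t x + coneInt (source p w) t x ≤ w t x)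
    (hvw : ∀ t x, 0 ≤ t → hv t x ≤ hw t x) {t : ℝ} (ht : 0 ≤ t) (x : ℝ) :
    coneInt (source p v) t x ≤ coneInt (source p w) t x := by
  set r : ℝ → ℝ → ℝ := fun t x => max (v t x - w t x) 0
  have sr : StripBounded r := by
    refine ⟨(sv.measurable.sub sw.measurable).max measurable_const, fun T => ?_⟩
    obtain ⟨M', hM'⟩ := sv.bounded T
    refine ⟨M', fun τ z h1 h2 => ?_⟩
    have h3 := hM' τ z h1 h2
    rw [abs_of_nonneg (le_max_right _ _)]
    refine max_le ?_ ((abs_nonneg _).trans h3)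
    have := hw0 τ z h1
    linarith [le_abs_self (v τ z)]
  have ssv := sv.source hp hv0
  have ssw := sw.source hp hw0
  have hS : ∀ t x, 0 ≤ t →
      coneInt (source p v) t x ≤ coneInt (source p w) t x + 1 / 4 * coneInt r t x := by
    intro t x ht
    have h := ssv.coneInt_mono (ssw.linear_comb sr 1 (1 / 4)) (ae_of_all _ fun τ hτ =>
      ae_of_all _ fun z => by
        have := source_sub_le hp (hv0 τ z hτ) (hw0 τ z hτ) (hsmall τ z hτ)
        rw [one_mul]
        exact this) ht x
    rwa [ssw.coneInt_linear_comb sr 1 (1 / 4) ht x, one_mul] at h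
  have sE : ∀ a : ℝ, StripBounded fun τ _ => a * Real.exp (3 * τ) := by
    intro a
    refine ⟨?_, fun T => ⟨|a| * Real.exp (3 * T), fun τ z _ h2 => ?_⟩⟩
    · exact (by fun_prop : Continuous fun q : ℝ × ℝ => a * Real.exp (3 * q.1)).measurable
    · rw [abs_mul, abs_of_pos (Real.exp_pos _)]
      gcongr
  have hk : ∀ k : ℕ, ∀ t x, 0 ≤ t → 1 / 4 * coneInt r t x ≤ M / 8 ^ (k + 1) * Real.exp (3 * t) := by
    intro k
    have step : ∀ a, 0 ≤ a → (∀ᵐ t : ℝ, 0 ≤ t → ∀ᵐ x : ℝ, r t x ≤ a * Real.exp (3 * t)) →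
        ∀ t x, 0 ≤ t → 1 / 4 * coneInt r t x ≤ a / 8 * Real.exp (3 * t) := by
      intro a ha har t x ht
      have h1 := sr.coneInt_mono (sE a) har ht x
      have h2 := coneInt_exp_le ha ht x
      linarith
    induction k with
    | zero =>
      rw [zero_add, pow_one]
      refine step M hM (ae_of_all _ fun t ht => ae_of_all _ fun x => max_le ?_ (by positivity))
      linarith [hvM t x ht, hw0 t x ht]
    | succ k ih =>
      have := step (M / 8 ^ (k + 1)) (by positivity) (by
        filter_upwards [hveq] with t h1 ht
        filter_upwards [h1 ht] with x h2
        refine max_le ?_ (by positivity)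
        linarith [hS t x ht, hwle t x ht, hvw t x ht, ih t x ht])
      intro t x ht
      refine (this t x ht).trans_eq ?_
      rw [div_div, ← pow_succ]
  have hr : 1 / 4 * coneInt r t x ≤ 0 := by
    have hlim : Filter.Tendsto (fun k : ℕ => M / 8 ^ (k + 1) * Real.exp (3 * t)) Filter.atTop
        (nhds (0 * Real.exp (3 * t))) := by
      refine Filter.Tendsto.mul_const _ ?_
      have h1 : Filter.Tendsto (fun k : ℕ => (1 / 8 : ℝ) ^ (k + 1)) Filter.atTop (nhds 0) :=
        (Filter.tendsto_add_atTop_iff_nat 1).2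
          (tendsto_pow_atTop_nhds_zero_of_lt_one (by norm_num) (by norm_num))
      have h2 := h1.const_mul M
      rw [mul_zero] at h2
      refine h2.congr fun k => ?_
      rw [one_div, inv_pow, div_eq_mul_inv]
    rw [zero_mul] at hlim
    exact ge_of_tendsto' hlim fun k => hk k t x ht
  linarith [hS t x ht]

end

/-! ### Mild solutions as solutions of an integral equation for the wave operator -/

lemma kgSin_const_mul (c : ℝ) (f : ℝ → ℝ) (t x : ℝ) :
    kgSin (fun z => c * f z) t x = c * kgSin f t x := by
  rw [kgSin, kgSin, mul_left_comm, ← intervalIntegral.integral_const_mul c]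
  congr 2
  funext z
  ring

lemma kgSin_add {f g : ℝ → ℝ} {t x : ℝ} (hf : IntervalIntegrable f volume (x - t) (x + t))
    (hg : IntervalIntegrable g volume (x - t) (x + t)) :
    kgSin (fun z => f z + g z) t x = kgSin f t x + kgSin g t x := by
  have hc : ContinuousOn (fun z => besselC 0 ((t ^ 2 - (x - z) ^ 2) / 16))
      (uIcc (x - t) (x + t)) := by fun_prop
  rw [kgSin, kgSin, kgSin, ← mul_add,
    ← intervalIntegral.integral_add (hf.continuousOn_mul hc) (hg.continuousOn_mul hc)]
  congr 2
  funext z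
  ring

/-- The solution at time `t` of the wave equation with initial data `f` and `g`. -/
def waveData (f g : ℝ → ℝ) (t x : ℝ) : ℝ :=
  1 / 2 * (f (x + t) + f (x - t)) + 1 / 2 * ∫ z in (x - t)..(x + t), g z

lemma S_add_dtS_eq {u₀ u₁ f g : ℝ → ℝ} (hf : Continuous f) (hf0 : u₀ =ᵐ[volume] f)
    (hg : ∀ a b, IntervalIntegrable g volume a b)
    (hg1 : (fun y => u₁ y + 1 / 2 * u₀ y) =ᵐ[volume] g) (t x : ℝ) :
    S t (fun y => u₀ y + u₁ y) x + dtS t u₀ x =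
      Real.exp (-t / 2) * (kgSin g t x + kgCos f t x) := by
  have e : (fun y => u₀ y + u₁ y) =ᵐ[volume] fun y => g y + 1 / 2 * f y := by
    filter_upwards [hf0, hg1] with y h1 h2
    rw [← h1, ← h2]
    ring
  rw [S_congr_ae e, dtS_congr_ae hf0, dtS_eq_kg hf, S_eq_kgSin, kgSin_add
    (hg _ _)
    ((by fun_prop : Continuous fun y => 1 / 2 * f y).intervalIntegrable _ _), kgSin_const_mul]
  ring

lemma kgSin_le_of_le {g : ℝ → ℝ} {b : ℝ} (hg : ∀ x, 0 ≤ g x) (hgb : ∀ x, g x ≤ b) {t : ℝ}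
    (ht : 0 ≤ t) (x : ℝ) : kgSin g t x ≤ b * t * Real.exp (t / 2) :=
  (le_abs_self _).trans (abs_kgSin_le ht fun z _ => (abs_of_nonneg (hg z)).trans_le (hgb z))

lemma kgCos_le_of_le {f : ℝ → ℝ} {b : ℝ} (hf : Continuous f) (hf0 : ∀ x, 0 ≤ f x)
    (hfb : ∀ x, f x ≤ b) {t : ℝ} (ht : 0 ≤ t) (x : ℝ) :
    kgCos f t x ≤ b * (1 + t + t ^ 2) * Real.exp (t / 2) := by
  have h1 := kgLin_le_of_le hf0 hfb ht x
  have h2 := kgSin_nonneg (x := x) ht (ae_of_all _ hf0)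
  rw [kgLin_eq hf] at h1
  linarith

lemma kgCos_nonneg {f : ℝ → ℝ} (hf0 : ∀ x, 0 ≤ f x) {t : ℝ} (ht : 0 ≤ t) (x : ℝ) :
    0 ≤ kgCos f t x := by
  refine add_nonneg (mul_nonneg (by norm_num) (add_nonneg (hf0 _) (hf0 _)))
    (mul_nonneg (by norm_num) (intervalIntegral.integral_nonneg (by linarith) fun z hz => ?_))
  exact mul_nonneg (mul_nonneg (by linarith) (besselC_nonneg _ (mul_sub_nonneg_of_mem hz))) (hf0 z)

lemma stripBounded_kgSin {g : ℝ → ℝ} {b : ℝ} (hm : Measurable g) (hg : ∀ x, 0 ≤ g x)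
    (hgb : ∀ x, g x ≤ b) : StripBounded (kgSin g) := by
  refine ⟨measurable_kgSin hm, fun T => ⟨b * T * Real.exp (T / 2), fun t x h0 hT => ?_⟩⟩
  have hb : 0 ≤ b := (hg 0).trans (hgb 0)
  have hT0 : 0 ≤ T := h0.trans hT
  rw [abs_of_nonneg (kgSin_nonneg h0 (ae_of_all _ hg))]
  refine (kgSin_le_of_le hg hgb h0 x).trans ?_
  gcongr

lemma stripBounded_kgCos {f : ℝ → ℝ} {b : ℝ} (hf : Continuous f) (hf0 : ∀ x, 0 ≤ f x)
    (hfb : ∀ x, f x ≤ b) : StripBounded (kgCos f) := by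
  refine ⟨(continuous_kgCos hf).measurable,
    fun T => ⟨b * (1 + T + T ^ 2) * Real.exp (T / 2), fun t x h0 hT => ?_⟩⟩
  have hb : 0 ≤ b := (hf0 0).trans (hfb 0)
  have hT0 : 0 ≤ T := h0.trans hT
  rw [abs_of_nonneg (kgCos_nonneg hf0 h0 x)]
  refine (kgCos_le_of_le hf hf0 hfb h0 x).trans ?_
  gcongr

lemma stripBounded_kgDuhamel {F : ℝ → ℝ → ℝ} (hF : StripBounded F) :
    StripBounded (kgDuhamel F) := by
  refine ⟨measurable_kgDuhamel hF.measurable, fun T => ?_⟩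
  obtain ⟨M, hM⟩ := hF.bounded T
  refine ⟨M * T * Real.exp (T / 2) * T, fun t x h0 hT => ?_⟩
  have hM0 : 0 ≤ M := (abs_nonneg _).trans (hM t x h0 hT)
  have hT0 : 0 ≤ T := h0.trans hT
  refine (abs_kgDuhamel_le h0 fun τ z h1 h2 => hM τ z h1 (h2.trans hT)).trans ?_
  gcongr

/-- If `u` solves the Klein-Gordon form of the mild equation with source `F`, then the same
function solves the wave form of the equation, with the zeroth order term moved to the source. -/
lemma kg_eq_waveData_add_coneInt {f g : ℝ → ℝ} {F : ℝ → ℝ → ℝ} {b : ℝ} (hf : Continuous f)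
    (hf0 : ∀ x, 0 ≤ f x) (hfb : ∀ x, f x ≤ b) (hm : Measurable g) (hg : ∀ x, 0 ≤ g x)
    (hgb : ∀ x, g x ≤ b) (hF : StripBounded F) {v : ℝ → ℝ → ℝ} (hv : StripBounded v)
    (hvF : ∀ᵐ τ : ℝ, 0 ≤ τ → ∀ᵐ z : ℝ, v τ z = kgSin g τ z + kgCos f τ z - kgDuhamel F τ z)
    {t : ℝ} (ht : 0 ≤ t) (x : ℝ) :
    kgSin g t x + kgCos f t x - kgDuhamel F t x =
      waveData f g t x + coneInt (fun τ z => 1 / 4 * v τ z - F τ z) t x := by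
  have sS := stripBounded_kgSin hm hg hgb
  have sC := stripBounded_kgCos hf hf0 hfb
  have sD := stripBounded_kgDuhamel hF
  have sH := sS.linear_comb sC 1 1
  have sW := sH.linear_comb sD 1 (-1)
  have e1 := sS.coneInt_linear_comb sC 1 1 ht x
  have e2 := sH.coneInt_linear_comb sD 1 (-1) ht x
  have e3 := hv.coneInt_congr sW (by
    filter_upwards [hvF] with τ h1 h0
    filter_upwards [h1 h0] with z hz
    rw [hz]
    ring) ht x
  have e4 := hv.coneInt_linear_comb hF (1 / 4) (-1) ht x
  have e5 : (fun τ z => 1 / 4 * v τ z - F τ z) = fun τ z => 1 / 4 * v τ z + -1 * F τ z := by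
    funext τ z
    ring
  obtain ⟨M, hM⟩ := hF.bounded t
  rw [e5, e4, e3, e2, e1, waveData, kgDuhamel_volterra hF.measurable ht hM,
    kgSin_volterra hm ht fun z _ => (abs_of_nonneg (hg z)).trans_le (hgb z),
    kgCos_volterra hf ht]
  ring

/-- A mild solution with bounded nonnegative data is bounded on strips, because the Duhamel term is
nonnegative. Up to the factor `exp (t / 2)` and null sets it is a solution of the wave equation
with source `source p`, in integral form. -/
lemma IsMildSolution.exists_wave_form {p : ℝ} (hp : 1 < p) {u₀ u₁ : ℝ → ℝ} {u : ℝ → ℝ → ℝ}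
    (hu : IsMildSolution p u₀ u₁ u) {f g : ℝ → ℝ} {b : ℝ} (hf : Continuous f)
    (hf0 : u₀ =ᵐ[volume] f) (hg : Measurable g)
    (hg1 : (fun y => u₁ y + 1 / 2 * u₀ y) =ᵐ[volume] g) (hfn : ∀ x, 0 ≤ f x) (hfb : ∀ x, f x ≤ b)
    (hgn : ∀ x, 0 ≤ g x) (hgb : ∀ x, g x ≤ b) :
    ∃ v : ℝ → ℝ → ℝ, StripBounded v ∧ (∀ t x, 0 ≤ t → 0 ≤ v t x) ∧
      (∀ t x, 0 ≤ t → v t x ≤ b * Real.exp (3 * t)) ∧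
      (∀ᵐ t : ℝ, 0 ≤ t → ∀ᵐ x : ℝ, v t x = Real.exp (t / 2) * u t x) ∧
      ∀ t, 0 ≤ t → ∀ᵐ x : ℝ, Real.exp (t / 2) * u t x =
        waveData f g t x + coneInt (source p v) t x := by
  have hb : 0 ≤ b := (hfn 0).trans (hfb 0)
  have hp0 : 0 < p := by linarith
  have hgi : ∀ a c, IntervalIntegrable g volume a c := fun a c =>
    intervalIntegrable_of_bounded hg.aestronglyMeasurable fun x _ =>
      (abs_of_nonneg (hgn x)).trans_le (hgb x)
  have hexp : ∀ t : ℝ, Real.exp (t / 2) * Real.exp (-t / 2) = 1 := fun t => by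
    rw [← Real.exp_add, ← Real.exp_zero]
    congr 1
    ring
  have heqn : ∀ t, 0 ≤ t → ∀ᵐ x : ℝ, Real.exp (t / 2) * u t x = kgSin g t x + kgCos f t x -
      Real.exp (t / 2) * ∫ τ in (0 : ℝ)..t, S (t - τ) (fun y => u τ y ^ p) x := by
    intro t ht
    filter_upwards [hu.eqn t ht] with x hx
    rw [hx, S_add_dtS_eq hf hf0 hgi hg1, mul_sub, ← mul_assoc, hexp, one_mul]
  have hle : ∀ t, 0 ≤ t → ∀ᵐ x : ℝ, Real.exp (t / 2) * u t x ≤ b * Real.exp (3 * t) := by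
    intro t ht
    filter_upwards [heqn t ht] with x hx
    have h1 : 0 ≤ ∫ τ in (0 : ℝ)..t, S (t - τ) (fun y => u τ y ^ p) x := by
      refine intervalIntegral.integral_nonneg ht fun τ hτ => ?_
      rw [S_eq_kgSin]
      refine mul_nonneg (Real.exp_pos _).le (kgSin_nonneg (by linarith [hτ.2]) ?_)
      filter_upwards [hu.nonneg τ hτ.1] with z hz using Real.rpow_nonneg hz p
    have h2 := mul_nonneg (Real.exp_pos (t / 2)).le h1
    have h3 := kgSin_le_of_le hgn hgb ht x
    have h4 := kgCos_le_of_le hf hfn hfb ht x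
    have h5 : (1 + t) ^ 2 * Real.exp (t / 2) ≤ Real.exp (3 * t) := by
      have h6 : (1 + t) ^ 2 ≤ Real.exp t ^ 2 := by
        have := Real.add_one_le_exp t
        gcongr
        linarith
      calc (1 + t) ^ 2 * Real.exp (t / 2) ≤ Real.exp t ^ 2 * Real.exp t := by
            gcongr
            linarith
        _ = Real.exp (3 * t) := by
            rw [← pow_succ, ← Real.exp_nat_mul]
            norm_num
    have h7 := mul_le_mul_of_nonneg_left h5 hb
    nlinarith
  -- A jointly measurable version of `u ^ p` on the half space.
  obtain ⟨G, hGm, hG⟩ : ∃ G : ℝ × ℝ → ℝ, Measurable G ∧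
      ∀ᵐ τ : ℝ, 0 ≤ τ → ∀ᵐ z : ℝ, u τ z ^ p = G (τ, z) := by
    have hae := hu.locInt.aestronglyMeasurable
    rw [Measure.volume_eq_prod, ← Measure.prod_restrict, Measure.restrict_univ] at hae
    refine ⟨hae.mk _, hae.stronglyMeasurable_mk.measurable, ?_⟩
    have h2 := Measure.ae_ae_of_ae_prod hae.ae_eq_mk
    rwa [ae_restrict_iff' measurableSet_Ici] at h2
  set v : ℝ → ℝ → ℝ := fun τ z =>
    min (Real.exp (τ / 2) * max (G (τ, z)) 0 ^ (1 / p)) (b * Real.exp (3 * τ)) with hv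
  have hvu : ∀ᵐ τ : ℝ, 0 ≤ τ → ∀ᵐ z : ℝ, v τ z = Real.exp (τ / 2) * u τ z := by
    filter_upwards [hG] with τ h1 h0
    filter_upwards [h1 h0, hu.nonneg τ h0, hle τ h0] with z h2 h3 h4
    simp only [hv]
    rw [← h2, max_eq_left (Real.rpow_nonneg h3 p), ← Real.rpow_mul h3, mul_one_div_cancel hp0.ne',
      Real.rpow_one, min_eq_left h4]
  have hv0 : ∀ t x, 0 ≤ t → 0 ≤ v t x := fun t x _ => by
    have := Real.rpow_nonneg (le_max_right (G (t, x)) 0) (1 / p)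
    exact le_min (by positivity) (by positivity)
  have hvb : ∀ t x, 0 ≤ t → v t x ≤ b * Real.exp (3 * t) := fun t x _ => min_le_right _ _
  have sv : StripBounded v := by
    refine ⟨?_, fun T => ⟨b * Real.exp (3 * T), fun τ z h0 hT => ?_⟩⟩
    · refine Measurable.min (Measurable.mul (by fun_prop) ?_) (by fun_prop)
      exact (hGm.max measurable_const).pow_const _
    · rw [abs_of_nonneg (hv0 τ z h0)]
      refine (hvb τ z h0).trans ?_
      gcongr
  set F : ℝ → ℝ → ℝ := fun τ z => Real.exp (τ / 2) * (Real.exp (-τ / 2) * v τ z) ^ p with hFdef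
  have sF : StripBounded F := by
    have h := sv.linear_comb (sv.source hp hv0) (1 / 4) (-1)
    convert h using 3 with τ z
    simp only [hFdef, DampedWave.source]
    ring
  have hduh : ∀ t, 0 ≤ t → ∀ x : ℝ, Real.exp (t / 2) *
      ∫ τ in (0 : ℝ)..t, S (t - τ) (fun y => u τ y ^ p) x = kgDuhamel F t x := by
    intro t ht x
    rw [kgDuhamel, ← intervalIntegral.integral_const_mul]
    refine intervalIntegral.integral_congr_ae ?_
    filter_upwards [hvu] with τ h1 h2
    rw [uIoc_of_le ht] at h2
    rw [S_eq_kgSin, ← mul_assoc, ← Real.exp_add, show t / 2 + -(t - τ) / 2 = τ / 2 by ring,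
      ← kgSin_const_mul]
    refine kgSin_congr_ae ?_ _ _
    filter_upwards [h1 h2.1.le] with z hz
    simp only [hFdef]
    rw [hz, ← mul_assoc, mul_comm (Real.exp (-τ / 2)), hexp, one_mul]
  refine ⟨v, sv, hv0, hvb, hvu, fun t ht => ?_⟩
  filter_upwards [heqn t ht] with x hx
  rw [hx, hduh t ht]
  refine kg_eq_waveData_add_coneInt hf hfn hfb hg hgn hgb sF sv ?_ ht x
  filter_upwards [hvu] with τ h1 h0
  filter_upwards [h1 h0, heqn τ h0] with z h2 h3
  rw [h2, h3, hduh τ h0]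

/-! ### Continuous representatives of weakly differentiable functions -/

lemma exists_tsupport_subset_ball {g : ℝ → ℝ} (hg : HasCompactSupport g) :
    ∃ R, 0 < R ∧ tsupport g ⊆ Ioo (-R) R := by
  obtain ⟨R, hR, h⟩ := hg.isCompact.isBounded.subset_ball_lt 0 0
  refine ⟨R, hR, ?_⟩
  rwa [Real.ball_eq_Ioo, zero_sub, zero_add] at h

lemma support_subset_Ioc {g : ℝ → ℝ} {R : ℝ} (h : tsupport g ⊆ Ioo (-R) R) :
    Function.support g ⊆ Ioc (-R) R :=
  ((subset_tsupport g).trans h).trans Ioo_subset_Ioc_self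

lemma continuous_primitive_of_locallyIntegrable {f : ℝ → ℝ} (hf : LocallyIntegrable f volume) :
    Continuous fun x => ∫ z in (0 : ℝ)..x, f z :=
  intervalIntegral.continuous_primitive (fun _ _ => intervalIntegrable_iff.2
    ((hf.integrableOn_isCompact isCompact_uIcc).mono_set uIoc_subset_uIcc)) 0

/-- The primitive of a locally integrable function is a weak primitive. -/
lemma integral_primitive_mul_deriv {f : ℝ → ℝ} (hf : LocallyIntegrable f volume) {η : ℝ → ℝ}
    (hη : ContDiff ℝ ∞ η) (hs : HasCompactSupport η) :
    ∫ x, (∫ z in (0 : ℝ)..x, f z) * deriv η x = -∫ x, f x * η x := by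
  obtain ⟨R, hR, hR'⟩ := exists_tsupport_subset_ball hs
  have hi : IntervalIntegrable f volume (-R) R := intervalIntegrable_iff.2
    ((hf.integrableOn_isCompact isCompact_uIcc).mono_set uIoc_subset_uIcc)
  have h := AbsolutelyContinuousOnInterval.integral_mul_deriv_eq_deriv_mul
    (hi.absolutelyContinuousOnInterval_intervalIntegral (c := 0)
      (by rw [uIcc_of_le (by linarith)]; constructor <;> linarith))
    ((hη.of_le (by norm_cast) : ContDiff ℝ 1 η).contDiffOn.absolutelyContinuousOnInterval
      (a := -R) (b := R))
  have hη0 : ∀ x, x ∉ Ioo (-R) R → η x = 0 := fun x hx =>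
    image_eq_zero_of_notMem_tsupport fun h => hx (hR' h)
  rw [hη0 R (by simp), hη0 (-R) (by simp), mul_zero, mul_zero, sub_zero, zero_sub,
    intervalIntegral.integral_eq_integral_of_support_subset,
    intervalIntegral.integral_congr_ae (g := fun x => f x * η x),
    intervalIntegral.integral_eq_integral_of_support_subset] at h
  · exact h
  · exact (Function.support_mul_subset_right _ _).trans (support_subset_Ioc hR')
  · filter_upwards [LocallyIntegrable.ae_hasDerivAt_integral hf] with x hx _
    rw [(hx 0).deriv]
  · exact (Function.support_mul_subset_right _ _).trans
      (support_subset_Ioc ((tsupport_deriv_subset (𝕜 := ℝ)).trans hR'))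

/-- A test function of vanishing integral is the derivative of a test function. -/
lemma exists_deriv_eq_of_integral_eq_zero {g : ℝ → ℝ} (hg : ContDiff ℝ ∞ g)
    (hs : HasCompactSupport g) (h0 : ∫ x, g x = 0) :
    ∃ η : ℝ → ℝ, ContDiff ℝ ∞ η ∧ HasCompactSupport η ∧ deriv η = g := by
  obtain ⟨R, hR, hR'⟩ := exists_tsupport_subset_ball hs
  have hd : ∀ x, HasDerivAt (fun x => ∫ z in (-R)..x, g z) (g x) x := fun x =>
    hg.continuous.integral_hasStrictDerivAt (-R) x |>.hasDerivAt
  have hd' : deriv (fun x => ∫ z in (-R)..x, g z) = g := funext fun x => (hd x).deriv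
  refine ⟨fun x => ∫ z in (-R)..x, g z, ?_, ?_, hd'⟩
  · exact contDiff_infty_iff_deriv.2 ⟨fun x => (hd x).differentiableAt, hd'.symm ▸ hg⟩
  · refine HasCompactSupport.intro (isCompact_Icc (a := -R) (b := R)) fun x hx => ?_
    have hg0 : ∀ x, x ∉ Ioo (-R) R → g x = 0 := fun x hx =>
      image_eq_zero_of_notMem_tsupport fun h => hx (hR' h)
    rcases lt_or_ge x (-R) with h | h
    · refine (intervalIntegral.integral_congr (g := fun _ => (0 : ℝ)) fun z hz => ?_).trans (by simp)
      rw [uIcc_of_ge h.le] at hz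
      exact hg0 z fun h' => by linarith [h'.1, hz.2]
    · have hx' : R < x := by
        by_contra h'
        exact hx ⟨h, not_lt.1 h'⟩
      rw [intervalIntegral.integral_eq_integral_of_support_subset, h0]
      exact (support_subset_Ioc hR').trans (Ioc_subset_Ioc_right hx'.le)

/-- A weakly differentiable function on the line has a continuous representative. -/
lemma IsWeakDeriv.exists_continuous {f f' : ℝ → ℝ} (h : IsWeakDeriv f f') :
    ∃ g : ℝ → ℝ, Continuous g ∧ f =ᵐ[volume] g := by
  obtain ⟨hf, hf', hw⟩ := h
  have hG := continuous_primitive_of_locallyIntegrable hf'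
  set G : ℝ → ℝ := fun x => ∫ z in (0 : ℝ)..x, f' z with hGdef
  have hd : LocallyIntegrable (fun x => f x - G x) volume := hf.sub hG.locallyIntegrable
  have hint : ∀ {k g : ℝ → ℝ}, LocallyIntegrable k volume → Continuous g → HasCompactSupport g →
      Integrable (fun x => k x * g x) volume := fun hk hg hs => by
    simpa only [smul_eq_mul, mul_comm] using hk.integrable_smul_left_of_hasCompactSupport hg hs
  have hzero : ∀ η : ℝ → ℝ, ContDiff ℝ ∞ η → HasCompactSupport η →
      ∫ x, (f x - G x) * deriv η x = 0 := by
    intro η hη hs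
    have hη' : Continuous (deriv η) := hη.continuous_deriv (by norm_cast)
    simp only [sub_mul]
    rw [integral_sub (hint hf hη' hs.deriv) (hint hG.locallyIntegrable hη' hs.deriv), hw η hη hs,
      integral_primitive_mul_deriv hf' hη hs, sub_self]
  let ρ : ContDiffBump (0 : ℝ) := ⟨1, 2, one_pos, one_lt_two⟩
  set c := ∫ x, (f x - G x) * ρ.normed volume x with hc
  have hρ : ContDiff ℝ ∞ (ρ.normed volume) := ρ.contDiff_normed
  have hρs : HasCompactSupport (ρ.normed (volume : Measure ℝ)) := ρ.hasCompactSupport_normed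
  have hconst : ∀ᵐ x, f x - G x = c := by
    refine ae_eq_of_integral_contDiff_smul_eq hd (locallyIntegrable_const c) fun g hg hs => ?_
    obtain ⟨η, hη, hηs, hη'⟩ := exists_deriv_eq_of_integral_eq_zero
      (g := fun x => g x - (∫ z, g z) * ρ.normed volume x) (by fun_prop)
      (hs.sub (hρs.mul_left (f := fun _ => ∫ z, g z))) (by
        rw [integral_sub (hg.continuous.integrable_of_hasCompactSupport hs)
          (ρ.integrable_normed.const_mul _), integral_const_mul, ρ.integral_normed, mul_one,
          sub_self])
    have h1 := hzero η hη hηs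
    rw [hη'] at h1
    have e : ∀ x, (f x - G x) * (g x - (∫ z, g z) * ρ.normed volume x) =
        (f x - G x) * g x - (∫ z, g z) * ((f x - G x) * ρ.normed volume x) := fun x => by ring
    simp only [e] at h1
    rw [integral_sub (hint hd hg.continuous hs) ((hint hd hρ.continuous hρs).const_mul _),
      integral_const_mul, ← hc, sub_eq_zero] at h1
    simp only [smul_eq_mul]
    rw [integral_mul_const, ← h1]
    simp only [mul_comm]
  refine ⟨fun x => G x + c, by fun_prop, ?_⟩
  filter_upwards [hconst] with x hx
  rw [← hx]
  ring

/-! ### Regularization of the profile -/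

lemma le_of_ae_le {U : Set ℝ} (hU : IsOpen U) {f g : ℝ → ℝ} (hf : Continuous f)
    (hg : Continuous g) (h : ∀ᵐ x : ℝ, x ∈ U → f x ≤ g x) : ∀ x ∈ U, f x ≤ g x := by
  intro x hx
  by_contra hlt
  have ho : IsOpen (U ∩ {y | g y < f y}) := hU.inter (isOpen_lt hg hf)
  refine (ho.measure_pos volume ⟨x, hx, not_le.1 hlt⟩).ne' ?_
  refine measure_mono_null (fun y hy => ?_) h
  exact fun h' => absurd (h' hy.1) (not_le.2 hy.2)

lemma le_of_ae_ae_le {R : ℝ → ℝ → Prop} (hR1 : ∀ x, IsOpen {y | R x y})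
    (hR2 : ∀ y, IsOpen {x | R x y}) {φ g : ℝ → ℝ} (hg : Continuous g) (hφ : φ =ᵐ[volume] g) {K : ℝ}
    (h : ∀ᵐ x : ℝ, ∀ᵐ y : ℝ, R x y → φ x ≤ K * φ y) {x y : ℝ} (hxy : R x y) :
    g x ≤ K * g y := by
  refine le_of_ae_le (hR2 y) hg (continuous_const (y := K * g y)) ?_ x hxy
  filter_upwards [h, hφ] with x' h1 h2 h3
  refine le_of_ae_le (hR1 x') (continuous_const (y := g x')) (by fun_prop : Continuous
    fun y => K * g y) ?_ y h3
  filter_upwards [h1, hφ] with y' h4 h5 h6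
  rw [← h2, ← h5]
  exact h4 h6

/-- The continuous representative of a profile inherits the comparison properties at every point. -/
lemma exists_continuous_profile {φ φ' : ℝ → ℝ} (hφ : IsWeakDeriv φ φ') (hφb : MemLp φ ∞ volume)
    (hpos : ∀ᵐ x : ℝ, 0 < φ x) {K₀ : ℝ}
    (hnear : ∀ᵐ x : ℝ, ∀ᵐ y : ℝ, y ∈ Ioo (x - 1) (x + 1) → φ x ≤ K₀ * φ y)
    (hdoub : ∀ᵐ x : ℝ, ∀ᵐ y : ℝ, |y| < 2 * |x| → φ x ≤ K₀ * φ y) :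
    ∃ (g : ℝ → ℝ) (K M : ℝ), Continuous g ∧ φ =ᵐ[volume] g ∧ 1 ≤ K ∧ (∀ x, 0 < g x) ∧
      (∀ x, g x ≤ M) ∧ (∀ x y, |x - y| < 1 → g x ≤ K * g y) ∧
      ∀ x y, |y| < 2 * |x| → g x ≤ K * g y := by
  obtain ⟨g, hg, hφg⟩ := hφ.exists_continuous
  have h0 : ∀ x, 0 ≤ g x := fun x => by
    refine le_of_ae_le isOpen_univ continuous_const hg ?_ x (mem_univ x)
    filter_upwards [hpos, hφg] with y h1 h2 _
    rw [← h2]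
    exact h1.le
  have hn : ∀ x y, |x - y| < 1 → g x ≤ K₀ * g y := fun x y hxy => by
    refine le_of_ae_ae_le (R := fun x y => |x - y| < 1) (fun x => ?_) (fun y => ?_) hg hφg ?_ hxy
    · exact isOpen_lt (by fun_prop) continuous_const
    · exact isOpen_lt (by fun_prop) continuous_const
    · filter_upwards [hnear] with x h1
      filter_upwards [h1] with y h2 h3
      rw [abs_lt] at h3
      exact h2 ⟨by linarith, by linarith⟩
  have hd : ∀ x y, |y| < 2 * |x| → g x ≤ K₀ * g y := fun x y hxy =>
    le_of_ae_ae_le (R := fun x y => |y| < 2 * |x|) (fun x => isOpen_lt (by fun_prop) (by fun_prop))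
      (fun y => isOpen_lt (by fun_prop) (by fun_prop)) hg hφg hdoub hxy
  have hpos' : ∀ x, 0 < g x := by
    intro x
    by_contra hx
    have hx0 : g x = 0 := le_antisymm (not_lt.1 hx) (h0 x)
    -- Near a zero of `g` the function vanishes identically, which its positivity almost everywhere
    -- excludes.
    refine (Metric.isOpen_ball.measure_pos volume ⟨x, Metric.mem_ball_self (one_pos)⟩).ne' ?_
    refine measure_mono_null (t := {y | ¬ 0 < g y}) (fun y hy => ?_) ?_
    · have := hn y x (by rwa [Metric.mem_ball, Real.dist_eq] at hy)
      rw [hx0, mul_zero] at this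
      exact not_lt.2 this
    · filter_upwards [hpos, hφg] with y h1 h2
      change 0 < g y
      rwa [← h2]
  obtain ⟨M, hM⟩ : ∃ M : ℝ, ∀ᵐ x : ℝ, ‖φ x‖ ≤ M := ⟨_, ae_le_lpNorm_exponent_top hφb⟩
  refine ⟨g, max K₀ 1, M, hg, hφg, le_max_right _ _, hpos', ?_, fun x y h => ?_, fun x y h => ?_⟩
  · intro x
    refine le_of_ae_le isOpen_univ hg continuous_const ?_ x (mem_univ x)
    filter_upwards [hM, hφg] with y h1 h2 _
    rw [← h2]
    exact (le_abs_self _).trans h1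
  · exact (hn x y h).trans (mul_le_mul_of_nonneg_right (le_max_left _ _) (h0 y))
  · exact (hd x y h).trans (mul_le_mul_of_nonneg_right (le_max_left _ _) (h0 y))

/-- Doubling yields a polynomial lower bound, hence control of the oscillation at large scales. -/
lemma exists_far_bound {g : ℝ → ℝ} {K M : ℝ} (hK : 1 ≤ K) (hpos : ∀ x, 0 < g x)
    (hM : ∀ x, g x ≤ M) (hd : ∀ x y, |y| < 2 * |x| → g x ≤ K * g y) :
    ∃ A > 0, ∃ N : ℕ, ∀ t x z, 1 ≤ t → |x - z| ≤ t → g z ≤ A * t ^ N * g x := by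
  have hKK : K ≤ K ^ 2 := by nlinarith
  have hd2 : ∀ x y, |y| ≤ 2 * |x| → g x ≤ K ^ 2 * g y := by
    intro x y hxy
    have h1 : g x ≤ K * g (3 / 4 * y) ∨ x = y := by
      rcases eq_or_ne x 0 with rfl | hx
      · right
        rw [abs_zero, mul_zero] at hxy
        exact (abs_nonpos_iff.1 hxy).symm
      · left
        refine hd _ _ ?_
        rw [abs_mul, abs_of_pos (by norm_num : (0 : ℝ) < 3 / 4)]
        linarith [abs_pos.2 hx]
    have h2 : g (3 / 4 * y) ≤ K * g y := by
      rcases eq_or_ne y 0 with rfl | hy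
      · rw [mul_zero]
        nlinarith [hpos 0]
      · refine hd _ _ ?_
        rw [abs_mul, abs_of_pos (by norm_num : (0 : ℝ) < 3 / 4)]
        linarith [abs_pos.2 hy]
    rcases h1 with h1 | rfl
    · calc g x ≤ K * g (3 / 4 * y) := h1
        _ ≤ K * (K * g y) := by gcongr
        _ = K ^ 2 * g y := by ring
    · nlinarith [hpos x]
  obtain ⟨N, hN⟩ := pow_unbounded_of_one_lt (K ^ 2) (one_lt_two : (1 : ℝ) < 2)
  have hlow : ∀ k : ℕ, ∀ y, |y| ≤ 2 ^ k → g 1 ≤ (2 ^ (k + 1)) ^ N * g y := by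
    intro k
    induction k with
    | zero =>
      intro y hy
      rw [zero_add, pow_one]
      refine (hd2 1 y (by rw [pow_zero] at hy; rw [abs_one]; linarith)).trans ?_
      exact mul_le_mul_of_nonneg_right hN.le (hpos y).le
    | succ k ih =>
      intro y hy
      have h1 := ih (2 ^ k) (by rw [abs_of_pos (by positivity)])
      have h2 := hd2 (2 ^ k) y (by
        rw [abs_of_pos (by positivity : (0 : ℝ) < 2 ^ k)]
        rwa [pow_succ'] at hy)
      calc g 1 ≤ (2 ^ (k + 1)) ^ N * g (2 ^ k) := h1
        _ ≤ (2 ^ (k + 1)) ^ N * (2 ^ N * g y) := by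
            gcongr
            exact h2.trans (mul_le_mul_of_nonneg_right hN.le (hpos y).le)
        _ = (2 ^ (k + 1 + 1)) ^ N * g y := by
            rw [← mul_assoc, ← mul_pow, ← pow_succ]
  have hM0 : 0 < M := (hpos 0).trans_le (hM 0)
  have h1 := hpos 1
  refine ⟨M / g 1 * 8 ^ N + K ^ 2, by positivity, N, fun t x z ht hxz => ?_⟩
  have ht0 : 0 < t := by linarith
  have hx := hpos x
  rw [add_mul, add_mul]
  rcases le_total |x| (2 * t) with h | h
  · obtain ⟨n, hn1, hn2⟩ := exists_nat_pow_near (by linarith : 1 ≤ 2 * t)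
      (one_lt_two : (1 : ℝ) < 2)
    have h2 := hlow (n + 1) x (h.trans hn2.le)
    have h3 : (2 : ℝ) ^ (n + 1 + 1) ≤ 8 * t := by
      rw [pow_succ, pow_succ]
      linarith
    have h4 : g 1 ≤ 8 ^ N * t ^ N * g x := by
      refine h2.trans ?_
      rw [← mul_pow]
      gcongr
    have h5 : M ≤ M / g 1 * 8 ^ N * t ^ N * g x := by
      calc M = M / g 1 * g 1 := by field_simp
        _ ≤ M / g 1 * (8 ^ N * t ^ N * g x) := by gcongr
        _ = _ := by ring
    have h6 : 0 ≤ K ^ 2 * t ^ N * g x := by positivity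
    linarith [hM z]
  · have h2 : |x| - |z| ≤ |x - z| := abs_sub_abs_le_abs_sub x z
    have h3 := hd2 z x (by linarith)
    have h4 : K ^ 2 * g x ≤ K ^ 2 * t ^ N * g x := by
      have := one_le_pow₀ ht (n := N)
      have h5 : 0 < K ^ 2 * g x := by positivity
      nlinarith
    have h6 : 0 ≤ M / g 1 * 8 ^ N * t ^ N * g x := by positivity
    linarith

/-- Averaging over unit intervals turns a continuous profile into a comparable `SlowProfile`. -/
lemma exists_slowProfile {g : ℝ → ℝ} {K M : ℝ} (hg : Continuous g) (hK : 1 ≤ K)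
    (hpos : ∀ x, 0 < g x) (hM : ∀ x, g x ≤ M) (hn : ∀ x y, |x - y| < 1 → g x ≤ K * g y)
    (hd : ∀ x y, |y| < 2 * |x| → g x ≤ K * g y) :
    ∃ (ψ ψ' : ℝ → ℝ) (K' : ℝ) (N : ℕ), SlowProfile ψ ψ' K' N ∧ (∀ x, ψ x ≤ g x) ∧
      ∀ x, g x ≤ K ^ 2 * ψ x := by
  obtain ⟨A, hA, N, hfar⟩ := exists_far_bound hK hpos hM hd
  have hK0 : 0 < K := by linarith
  set ψ : ℝ → ℝ := fun x => 1 / K * ∫ z in (x - 1 / 2)..(x + 1 / 2), g z with hψ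
  have hle : ∀ x, ψ x ≤ g x := by
    intro x
    have h : ∫ z in (x - 1 / 2)..(x + 1 / 2), g z ≤ ∫ _z in (x - 1 / 2)..(x + 1 / 2), K * g x := by
      refine intervalIntegral.integral_mono_on (by linarith) (hg.intervalIntegrable _ _)
        (by simp) fun z hz => hn z x ?_
      rw [abs_lt]
      constructor <;> linarith [hz.1, hz.2]
    rw [intervalIntegral.integral_const, smul_eq_mul] at h
    simp only [hψ]
    rw [one_div, inv_mul_le_iff₀ hK0]
    linarith
  have hge : ∀ x, g x ≤ K ^ 2 * ψ x := by
    intro x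
    have h : ∫ _z in (x - 1 / 2)..(x + 1 / 2), g x ≤ ∫ z in (x - 1 / 2)..(x + 1 / 2), K * g z := by
      refine intervalIntegral.integral_mono_on (by linarith) (by simp)
        ((hg.intervalIntegrable _ _).const_mul K) fun z hz => hn x z ?_
      rw [abs_lt]
      constructor <;> linarith [hz.1, hz.2]
    rw [intervalIntegral.integral_const, smul_eq_mul, intervalIntegral.integral_const_mul] at h
    have e : K ^ 2 * ψ x = K * ∫ z in (x - 1 / 2)..(x + 1 / 2), g z := by
      simp only [hψ]
      field_simp
    rw [e]
    linarith
  have hψ0 : ∀ x, 0 < ψ x := fun x => by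
    have h1 := hge x
    have h2 := hpos x
    have h3 : 0 < K ^ 2 := by positivity
    exact pos_of_mul_pos_right (h2.trans_le h1) h3.le
  refine ⟨ψ, fun x => 1 / K * (g (x + 1 / 2) - g (x - 1 / 2)), K ^ 4 + A * K ^ 2, N,
    ⟨fun x => ?_, by fun_prop, hψ0, fun x => ?_, fun x z hxz => ?_, fun t x z ht hxz => ?_⟩,
    hle, hge⟩
  · have hP : ∀ y, HasDerivAt (fun y => ∫ z in (0 : ℝ)..y, g z) (g y) y := fun y =>
      (hg.integral_hasStrictDerivAt 0 y).hasDerivAt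
    have e : ψ = fun x => 1 / K *
        ((∫ z in (0 : ℝ)..(x + 1 / 2), g z) - ∫ z in (0 : ℝ)..(x - 1 / 2), g z) := by
      funext y
      simp only [hψ]
      rw [intervalIntegral.integral_interval_sub_left (hg.intervalIntegrable _ _)
        (hg.intervalIntegrable _ _)]
    rw [e]
    exact (((hP _).comp_add_const x (1 / 2)).sub ((hP _).comp_sub_const x (1 / 2))).const_mul _
  · have h1 := hn (x + 1 / 2) x (by rw [add_sub_cancel_left]; norm_num [abs_of_pos])
    have h2 := hn (x - 1 / 2) x (by rw [sub_sub_cancel_left, abs_neg]; norm_num [abs_of_pos])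
    have h3 : |g (x + 1 / 2) - g (x - 1 / 2)| ≤ K * g x := by
      rw [abs_le]
      constructor <;> linarith [hpos (x + 1 / 2), hpos (x - 1 / 2)]
    rw [abs_mul, abs_of_pos (by positivity), one_div, inv_mul_le_iff₀ hK0]
    refine h3.trans ?_
    have h4 : K ^ 2 * ψ x ≤ (K ^ 4 + A * K ^ 2) * ψ x := by
      have h5 : K ^ 2 ≤ K ^ 4 := pow_le_pow_right₀ hK (by norm_num)
      have h6 : 0 ≤ A * K ^ 2 := by positivity
      have := hψ0 x
      gcongr
      linarith
    have := (hge x).trans h4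
    gcongr
  · have h1 : g x ≤ K * g ((x + z) / 2) := hn _ _ (by
      rw [show x - (x + z) / 2 = (x - z) * (1 / 2) by ring, abs_mul,
        abs_of_pos (by norm_num : (0 : ℝ) < 1 / 2)]
      linarith)
    have h2 : g ((x + z) / 2) ≤ K * g z := hn _ _ (by
      rw [show (x + z) / 2 - z = (x - z) * (1 / 2) by ring, abs_mul,
        abs_of_pos (by norm_num : (0 : ℝ) < 1 / 2)]
      linarith)
    have h3 : 0 ≤ A * K ^ 2 * ψ z := by
      have := hψ0 z
      positivity
    calc ψ x ≤ g x := hle x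
      _ ≤ K * (K * (K ^ 2 * ψ z)) := h1.trans (by gcongr; exact h2.trans (by gcongr; exact hge z))
      _ ≤ (K ^ 4 + A * K ^ 2) * ψ z := by linarith
  · have h3 : 0 ≤ K ^ 4 * t ^ N * ψ x := by
      have := hψ0 x
      positivity
    calc ψ z ≤ g z := hle z
      _ ≤ A * t ^ N * (K ^ 2 * ψ x) := (hfar t x z ht hxz).trans (by gcongr; exact hge x)
      _ ≤ (K ^ 4 + A * K ^ 2) * t ^ N * ψ x := by linarith

/-- Everywhere defined nonnegative representatives of the data, below a continuous majorant. -/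
lemma exists_measurable_between {f B : ℝ → ℝ} (hf : AEStronglyMeasurable f volume)
    (hB : Continuous B) (hB0 : ∀ x, 0 ≤ B x) (h : ∀ᵐ x, 0 ≤ f x ∧ f x ≤ B x) :
    ∃ g : ℝ → ℝ, Measurable g ∧ f =ᵐ[volume] g ∧ (∀ x, 0 ≤ g x) ∧ ∀ x, g x ≤ B x := by
  refine ⟨fun x => max 0 (min (hf.mk f x) (B x)), ?_, ?_, fun x => le_max_left _ _,
    fun x => max_le (hB0 x) (min_le_right _ _)⟩
  · exact measurable_const.max (hf.stronglyMeasurable_mk.measurable.min hB.measurable)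
  · filter_upwards [h, hf.ae_eq_mk] with x h1 h2
    rw [← h2, min_eq_left h1.2, max_eq_right h1.1]

section

/-! ### Size of the supersolution and of its initial data -/

lemma inv_envelope_base_le (q : ℝ) {s U : ℝ} (hs : 0 < s) (hU : 0 < U) :
    (U ^ (-q) + s)⁻¹ ≤ s⁻¹ := by
  have := Real.rpow_pos_of_pos hU (-q)
  exact inv_anti₀ hs (by linarith)

lemma envelopeRatio_le_one (q : ℝ) {s U : ℝ} (hs : 0 ≤ s) (hU : 0 < U) :
    envelopeRatio q s U ≤ 1 := by
  have h := one_sub_envelopeRatio q hs hU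
  have := mul_nonneg hs (inv_pos.2 (envelope_base_pos q hs hU)).le
  linarith

lemma envelope_le_rpow {q : ℝ} (hq : 0 < q) {s s' U : ℝ} (hs : 0 < s) (hss : s ≤ s') (hU : 0 < U) :
    envelope q s' U ≤ s ^ (-(1 / q)) := by
  have := Real.rpow_pos_of_pos hU (-q)
  have : 0 < 1 / q := by positivity
  exact Real.rpow_le_rpow_of_nonpos hs (by linarith) (by linarith)

/-- Before the nonlinear time scale `U ^ (-q)`, the envelope is comparable to `U`. -/
lemma mul_le_envelope {q : ℝ} (hq : 0 < q) {s U : ℝ} (hs : 0 ≤ s) (hU : 0 < U)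
    (h : s * U ^ q ≤ 1) : (1 / 2) ^ (1 / q) * U ≤ envelope q s U := by
  have hUq := Real.rpow_pos_of_pos hU q
  have e : U = (U ^ q) ^ (1 / q) := by
    rw [← Real.rpow_mul hU.le, mul_one_div_cancel hq.ne', Real.rpow_one]
  rw [envelope_eq q hs hU]
  nth_rewrite 1 [e]
  rw [← Real.mul_rpow (by norm_num) hUq.le]
  refine Real.rpow_le_rpow (by positivity) ?_ (by positivity)
  rw [le_div_iff₀ (by positivity)]
  nlinarith

variable {ψ ψ' : ℝ → ℝ} {K : ℝ} {N : ℕ}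

lemma SlowProfile.le_linU (h : SlowProfile ψ ψ' K N) {ε T : ℝ} (hε : 0 ≤ ε) (hT : 3 ≤ T) (x : ℝ) :
    ε * (5 / 32 * Real.exp (-1 / 2) / K * ψ x) ≤ Real.sqrt T * linU ε ψ T x := by
  have h1 := mul_le_mul_of_nonneg_left (h.le_kgLin hT x) (Real.exp_pos (-T / 2)).le
  have e : Real.exp (-T / 2) * Real.exp (T / 2) = 1 := by
    rw [← Real.exp_add, ← Real.exp_zero]
    congr 1
    ring
  have h2 := mul_le_mul_of_nonneg_left h1 hε
  calc ε * (5 / 32 * Real.exp (-1 / 2) / K * ψ x)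
      = ε * (5 / 32 * Real.exp (-1 / 2) / K * ψ x) * (Real.exp (-T / 2) * Real.exp (T / 2)) := by
        rw [e, mul_one]
    _ = ε * (Real.exp (-T / 2) * (5 / 32 * Real.exp (-1 / 2) / K * ψ x * Real.exp (T / 2))) := by
        ring
    _ ≤ _ := h2
    _ = _ := by rw [linU]; ring

lemma linU_le {M : ℝ} (h0 : ∀ x, 0 ≤ ψ x) (hM : ∀ x, ψ x ≤ M) {ε T : ℝ} (hε : 0 ≤ ε)
    (hT : 0 ≤ T) (x : ℝ) : linU ε ψ T x ≤ ε * (M * (1 + T + T ^ 2)) := by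
  have h1 := mul_le_mul_of_nonneg_left (kgLin_le_of_le h0 hM hT x) (Real.exp_pos (-T / 2)).le
  have e : Real.exp (-T / 2) * Real.exp (T / 2) = 1 := by
    rw [← Real.exp_add, ← Real.exp_zero]
    congr 1
    ring
  refine mul_le_mul_of_nonneg_left (h1.trans_eq ?_) hε
  rw [mul_left_comm, e, mul_one]

/-- The logarithmic time derivative of `superV` is `1 / 2`, from the factor `exp (t / 2)`, up to
terms that are small for large `T₀`. -/
lemma quarter_le_superVLogT {q T₀ ε L : ℝ} (hq : 0 < q) (hε : 0 < ε) (h : SlowProfile ψ ψ' K N)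
    (hL : ∀ t x, 4 ≤ t → |kgLinT ψ ψ' t x - 1 / 2 * kgLin ψ t x| ≤ L / Real.sqrt t * kgLin ψ t x)
    (hT4 : 4 ≤ T₀) (hTL : 64 * L ^ 2 ≤ T₀) (hTq : 8 / q ≤ T₀) (x : ℝ) :
    1 / 4 ≤ superVLogT q T₀ ε ψ ψ' 0 x := by
  have hT0 : 0 < T₀ := by linarith
  have hk := kgLin_pos h.pos hT0.le x
  have hU := linU_pos hε h.pos hT0.le x
  have h1 : |linUT ε ψ ψ' T₀ x / linU ε ψ T₀ x| ≤ 1 / 8 := by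
    have e : linUT ε ψ ψ' T₀ x / linU ε ψ T₀ x =
        (kgLinT ψ ψ' T₀ x - 1 / 2 * kgLin ψ T₀ x) / kgLin ψ T₀ x := by
      have := (Real.exp_pos (-T₀ / 2)).ne'
      have := hε.ne'
      rw [linUT, linU]
      field_simp
    have hs : 8 * L ≤ Real.sqrt T₀ := Real.le_sqrt_of_sq_le (by linarith)
    have hs0 := Real.sqrt_pos.2 hT0
    rw [e, abs_div, abs_of_pos hk, div_le_iff₀ hk]
    refine (hL T₀ x hT4).trans (mul_le_mul_of_nonneg_right ?_ hk.le)
    rw [div_le_iff₀ hs0]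
    linarith
  have h2 := envelopeRatio_pos q hT0.le hU
  have h3 := envelopeRatio_le_one q hT0.le hU
  have h4 : 1 / q * (linU ε ψ T₀ x ^ (-q) + T₀)⁻¹ ≤ 1 / 8 := by
    refine (mul_le_mul_of_nonneg_left (inv_envelope_base_le q hT0 hU) (by positivity)).trans ?_
    rw [div_le_iff₀ hq] at hTq
    rw [← one_div, div_mul_div_comm, one_mul, div_le_div_iff₀ (by positivity) (by norm_num)]
    linarith
  have h5 : -(1 / 8) ≤
      envelopeRatio q T₀ (linU ε ψ T₀ x) * (linUT ε ψ ψ' T₀ x / linU ε ψ T₀ x) := by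
    have := (abs_le.1 h1).1
    nlinarith
  rw [superVLogT, zero_add]
  linarith

lemma superV_nonneg {C q T₀ ε : ℝ} (hC : 0 ≤ C) (hε : 0 < ε) (hT : 0 ≤ T₀) (h : ∀ x, 0 < ψ x)
    {t : ℝ} (ht : 0 ≤ t) (x : ℝ) : 0 ≤ superV C q T₀ ε ψ t x :=
  mul_nonneg (Real.exp_pos _).le (mul_nonneg hC
    (envelope_pos q (add_nonneg ht hT) (linU_pos hε h (add_nonneg ht hT) x)).le)

lemma stripBounded_superV {C q T₀ ε : ℝ} (hC : 0 ≤ C) (hq : 0 < q) (hε : 0 < ε) (hT : 0 < T₀)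
    (hψ : Continuous ψ) (h : ∀ x, 0 < ψ x) : StripBounded (superV C q T₀ ε ψ) := by
  refine ⟨?_, fun T => ⟨Real.exp (T / 2) * (C * T₀ ^ (-(1 / q))), fun t x h0 htT => ?_⟩⟩
  · have hm : Measurable fun z : ℝ × ℝ => linU ε ψ (z.1 + T₀) z.2 :=
      ((continuous_linU hψ ε).comp (f := fun z : ℝ × ℝ => (z.1 + T₀, z.2)) (by fun_prop)).measurable
    refine Measurable.mul (by fun_prop) (measurable_const.mul (Measurable.pow_const ?_ _))
    exact (hm.pow_const _).add (by fun_prop)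
  · rw [abs_of_nonneg (superV_nonneg hC hε hT.le h h0 x), superV]
    have h1 := envelope_le_rpow hq hT (by linarith : T₀ ≤ t + T₀)
      (linU_pos hε h (by linarith : 0 ≤ t + T₀) x)
    have h2 : 0 ≤ C * T₀ ^ (-(1 / q)) := by positivity
    calc Real.exp (t / 2) * (C * envelope q (t + T₀) (linU ε ψ (t + T₀) x)) ≤
        Real.exp (t / 2) * (C * T₀ ^ (-(1 / q))) := by gcongr
      _ ≤ _ := by gcongr

/-- The supersolution is so small that `source (q + 1)` is increasing below it. -/
lemma superV_small {C q T₀ ε : ℝ} (hC : 0 ≤ C) (hq : 0 < q) (hε : 0 < ε) (hT : 0 < T₀)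
    (h : ∀ x, 0 < ψ x) (hTC : 4 * ((q + 1) * C ^ q) ≤ T₀) {t : ℝ} (ht : 0 ≤ t) (x : ℝ) :
    (q + 1) * (Real.exp (-t / 2) * superV C q T₀ ε ψ t x) ^ q ≤ 1 / 4 := by
  have hU := linU_pos hε h (by linarith : 0 ≤ t + T₀) x
  have e : Real.exp (-t / 2) * superV C q T₀ ε ψ t x =
      C * envelope q (t + T₀) (linU ε ψ (t + T₀) x) := by
    rw [superV, ← mul_assoc, ← Real.exp_add, show -t / 2 + t / 2 = 0 by ring, Real.exp_zero,
      one_mul]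
  have h1 : (linU ε ψ (t + T₀) x ^ (-q) + (t + T₀))⁻¹ ≤ T₀⁻¹ :=
    (inv_envelope_base_le q (by linarith) hU).trans (inv_anti₀ hT (by linarith))
  rw [e, Real.mul_rpow hC (envelope_pos q (by linarith) hU).le,
    envelope_rpow hq (by linarith) hU, ← mul_assoc]
  refine (mul_le_mul_of_nonneg_left h1 (by positivity)).trans ?_
  rw [← div_eq_mul_inv, div_le_iff₀ hT]
  linarith

/-- The initial data of the theorem lie below those of the supersolution. -/
lemma data_le_superV {C q T₀ ε κ : ℝ} {g : ℝ → ℝ} (hC : 0 ≤ C) (hq : 0 < q) (hε : 0 < ε)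
    (hT3 : 3 ≤ T₀) (h : SlowProfile ψ ψ' K N) (hκ : 0 < κ) (hg : ∀ x, g x ≤ κ * ψ x)
    (hTκ : (1 / 4 * ((1 / 2) ^ (1 / q) * (5 / 32 * Real.exp (-1 / 2) / K)) / κ) ^ (-(1 / q)) ≤ T₀)
    (hsmall : ∀ x, T₀ * linU ε ψ T₀ x ^ q ≤ 1) (x : ℝ) :
    C * (ε / T₀ ^ (q + 1 / 2)) * g x ≤ 1 / 4 * superV C q T₀ ε ψ 0 x := by
  have hT0 : 0 < T₀ := by linarith
  have hK : 0 < K := zero_lt_one.trans_le h.one_le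
  have hU := linU_pos hε h.pos hT0.le x
  have hs := Real.sqrt_pos.2 hT0
  have hE := Real.exp_pos (-1 / 2)
  have h2 : (0 : ℝ) < (1 / 2) ^ (1 / q) := Real.rpow_pos_of_pos (by norm_num) _
  have h1 := mul_le_envelope hq hT0.le hU (hsmall x)
  have h3 := h.le_linU hε.le hT3 x
  set a := 5 / 32 * Real.exp (-1 / 2) / K with ha
  have ha0 : 0 < a := by positivity
  have hψ := h.pos x
  set δ := 1 / 4 * ((1 / 2) ^ (1 / q) * a) / κ with hδ
  have hδ0 : 0 < δ := by positivity
  have h4 : (T₀ ^ q)⁻¹ ≤ δ := by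
    have h5 : (δ ^ (-(1 / q))) ^ q ≤ T₀ ^ q := Real.rpow_le_rpow (by positivity) hTκ hq.le
    rw [← Real.rpow_mul hδ0.le, show -(1 / q) * q = -1 by field_simp, Real.rpow_neg_one] at h5
    exact inv_le_of_inv_le₀ hδ0 h5
  have e : T₀ ^ (q + 1 / 2) = T₀ ^ q * Real.sqrt T₀ := by
    rw [Real.rpow_add hT0, Real.sqrt_eq_rpow]
  have hTq := Real.rpow_pos_of_pos hT0 q
  have h6 : ε / T₀ ^ (q + 1 / 2) * g x ≤ 1 / 4 * envelope q T₀ (linU ε ψ T₀ x) := by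
    calc ε / T₀ ^ (q + 1 / 2) * g x ≤ ε / T₀ ^ (q + 1 / 2) * (κ * ψ x) := by
          gcongr
          exact hg x
      _ = (T₀ ^ q)⁻¹ * κ * (ε * ψ x) / Real.sqrt T₀ := by
          rw [e]
          field_simp
      _ ≤ δ * κ * (ε * ψ x) / Real.sqrt T₀ := by gcongr
      _ = 1 / 4 * ((1 / 2) ^ (1 / q) * (ε * (a * ψ x))) / Real.sqrt T₀ := by
          rw [hδ]
          field_simp
      _ ≤ 1 / 4 * ((1 / 2) ^ (1 / q) * (Real.sqrt T₀ * linU ε ψ T₀ x)) / Real.sqrt T₀ := by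
          gcongr
      _ = 1 / 4 * ((1 / 2) ^ (1 / q) * linU ε ψ T₀ x) := by field_simp
      _ ≤ _ := by gcongr
  rw [superV, zero_add, zero_div, Real.exp_zero, one_mul]
  calc C * (ε / T₀ ^ (q + 1 / 2)) * g x = C * (ε / T₀ ^ (q + 1 / 2) * g x) := by ring
    _ ≤ C * (1 / 4 * envelope q T₀ (linU ε ψ T₀ x)) := by gcongr
    _ = _ := by ring

/-! ### The comparison theorem -/

/-- A mild solution whose data lie below those of the supersolution stays below it. -/
lemma IsMildSolution.le_envelope {q : ℝ} (hq : 0 < q) {u₀ u₁ : ℝ → ℝ} {u : ℝ → ℝ → ℝ}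
    (hu : IsMildSolution (q + 1) u₀ u₁ u) {f g : ℝ → ℝ} {b : ℝ} (hf : Continuous f)
    (hf0 : u₀ =ᵐ[volume] f) (hg : Measurable g)
    (hg1 : (fun y => u₁ y + 1 / 2 * u₀ y) =ᵐ[volume] g) (hfn : ∀ x, 0 ≤ f x) (hfb : ∀ x, f x ≤ b)
    (hgn : ∀ x, 0 ≤ g x) (hgb : ∀ x, g x ≤ b) {C T₀ ε L : ℝ} (hC0 : 0 < C) (hε : 0 < ε)
    (h : SlowProfile ψ ψ' K N) (hL0 : 0 ≤ L)
    (hL : ∀ t x, 4 ≤ t → |kgLinT ψ ψ' t x - 1 / 2 * kgLin ψ t x| ≤ L / Real.sqrt t * kgLin ψ t x)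
    (hC : 1 / q + (q + 1) * L ^ 2 + 2 * (1 + 1 / q) * L ≤ C ^ q)
    (hT4 : 4 ≤ T₀) (hTL : 64 * L ^ 2 ≤ T₀) (hTq : 8 / q ≤ T₀) (hTC : 4 * ((q + 1) * C ^ q) ≤ T₀)
    (hfV : ∀ x, f x ≤ 1 / 4 * superV C q T₀ ε ψ 0 x)
    (hgV : ∀ x, g x ≤ 1 / 4 * superV C q T₀ ε ψ 0 x) {t : ℝ} (ht : 0 ≤ t) :
    ∀ᵐ x : ℝ, u t x ≤ C * envelope q (t + T₀) (linU ε ψ (t + T₀) x) := by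
  have hT0 : 0 < T₀ := by linarith
  obtain ⟨v, sv, hv0, hvM, hvu, heq⟩ := hu.exists_wave_form (by linarith) hf hf0 hg hg1 hfn hfb
    hgn hgb
  have hV0 := fun t x (ht : 0 ≤ t) =>
    superV_nonneg (q := q) hC0.le hε hT0.le h.pos ht x
  have hdata : ∀ t x, 0 ≤ t → waveData f g t x ≤
      1 / 2 * (superV C q T₀ ε ψ 0 (x + t) + superV C q T₀ ε ψ 0 (x - t)) +
      1 / 2 * ∫ z in (x - t)..(x + t), superV C q T₀ ε ψ 0 z * superVLogT q T₀ ε ψ ψ' 0 z := by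
    intro t x ht
    obtain ⟨cV, cT, -, -⟩ := continuousOn_superV (q := q) hε hT0 h C
    have hc : Continuous fun z => superV C q T₀ ε ψ 0 z * superVLogT q T₀ ε ψ ψ' 0 z :=
      (cV.mul cT).comp_continuous (f := fun z => ((0 : ℝ), z)) (by fun_prop)
        fun z => ⟨mem_Ici.2 le_rfl, mem_univ z⟩
    have h1 := hfV (x + t)
    have h2 := hfV (x - t)
    have h3 := hV0 0 (x + t) le_rfl
    have h4 := hV0 0 (x - t) le_rfl
    have h5 : ∫ z in (x - t)..(x + t), g z ≤
        ∫ z in (x - t)..(x + t), superV C q T₀ ε ψ 0 z * superVLogT q T₀ ε ψ ψ' 0 z := by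
      refine intervalIntegral.integral_mono_on (by linarith)
        (intervalIntegrable_of_bounded hg.aestronglyMeasurable fun z _ =>
          (abs_of_nonneg (hgn z)).trans_le (hgb z)) (hc.intervalIntegrable _ _) fun z _ => ?_
      have h6 := quarter_le_superVLogT hq hε h hL hT4 hTL hTq z
      have h7 := mul_le_mul_of_nonneg_left h6 (hV0 0 z le_rfl)
      linarith [hgV z]
    rw [waveData]
    linarith
  filter_upwards [heq t ht] with x hx
  have h1 := coneInt_source_le (p := q + 1) (by linarith) sv
    (stripBounded_superV hC0.le hq hε hT0 h.continuous h.pos) hv0 hV0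
    ((hfn 0).trans (hfb 0)) hvM
    (fun t x ht => by
      rw [add_sub_cancel_right]
      exact superV_small hC0.le hq hε hT0 h.pos hTC ht x)
    (by
      filter_upwards [hvu] with t h1 h0
      filter_upwards [h1 h0, heq t h0] with x h2 h3
      rw [h2, h3])
    (fun t x ht => superV_ge hq hε hT4 hC0 h hL0 hL hC ht x) hdata ht x
  have h2 := superV_ge hq hε hT4 hC0 h hL0 hL hC ht x
  have h3 := hdata t x ht
  have h4 : Real.exp (t / 2) * u t x ≤ superV C q T₀ ε ψ t x := by
    rw [hx]
    linarith
  exact le_of_mul_le_mul_left h4 (Real.exp_pos _)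

end

end DampedWave

end

theorem theorem1p1 (p : ℝ) (hp : 1 < p) (φ φ' : ℝ → ℝ)
    (hφ : DampedWave.MemW1With φ φ') (hφpos : ∀ᵐ x : ℝ, 0 < φ x)
    (hcomp : ∃ K : ℝ,
      (∀ᵐ x : ℝ, ∀ᵐ y : ℝ, y ∈ Ioo (x - 1) (x + 1) → φ x ≤ K * φ y) ∧
      (∀ᵐ x : ℝ, ∀ᵐ y : ℝ, |y| < 2 * |x| → φ x ≤ K * φ y) ∧
      (∀ᵐ x : ℝ, |φ' x| ≤ K * φ x))
    (hlower : ∀ δ : ℝ, 0 < δ → ∃ K : ℝ, 0 < K ∧ ∀ᵐ x : ℝ, Real.exp (-δ * |x|) ≤ K * φ x) :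
    ∃ C : ℝ, 0 < C ∧ ∃ Tmin : ℝ, 0 < Tmin ∧ ∀ T₀ : ℝ, Tmin ≤ T₀ →
      ∃ εmax : ℝ, 0 < εmax ∧ ∀ ε₀ : ℝ, 0 < ε₀ → ε₀ ≤ εmax →
        ∀ u₀ u₁ : ℝ → ℝ, DampedWave.MemW1 u₀ → MemLp u₁ 1 volume → MemLp u₁ ∞ volume →
          (∀ᵐ x : ℝ, 0 ≤ u₀ x ∧ u₀ x ≤ C * (ε₀ / T₀ ^ (p - 1 / 2)) * φ x) →
          (∀ᵐ x : ℝ, 0 ≤ u₁ x + 1 / 2 * u₀ x ∧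
            u₁ x + 1 / 2 * u₀ x ≤ C * (ε₀ / T₀ ^ (p - 1 / 2)) * φ x) →
          ∀ u : ℝ → ℝ → ℝ, DampedWave.IsMildSolution p u₀ u₁ u →
            ∀ t : ℝ, 0 ≤ t → ∀ᵐ x : ℝ,
              0 ≤ u t x ∧
              u t x ≤ C * (DampedWave.uL ε₀ φ (t + T₀) x ^ (p - 1) /
                ((t + T₀) * DampedWave.uL ε₀ φ (t + T₀) x ^ (p - 1) + 1)) ^ (1 / (p - 1)) := by
  obtain ⟨K₀, hnear, hdoub, -⟩ := hcomp
  obtain ⟨q, rfl⟩ : ∃ q : ℝ, p = q + 1 := ⟨p - 1, by ring⟩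
  have hq : 0 < q := by linarith
  obtain ⟨g, K, M, hg, hφg, hK, hg0, hgM, hgn, hgd⟩ :=
    DampedWave.exists_continuous_profile hφ.1 hφ.2.2.1 hφpos hnear hdoub
  obtain ⟨ψ, ψ', K', N, hψ, hψg, hgψ⟩ := DampedWave.exists_slowProfile hg hK hg0 hgM hgn hgd
  obtain ⟨L, hL0, hL⟩ := hψ.exists_abs_kgLinT_sub_le
  have hM : 0 < M := (hg0 0).trans_le (hgM 0)
  have hK' : 0 < K' := zero_lt_one.trans_le hψ.one_le
  set Λ := 1 / q + (q + 1) * L ^ 2 + 2 * (1 + 1 / q) * L with hΛ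
  have hΛ0 : 0 < Λ := by positivity
  have hC0 : 0 < Λ ^ (1 / q) := Real.rpow_pos_of_pos hΛ0 _
  have hCq : Λ ≤ (Λ ^ (1 / q)) ^ q := by
    rw [← Real.rpow_mul hΛ0.le, one_div_mul_cancel hq.ne', Real.rpow_one]
  set C := Λ ^ (1 / q) with hC
  set δ := (1 / 4 * ((1 / 2) ^ (1 / q) * (5 / 32 * Real.exp (-1 / 2) / K')) / K ^ 2) ^ (-(1 / q))
    with hδ
  have hδ0 : 0 ≤ δ := by positivity
  have hTL0 : 0 ≤ 64 * L ^ 2 := by positivity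
  have hTq0 : 0 ≤ 8 / q := by positivity
  have hTC0 : 0 ≤ 4 * ((q + 1) * C ^ q) := by positivity
  -- Each summand of `Tmin` serves one of the lower bounds on `T₀` needed below.
  refine ⟨C, hC0, 4 + 64 * L ^ 2 + 8 / q + 4 * ((q + 1) * C ^ q) + δ, by linarith,
    fun T₀ hT₀ => ?_⟩
  have hT0 : 0 < T₀ := by linarith
  have hD : 0 < M * (1 + T₀ + T₀ ^ 2) := by positivity
  have hTr : 0 < T₀ ^ (-(1 / q)) := Real.rpow_pos_of_pos hT0 _
  -- With this `εmax` the envelope at time `T₀` is still comparable to `U`.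
  refine ⟨T₀ ^ (-(1 / q)) / (M * (1 + T₀ + T₀ ^ 2)), by positivity, ?_⟩
  intro ε hε hεmax u₀ u₁ hu₀ hu₁ _ hdata₀ hdata₁ u hu t ht
  rw [show q + 1 - 1 / 2 = q + 1 / 2 by ring] at hdata₀ hdata₁
  have hsmall : ∀ x, T₀ * DampedWave.linU ε ψ T₀ x ^ q ≤ 1 := fun x => by
    have hU := DampedWave.linU_pos hε hψ.pos hT0.le x
    have h1 : DampedWave.linU ε ψ T₀ x ≤ T₀ ^ (-(1 / q)) :=
      (DampedWave.linU_le (fun x => (hψ.pos x).le) (fun x => (hψg x).trans (hgM x)) hε.le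
        hT0.le x).trans ((le_div_iff₀ hD).1 hεmax)
    have h2 := Real.rpow_le_rpow hU.le h1 hq.le
    rw [← Real.rpow_mul hT0.le, show -(1 / q) * q = -1 by field_simp, Real.rpow_neg_one] at h2
    calc T₀ * DampedWave.linU ε ψ T₀ x ^ q ≤ T₀ * T₀⁻¹ := by gcongr
      _ = 1 := mul_inv_cancel₀ hT0.ne'
  set B : ℝ → ℝ := fun x => C * (ε / T₀ ^ (q + 1 / 2)) * g x with hB
  have hB0 : 0 < C * (ε / T₀ ^ (q + 1 / 2)) := by
    have := Real.rpow_pos_of_pos hT0 (q + 1 / 2)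
    positivity
  have hBn : ∀ x, 0 ≤ B x := fun x => (mul_pos hB0 (hg0 x)).le
  have hBc : Continuous B := by fun_prop
  have hBM : ∀ x, B x ≤ C * (ε / T₀ ^ (q + 1 / 2)) * M := fun x =>
    mul_le_mul_of_nonneg_left (hgM x) hB0.le
  have hBV : ∀ x, B x ≤ 1 / 4 * DampedWave.superV C q T₀ ε ψ 0 x :=
    DampedWave.data_le_superV hC0.le hq hε (by linarith) hψ (by positivity) hgψ (by linarith)
      hsmall
  obtain ⟨u₀', hu₀'⟩ := hu₀
  obtain ⟨f, hf, hf0⟩ := hu₀'.1.exists_continuous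
  have hfn : ∀ x, 0 ≤ f x := fun x => by
    refine DampedWave.le_of_ae_le isOpen_univ continuous_const hf ?_ x (mem_univ x)
    filter_upwards [hdata₀, hf0] with y h1 h2 _
    rw [← h2]
    exact h1.1
  have hfB : ∀ x, f x ≤ B x := fun x => by
    refine DampedWave.le_of_ae_le isOpen_univ hf hBc ?_ x (mem_univ x)
    filter_upwards [hdata₀, hf0, hφg] with y h1 h2 h3 _
    rw [← h2]
    simp only [hB]
    rw [← h3]
    exact h1.2
  obtain ⟨k, hk, hk1, hkn, hkB⟩ := DampedWave.exists_measurable_between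
    (f := fun y => u₁ y + 1 / 2 * u₀ y)
    (hu₁.aestronglyMeasurable.add (hu₀'.2.1.aestronglyMeasurable.const_mul _)) hBc hBn (by
      filter_upwards [hdata₁, hφg] with y h1 h2
      simp only [hB]
      rw [← h2]
      exact h1)
  filter_upwards [hu.nonneg t ht, hu.le_envelope hq hf hf0 hk hk1 hfn
    (fun x => (hfB x).trans (hBM x)) hkn (fun x => (hkB x).trans (hBM x)) hC0 hε hψ hL0.le hL hCq
    (by linarith) (by linarith) (by linarith) (by linarith) (fun x => (hfB x).trans (hBV x))
    (fun x => (hkB x).trans (hBV x)) ht] with x h1 h2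
  have htT : 0 ≤ t + T₀ := by linarith
  have hU := DampedWave.linU_pos hε hψ.pos htT x
  have e : DampedWave.uL ε φ (t + T₀) x = DampedWave.linU ε g (t + T₀) x := by
    have : DampedWave.uL ε φ (t + T₀) x = DampedWave.uL ε g (t + T₀) x := by
      rw [DampedWave.uL, DampedWave.uL, DampedWave.S_congr_ae hφg, DampedWave.dtS_congr_ae hφg]
    rw [this, DampedWave.uL_eq_kgLin hg, DampedWave.linU]
  have hle : DampedWave.linU ε ψ (t + T₀) x ≤ DampedWave.linU ε g (t + T₀) x :=
    mul_le_mul_of_nonneg_left (mul_le_mul_of_nonneg_left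
      (DampedWave.kgLin_mono hψ.continuous hg hψg htT x) (Real.exp_pos _).le) hε.le
  refine ⟨h1, h2.trans ?_⟩
  rw [e, add_sub_cancel_right, ← DampedWave.envelope_eq q htT (hU.trans_le hle)]
  exact mul_le_mul_of_nonneg_left (DampedWave.envelope_mono hq htT hU hle) hC0.le
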